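/- **Setting.** Let $\mathbb S$ be a commutative semiring and $\mathcal N$ a finite set of free names. Polarities are $+,-$, with $\bar\varepsilon$ the opposite of $\varepsilon$; locations are natural numbers. *Calculus.* Terms of the $\pi$-calculus with internal mobility are given by branchings $S,T ::= {}^{\iota}u^\varepsilon(x).P \mid S+T$ and processes $P,Q ::= \lambda\in\mathbb S \mid S \mid P|Q \mid (\nu x)P$, up to renaming of bound names ($x$ is bound in $u^\varepsilon(x).P$ and in $(\nu x)P$); all locations in a term are distinct. Transitions have labels $u^\varepsilon(x)_\iota$ (visible) or $(\iota,\kappa)$ (internal): ${}^\iota\alpha.P\to P$ with label $\alpha_\iota$; if $P\to P'$ by $u^\varepsilon(x)_\iota$ and $Q\to Q'$ by $u^{\bar\varepsilon}(y)_\kappa$ then $P|Q\to(\nu x)(P'|Q'[x/y])$ by $(\iota,\kappa)$; transitions are closed under both sides of $+$ and $|$, and under $(\nu x)$ for labels in which $x$ does not occur. An *interaction* of $P$ is a finite sequence of labels of consecutive transitions from $P$. Two labels are *independent* in $P$ if all their locations are distinct and no action at one of them lies in $P$ in the continuation of the action at another. *Homotopy* is the equivalence on interactions of $P$ generated by exchanging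 consecutive independent labels. A *pre-trace* is a homotopy class of interactions; a *run* is a homotopy class of maximal sequences of internal transitions. $P/\rho$ is the term reached by $\rho$ (unique up to commutation of restrictions). The state is $s(\lambda)=\lambda$, $s(S)=1$, $s((\nu x)P)=s(P)$, $s(P|Q)=s(P)s(Q)$, and the *outcome* of $P$ is $\langle P\rangle=\sum_{\rho}s(P/\rho)$ over the runs $\rho$ of $P$. *Simple terms* are generated by $1$, non-empty sums $\sum_i\alpha_i.0$, linear actions $\hat\alpha.P:=(\nu w)(\alpha.(P|w.1)\,|\,w.0\,|\,\bar w.1)$ with $w$ fresh, $P|Q$ and $(\nu x)P$. An *inaction* is a subterm $\alpha.0$. A pre-trace $\rho$ of a simple term is *exhaustive* if it triggers all linear actions (that is, the action $w.1$ of each) and no inaction, and $P/\rho$ has no subterm $Q|R$ with $Q$ containing some $u^\varepsilon(x).0$ and $R$ containing some $u^{\bar\varepsilon}(y).0$. *Order algebra.* An arena is a countable set (web) with a group $G$ of permutations of it. A play $r$ is a preorder on a finite subset $|r|$ of the web, consistent if it is antisymmetric. For $|r|=|s|$, the play $r\cdot s$ is the reflexive transitive closure of the union of the two preorders. The multiplicity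 $\mu(s)$ is the index of the pointwise stabilizer of $|s|$ in the stabilizer of $s$ in $G$. On the free $\mathbb S$-semimodule over plays, the outcome $\langle\cdot\rangle$ is the linear form with value $1$ on consistent plays and $0$ on the others, and permuted synchronisation is the bilinear operation with $r\circledast s=\mu(s)\sum_{s'\in Gs,\ |s'|=|r|} r\cdot s'$. *The arena $E$.* Abstract channels are the words $x=u\cdot\varepsilon_1n_1\cdots\varepsilon_kn_k$ with $u\in\mathcal N$, $n_i\in\mathbb N$ and $\varepsilon_i$ polarities; $u$ itself stands for the free name, and $x\cdot\varepsilon n$ stands for the name bound by the action of polarity $\varepsilon$ at location $n$ with subject $x$. Events of $E$ are the words $x\cdot\varepsilon n$, $x\cdot\varepsilon\bot$ and $x\cdot\varepsilon\top$. The group is generated by the permutations $(x,\varepsilon,\sigma)$, for $x$ a channel, $\varepsilon$ a polarity and $\sigma$ a permutation of $\mathbb N$, which map $x\cdot\varepsilon n\cdot z$ to $x\cdot\varepsilon\sigma(n)\cdot z$ ($n\in\mathbb N$, $z$ empty or any continuation) and fix all other events. *Induced trace.* For a pre-trace $\rho$, with revealed names written as abstract channels, $\rho^*$ is the play on $E$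 whose support consists of the $x\cdot\varepsilon n$ such that $\rho$ contains the visible action of subject $x$ and polarity $\varepsilon$ at location $n$, and of $x\cdot\varepsilon\bot$ and $x\cdot\varepsilon\top$ for all $\varepsilon$ and all $x$ that is in $\mathcal N$ or is revealed by a visible action of $\rho$. Its order is the causal order of $\rho$ ($a\le b$ if $a=b$ or $a$ occurs before $b$ in all interactions in $\rho$) on visible actions, augmented with $x\cdot\varepsilon\bot<x\cdot\varepsilon\top$ for each inaction of polarity $\varepsilon$ on the name $x$ that occurs in $P/\rho$. **Proposition.** For a simple term $P$ and a play $t$ on $E$, let $[P](t)\in\mathbb S$ be the number of exhaustive pre-traces $\rho$ of $P$ with $\rho^*=t$. Then $[P]$ has finite support, hence is a vector of the free semimodule over plays on $E$. Let $v\mapsto\bar v$ be the linear map on vectors induced by the map on events that inverts all polarities and exchanges $\bot$ and $\top$. Then for all simple terms $P,Q$ with free names in $\mathcal N$ (such that $P|Q$ is a term, i.e. all its locations are distinct), $$\langle P|Q\rangle=\big\langle [P]\circledast\overline{[Q]}\big\rangle .$$ -/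

import Mathlib

universe u v

/-! # Order algebras -/

namespace OrderAlgebra

/-- An arena: a countable web of events with a group of permutations of the web. -/
structure Arena where
  web : Type u
  countable_web : Countable web
  group : Subgroup (Equiv.Perm web)

/-- A play: a preorder on a finite subset of the web. -/
@[ext]
structure Play (X : Arena.{u}) where
  support : Finset X.web
  rel : X.web → X.web → Prop
  rel_mem : ∀ {x y}, rel x y → x ∈ support ∧ y ∈ support
  refl : ∀ {x}, x ∈ support → rel x x
  trans : ∀ {x y z}, rel x y → rel y z → rel x z

namespace Play

variable {X : Arena.{u}}

/-- A play is consistent when its preorder is a partial order. -/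
def Consistent (r : Play X) : Prop :=
  ∀ x y, r.rel x y → r.rel y x → x = y

/-- The play on the finite set `A` whose preorder is the reflexive transitive closure, on `A`,
of the relation `R`. -/
def generate (A : Finset X.web) (R : X.web → X.web → Prop) : Play X where
  support := A
  rel x y := x ∈ A ∧ Relation.ReflTransGen (fun a b => a ∈ A ∧ b ∈ A ∧ R a b) x y
  rel_mem := by
    rintro x y ⟨hx, h⟩
    refine ⟨hx, ?_⟩
    induction h with
    | refl => exact hx
    | tail _ h _ => exact h.2.1
  refl := fun hx => ⟨hx, Relation.ReflTransGen.refl⟩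
  trans := fun h h2 => ⟨h.1, h.2.trans h2.2⟩

/-- Synchronisation of two plays with the same support. -/
def sync (r s : Play X) (_h : s.support = r.support) : Play X :=
  generate r.support (fun x y => r.rel x y ∨ s.rel x y)

/-- The image of a play under a permutation of the web. -/
def map (σ : Equiv.Perm X.web) (r : Play X) : Play X where
  support := r.support.map σ.toEmbedding
  rel x y := r.rel (σ.symm x) (σ.symm y)
  rel_mem := by
    intro x y h
    have := r.rel_mem h
    simpa [Finset.mem_map_equiv] using this
  refl := by
    intro x h
    exact r.refl (by simpa [Finset.mem_map_equiv] using h)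
  trans := fun h h2 => r.trans h h2

/-- Permutations of the web act on plays. -/
instance : MulAction (Equiv.Perm X.web) (Play X) where
  smul := map
  one_smul := by
    intro r
    change map 1 r = r
    ext x y
    · change x ∈ r.support.map _ ↔ _
      rw [Finset.mem_map_equiv]
      rfl
    · exact Iff.rfl
  mul_smul := by
    intro σ τ r
    change map (σ * τ) r = map σ (map τ r)
    ext x y
    · change x ∈ r.support.map _ ↔ x ∈ (r.support.map _).map _
      rw [Finset.mem_map_equiv, Finset.mem_map_equiv, Finset.mem_map_equiv]
      rfl
    · exact Iff.rfl

/-- The multiplicity of a play: the index of the pointwise stabilizer of its support in its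
stabilizer, both taken in the group of the arena. -/
noncomputable def multiplicity (r : Play X) : ℕ :=
  (fixingSubgroup X.group (r.support : Set X.web)).relIndex (MulAction.stabilizer X.group r)

/-- The plays in the orbit of `s` with support `A`. -/
abbrev OrbitOn (s : Play X) (A : Finset X.web) : Type u :=
  {t : Play X // t ∈ MulAction.orbit X.group s ∧ t.support = A}

instance (s : Play X) (A : Finset X.web) : Finite (OrbitOn s A) := by
  classical
  let f : OrbitOn s A → (A → A → Prop) := fun t a b => t.1.rel a b
  refine Finite.of_injective f ?_
  rintro ⟨t, _, ht⟩ ⟨t2, _, ht2⟩ h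
  have key : ∀ x y, x ∈ A → y ∈ A → (t.rel x y ↔ t2.rel x y) := by
    intro x y hx hy
    have := congrFun (congrFun h ⟨x, hx⟩) ⟨y, hy⟩
    exact iff_of_eq this
  have h1 : t = t2 := by
    ext x y
    · rw [ht, ht2]
    · constructor
      · intro hr
        have hm := t.rel_mem hr
        rw [ht] at hm
        exact (key x y hm.1 hm.2).1 hr
      · intro hr
        have hm := t2.rel_mem hr
        rw [ht2] at hm
        exact (key x y hm.1 hm.2).2 hr
  exact Subtype.ext h1

end Play

section Algebra

variable (𝕊 : Type v) [CommSemiring 𝕊] (X : Arena.{u})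

/-- The preliminary order algebra: the free semimodule over the plays. -/
abbrev PreOrderAlgebra : Type (max u v) := Play X →₀ 𝕊

open scoped Classical in
/-- The outcome: the linear form with value `1` at consistent plays and `0` at the others. -/
noncomputable def outcome : PreOrderAlgebra 𝕊 X →ₗ[𝕊] 𝕊 :=
  Finsupp.linearCombination 𝕊 (fun r : Play X => if r.Consistent then (1 : 𝕊) else 0)

variable {X}

/-- Permuted synchronisation of two plays (a finite sum). -/
noncomputable def psyncPlay (r s : Play X) : PreOrderAlgebra 𝕊 X :=
  s.multiplicity • ∑ᶠ t : s.OrbitOn r.support, Finsupp.single (r.sync t.1 t.2.2) (1 : 𝕊)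

variable (X)

/-- Permuted synchronisation, as a bilinear operator. -/
noncomputable def psync :
    PreOrderAlgebra 𝕊 X →ₗ[𝕊] PreOrderAlgebra 𝕊 X →ₗ[𝕊] PreOrderAlgebra 𝕊 X :=
  Finsupp.linearCombination 𝕊 (fun r : Play X =>
    Finsupp.linearCombination 𝕊 (fun s : Play X => psyncPlay 𝕊 r s))

end Algebra

end OrderAlgebra

/-! # The π-calculus with internal mobility, with outcomes and locations -/

namespace PiI

/-- Polarities. -/
inductive Pola : Type
  | pos
  | neg
  deriving DecidableEq

namespace Pola

/-- The opposite polarity. -/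
def op : Pola → Pola
  | pos => neg
  | neg => pos

@[simp] theorem op_op (ε : Pola) : ε.op.op = ε := by cases ε <;> rfl

instance : Finite Pola :=
  Finite.of_injective (fun ε : Pola => decide (ε = pos)) (by
    intro a b h; cases a <;> cases b <;> simp_all)

end Pola

/-- The two syntactic categories. -/
inductive Kind : Type
  | branching
  | proc

/-- Terms with outcomes in `𝕊` whose free names are taken in the type `V`.
Terms are considered up to renaming of bound names: in the body of a binder, the free names are
taken in `Option V`, where `none` is the bound name. Locations are natural numbers. -/
inductive Term (𝕊 : Type v) : Kind → Type u → Type (max (u + 1) v)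
  /-- the action with location `ι`, subject `a`, polarity `ε`, which binds a name in `P` -/
  | act {V : Type u} (ι : ℕ) (a : V) (ε : Pola) (P : Term 𝕊 Kind.proc (Option V)) :
      Term 𝕊 Kind.branching V
  /-- external choice -/
  | sum {V : Type u} (S T : Term 𝕊 Kind.branching V) : Term 𝕊 Kind.branching V
  /-- outcome -/
  | out {V : Type u} (c : 𝕊) : Term 𝕊 Kind.proc V
  /-- a branching is a process -/
  | br {V : Type u} (S : Term 𝕊 Kind.branching V) : Term 𝕊 Kind.proc V
  /-- parallel composition -/
  | par {V : Type u} (P Q : Term 𝕊 Kind.proc V) : Term 𝕊 Kind.proc V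
  /-- hiding of a name -/
  | new {V : Type u} (P : Term 𝕊 Kind.proc (Option V)) : Term 𝕊 Kind.proc V

namespace Term

variable {𝕊 : Type v}

/-- Renaming of free names. -/
def rename : {k : Kind} → {V : Type u} → Term 𝕊 k V → {W : Type u} → (V → W) → Term 𝕊 k W
  | _, _, act ι a ε P, _, f => act ι (f a) ε (rename P (Option.map f))
  | _, _, sum S T, _, f => sum (rename S f) (rename T f)
  | _, _, out c, _, _ => out c
  | _, _, br S, _, f => br (rename S f)
  | _, _, par P Q, _, f => par (rename P f) (rename Q f)
  | _, _, new P, _, f => new (rename P (Option.map f))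

/-- The locations that occur in a term, with repetitions. -/
def locs : {k : Kind} → {V : Type u} → Term 𝕊 k V → List ℕ
  | _, _, act ι _ _ P => ι :: locs P
  | _, _, sum S T => locs S ++ locs T
  | _, _, out _ => []
  | _, _, br S => locs S
  | _, _, par P Q => locs P ++ locs Q
  | _, _, new P => locs P

/-- Strict prefixing: the action at location `κ` occurs in the continuation of the action at
location `ι`. -/
def Prefixing (ι κ : ℕ) : {k : Kind} → {V : Type u} → Term 𝕊 k V → Prop
  | _, _, act ι' _ _ P => (ι = ι' ∧ κ ∈ locs P) ∨ Prefixing ι κ P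
  | _, _, sum S T => Prefixing ι κ S ∨ Prefixing ι κ T
  | _, _, out _ => False
  | _, _, br S => Prefixing ι κ S
  | _, _, par P Q => Prefixing ι κ P ∨ Prefixing ι κ Q
  | _, _, new P => Prefixing ι κ P

/-- The state of a process; that of a branching is `1`. -/
def state [CommSemiring 𝕊] : {k : Kind} → {V : Type u} → Term 𝕊 k V → 𝕊
  | _, _, act _ _ _ _ => 1
  | _, _, sum _ _ => 1
  | _, _, out c => c
  | _, _, br _ => 1
  | _, _, par P Q => state P * state Q
  | _, _, new P => state P

/-- The term contains an inaction `a^ε.0` on its free name `a`. -/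
def HasInaction [Zero 𝕊] (ε : Pola) : {k : Kind} → {V : Type u} → (a : V) → Term 𝕊 k V → Prop
  | _, _, a, act _ b η P => (b = a ∧ η = ε ∧ P = out 0) ∨ HasInaction ε (some a) P
  | _, _, a, sum S T => HasInaction ε a S ∨ HasInaction ε a T
  | _, _, _, out _ => False
  | _, _, a, br S => HasInaction ε a S
  | _, _, a, par P Q => HasInaction ε a P ∨ HasInaction ε a Q
  | _, _, a, new P => HasInaction ε (some a) P

/-- Some sub-term has the form `Q | R` where `Q` contains an inaction `a^ε.0` and `R` contains the
dual inaction. -/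
def HasDualInactions [Zero 𝕊] : {k : Kind} → {V : Type u} → Term 𝕊 k V → Prop
  | _, _, act _ _ _ P => HasDualInactions P
  | _, _, sum S T => HasDualInactions S ∨ HasDualInactions T
  | _, _, out _ => False
  | _, _, br S => HasDualInactions S
  | _, V, par P Q => HasDualInactions P ∨ HasDualInactions Q ∨
      ∃ (a : V) (ε : Pola), HasInaction ε a P ∧ HasInaction ε.op a Q
  | _, _, new P => HasDualInactions P

end Term

/-- Exchange of the two innermost bound names. -/
def swapNames {V : Type u} : Option (Option V) → Option (Option V)
  | none => some none
  | some none => none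
  | some (some a) => some (some a)

/-- Visible transitions: `VTrans P a ε ι P'` means that `P` can perform the action of subject `a`
and polarity `ε` at location `ι` and become `P'`, where the revealed object of the action is the
name `none` of `P'`. Under a hiding, the subject of the action is not the hidden name. -/
inductive VTrans {𝕊 : Type v} : {k : Kind} → {V : Type u} →
    Term 𝕊 k V → V → Pola → ℕ → Term 𝕊 Kind.proc (Option V) → Prop
  | act {V : Type u} {ι : ℕ} {a : V} {ε : Pola} {P : Term 𝕊 Kind.proc (Option V)} :
      VTrans (Term.act ι a ε P) a ε ι P
  | sumLeft {V : Type u} {S T : Term 𝕊 Kind.branching V} {a : V} {ε : Pola} {ι : ℕ}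
      {P' : Term 𝕊 Kind.proc (Option V)} :
      VTrans S a ε ι P' → VTrans (Term.sum S T) a ε ι P'
  | sumRight {V : Type u} {S T : Term 𝕊 Kind.branching V} {a : V} {ε : Pola} {ι : ℕ}
      {P' : Term 𝕊 Kind.proc (Option V)} :
      VTrans T a ε ι P' → VTrans (Term.sum S T) a ε ι P'
  | br {V : Type u} {S : Term 𝕊 Kind.branching V} {a : V} {ε : Pola} {ι : ℕ}
      {P' : Term 𝕊 Kind.proc (Option V)} :
      VTrans S a ε ι P' → VTrans (Term.br S) a ε ι P'
  | parLeft {V : Type u} {P Q : Term 𝕊 Kind.proc V} {a : V} {ε : Pola} {ι : ℕ}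
      {P' : Term 𝕊 Kind.proc (Option V)} :
      VTrans P a ε ι P' → VTrans (Term.par P Q) a ε ι (Term.par P' (Q.rename some))
  | parRight {V : Type u} {P Q : Term 𝕊 Kind.proc V} {a : V} {ε : Pola} {ι : ℕ}
      {Q' : Term 𝕊 Kind.proc (Option V)} :
      VTrans Q a ε ι Q' → VTrans (Term.par P Q) a ε ι (Term.par (P.rename some) Q')
  | new {V : Type u} {P : Term 𝕊 Kind.proc (Option V)} {a : V} {ε : Pola} {ι : ℕ}
      {P' : Term 𝕊 Kind.proc (Option (Option V))} :
      VTrans P (some a) ε ι P' → VTrans (Term.new P) a ε ι (Term.new (P'.rename swapNames))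

/-- Internal transitions: `ITrans P ι κ P'` means that `P` becomes `P'` when its actions at the
locations `ι` and `κ` synchronise. (A branching has no internal transition.) -/
inductive ITrans {𝕊 : Type v} : {V : Type u} →
    Term 𝕊 Kind.proc V → ℕ → ℕ → Term 𝕊 Kind.proc V → Prop
  | sync {V : Type u} {P Q : Term 𝕊 Kind.proc V} {a : V} {ε : Pola} {ι κ : ℕ}
      {P' Q' : Term 𝕊 Kind.proc (Option V)} :
      VTrans P a ε ι P' → VTrans Q a ε.op κ Q' →
      ITrans (Term.par P Q) ι κ (Term.new (Term.par P' Q'))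
  | parLeft {V : Type u} {P Q P' : Term 𝕊 Kind.proc V} {ι κ : ℕ} :
      ITrans P ι κ P' → ITrans (Term.par P Q) ι κ (Term.par P' Q)
  | parRight {V : Type u} {P Q Q' : Term 𝕊 Kind.proc V} {ι κ : ℕ} :
      ITrans Q ι κ Q' → ITrans (Term.par P Q) ι κ (Term.par P Q')
  | new {V : Type u} {P P' : Term 𝕊 Kind.proc (Option V)} {ι κ : ℕ} :
      ITrans P ι κ P' → ITrans (Term.new P) ι κ (Term.new P')

/-- Abstract channels over the set `N` of free names: `(u, [(ε₁, n₁), …, (εₖ, nₖ)])` stands for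
`u⋅ε₁n₁⋯εₖnₖ`. -/
abbrev Channel (N : Type u) : Type u := N × List (Pola × ℕ)

namespace Channel

variable {N : Type u}

/-- The free name `u` as a channel. -/
def ofName (u : N) : Channel N := (u, [])

/-- The channel `x⋅εn`, which is the name bound by the action of polarity `ε` at location `n` of
the channel `x`. -/
def child (x : Channel N) (ε : Pola) (n : ℕ) : Channel N := (x.1, x.2 ++ [(ε, n)])

end Channel

/-- Transition labels; the object of a visible action of subject `x` is the channel `x⋅ει`. -/
inductive Label (N : Type u) : Type u
  | vis (x : Channel N) (ε : Pola) (ι : ℕ)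
  | tau (ι κ : ℕ)

/-- The locations that occur in a label. -/
def Label.locs {N : Type u} : Label N → List ℕ
  | vis _ _ ι => [ι]
  | tau ι κ => [ι, κ]

section Semantics

variable {𝕊 : Type v} {N : Type u}

/-- Processes whose free names are channels. -/
abbrev Proc (𝕊 : Type v) (N : Type u) : Type (max (u + 1) v) := Term 𝕊 Kind.proc (Channel N)

/-- Transitions: after a visible transition, the revealed name is the channel `x⋅ει`. -/
inductive Trans : Proc 𝕊 N → Label N → Proc 𝕊 N → Prop
  | vis {P : Proc 𝕊 N} {x : Channel N} {ε : Pola} {ι : ℕ}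
      {P' : Term 𝕊 Kind.proc (Option (Channel N))} :
      VTrans P x ε ι P' →
      Trans P (Label.vis x ε ι) (P'.rename (fun o => o.getD (x.child ε ι)))
  | tau {P P' : Proc 𝕊 N} {ι κ : ℕ} : ITrans P ι κ P' → Trans P (Label.tau ι κ) P'

/-- Sequences of transitions. -/
inductive TransSeq : Proc 𝕊 N → List (Label N) → Proc 𝕊 N → Prop
  | nil {P : Proc 𝕊 N} : TransSeq P [] P
  | cons {P P' P'' : Proc 𝕊 N} {a : Label N} {p : List (Label N)} :
      Trans P a P' → TransSeq P' p P'' → TransSeq P (a :: p) P''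

/-- The interactions that are valid for `P`. -/
abbrev Interaction (P : Proc 𝕊 N) : Type u :=
  {p : List (Label N) // ∃ P', TransSeq P p P'}

/-- Independence of labels in `P`: all locations that occur in them are distinct and pairwise
incomparable for prefixing. -/
def Independent (P : Proc 𝕊 N) (a b : Label N) : Prop :=
  (a.locs ++ b.locs).Nodup ∧
    ∀ ι ∈ a.locs ++ b.locs, ∀ κ ∈ a.locs ++ b.locs, ¬ P.Prefixing ι κ

/-- Homotopy: the equivalence generated by the exchange of consecutive independent labels. -/
def homotopy (P : Proc 𝕊 N) : Setoid (Interaction P) :=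
  Relation.EqvGen.setoid (fun p q : Interaction P =>
    ∃ (l r : List (Label N)) (a b : Label N), Independent P a b ∧
      p.1 = l ++ a :: b :: r ∧ q.1 = l ++ b :: a :: r)

/-- Pre-traces: homotopy classes of interactions. -/
def Pretrace (P : Proc 𝕊 N) : Type u := Quotient (homotopy P)

namespace Pretrace

variable {P : Proc 𝕊 N}

/-- The interaction `p` belongs to the pre-trace `ρ`. -/
def Contains (ρ : Pretrace P) (p : Interaction P) : Prop :=
  (Quotient.mk (homotopy P) p : Pretrace P) = ρ

/-- The reduct `P/ρ`. It is computed along one interaction of `ρ`; another one gives the same term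
up to commutation of restrictions, provided that the locations in `P` are distinct. -/
noncomputable def reduct (ρ : Pretrace P) : Proc 𝕊 N :=
  Classical.choose (Quotient.out ρ).2

/-- The label `a` occurs in the pre-trace `ρ`. -/
def HasLabel (ρ : Pretrace P) (a : Label N) : Prop :=
  ∃ p, ρ.Contains p ∧ a ∈ p.1

/-- The pre-trace `ρ` triggers the action at location `ι`. -/
def Triggers (ρ : Pretrace P) (ι : ℕ) : Prop :=
  ∃ a, ρ.HasLabel a ∧ ι ∈ a.locs

/-- The causal order on the labels of `ρ`: equality, or occurring before in all interactions. -/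
def Causal (ρ : Pretrace P) (a b : Label N) : Prop :=
  ρ.HasLabel a ∧ ρ.HasLabel b ∧ (a = b ∨ ∀ p, ρ.Contains p → List.Sublist [a, b] p.1)

end Pretrace

/-- A maximal path: a sequence of internal transitions that no internal transition extends. -/
def IsMaximalPath (P : Proc 𝕊 N) (p : Interaction P) : Prop :=
  (∀ a ∈ p.1, ∃ ι κ, a = Label.tau ι κ) ∧
    ∀ ι κ, ¬ ∃ P', TransSeq P (p.1 ++ [Label.tau ι κ]) P'

/-- Runs: homotopy classes of maximal paths. -/
abbrev Run (P : Proc 𝕊 N) : Type u :=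
  {ρ : Pretrace P // ∃ p, ρ.Contains p ∧ IsMaximalPath P p}

/-- The outcome of a process: the sum of the final states of its runs (a finite sum). -/
noncomputable def outcome [CommSemiring 𝕊] (P : Proc 𝕊 N) : 𝕊 :=
  ∑ᶠ ρ : Run P, ρ.1.reduct.state

end Semantics

/-! ## Finiteness of the set of interactions -/

section Finiteness

variable {𝕊 : Type v}

theorem Term.locs_rename {k : Kind} {V : Type u} (P : Term 𝕊 k V) {W : Type u}
    (f : V → W) : (P.rename f).locs = P.locs := by
  induction P generalizing W <;> simp_all [Term.rename, Term.locs]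

theorem VTrans.length_lt {k : Kind} {V : Type u} {P : Term 𝕊 k V} {a : V} {ε : Pola} {ι : ℕ}
    {P' : Term 𝕊 Kind.proc (Option V)} (h : VTrans P a ε ι P') :
    P'.locs.length < P.locs.length := by
  induction h <;> simp_all [Term.locs_rename, Term.locs] <;> omega

theorem ITrans.length_lt {V : Type u} {P : Term 𝕊 Kind.proc V} {ι κ : ℕ}
    {P' : Term 𝕊 Kind.proc V} (h : ITrans P ι κ P') :
    P'.locs.length < P.locs.length := by
  induction h with
  | sync h h2 =>
    have h3 := h.length_lt
    have h4 := h2.length_lt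
    simp only [Term.locs, List.length_append]; omega
  | parLeft _ ih => simp only [Term.locs, List.length_append]; omega
  | parRight _ ih => simp only [Term.locs, List.length_append]; omega
  | new _ ih => simpa only [Term.locs] using ih

/-- The set of visible transitions of a term. -/
def vset {k : Kind} {V : Type u} (P : Term 𝕊 k V) :
    Set (V × Pola × ℕ × Term 𝕊 Kind.proc (Option V)) :=
  {t | VTrans P t.1 t.2.1 t.2.2.1 t.2.2.2}

theorem vset_finite {k : Kind} {V : Type u} (P : Term 𝕊 k V) : (vset P).Finite := by
  induction P with
  | act ι a ε P _ =>
    refine (Set.finite_singleton (a, ε, ι, P)).subset ?_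
    rintro ⟨b, η, κ, P'⟩ h
    cases (show VTrans _ b η κ P' from h)
    rfl
  | sum S T ihS ihT =>
    refine (ihS.union ihT).subset ?_
    rintro ⟨b, η, κ, P'⟩ h
    cases (show VTrans _ b η κ P' from h) with
    | sumLeft h => exact Or.inl h
    | sumRight h => exact Or.inr h
  | out c =>
    refine Set.finite_empty.subset ?_
    rintro ⟨b, η, κ, P'⟩ h
    cases (show VTrans _ b η κ P' from h)
  | br S ih =>
    refine ih.subset ?_
    rintro ⟨b, η, κ, P'⟩ h
    cases (show VTrans _ b η κ P' from h) with
    | br h => exact h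
  | par P Q ihP ihQ =>
    refine ((ihP.image (fun t => (t.1, t.2.1, t.2.2.1, Term.par t.2.2.2 (Q.rename some)))).union
      (ihQ.image (fun t => (t.1, t.2.1, t.2.2.1, Term.par (P.rename some) t.2.2.2)))).subset ?_
    rintro ⟨b, η, κ, P'⟩ h
    cases (show VTrans _ b η κ P' from h) with
    | @parLeft _ _ _ _ _ _ R h1 => exact Or.inl ⟨(b, η, κ, R), h1, rfl⟩
    | @parRight _ _ _ _ _ _ R h1 => exact Or.inr ⟨(b, η, κ, R), h1, rfl⟩
  | @new V P ih =>
    have hinj : Set.InjOn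
        (fun t : V × Pola × ℕ × Term 𝕊 Kind.proc (Option (Option V)) =>
          ((some t.1, t.2) : Option V × _)) Set.univ := by
      rintro ⟨a, t⟩ _ ⟨b, s⟩ _ h
      simpa using h
    have hfin := (ih.preimage (hinj.mono (Set.subset_univ _))).image
      (fun t => (t.1, t.2.1, t.2.2.1, Term.new (t.2.2.2.rename swapNames)))
    refine hfin.subset ?_
    rintro ⟨b, η, κ, P'⟩ h
    cases (show VTrans _ b η κ P' from h) with
    | @new _ _ _ _ _ R h1 => exact ⟨(b, η, κ, R), h1, rfl⟩

/-- The set of internal transitions of a process. -/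
def iset {V : Type u} (P : Term 𝕊 Kind.proc V) : Set (ℕ × ℕ × Term 𝕊 Kind.proc V) :=
  {t | ITrans P t.1 t.2.1 t.2.2}

theorem iset_finite_aux {k : Kind} {V : Type u} (P : Term 𝕊 k V) :
    ∀ hk : k = Kind.proc, (iset (hk ▸ P)).Finite := by
  induction P with
  | act ι a ε P _ => intro hk; cases hk
  | sum S T _ _ => intro hk; cases hk
  | out c =>
    intro _
    refine Set.finite_empty.subset ?_
    rintro ⟨ι, κ, P'⟩ h
    cases (show ITrans _ ι κ P' from h)
  | br S _ =>
    intro _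
    refine Set.finite_empty.subset ?_
    rintro ⟨ι, κ, P'⟩ h
    cases (show ITrans _ ι κ P' from h)
  | par P Q ihP ihQ =>
    intro _
    refine ((((ihP rfl).image (fun t => (t.1, t.2.1, Term.par t.2.2 Q))).union
      ((ihQ rfl).image (fun t => (t.1, t.2.1, Term.par P t.2.2)))).union
      (((vset_finite P).prod (vset_finite Q)).image (fun t =>
        (t.1.2.2.1, t.2.2.2.1, Term.new (Term.par t.1.2.2.2 t.2.2.2.2))))).subset ?_
    rintro ⟨ι, κ, P'⟩ h
    cases (show ITrans (Term.par P Q) ι κ P' from h) with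
    | @sync _ _ _ a ε _ _ P1 Q1 h1 h2 =>
      exact Or.inr ⟨((a, ε, ι, P1), (a, ε.op, κ, Q1)), ⟨h1, h2⟩, rfl⟩
    | @parLeft _ _ _ R _ _ h1 => exact Or.inl (Or.inl ⟨(ι, κ, R), h1, rfl⟩)
    | @parRight _ _ _ R _ _ h1 => exact Or.inl (Or.inr ⟨(ι, κ, R), h1, rfl⟩)
  | new P ih =>
    intro _
    refine ((ih rfl).image (fun t => (t.1, t.2.1, Term.new t.2.2))).subset ?_
    rintro ⟨ι, κ, P'⟩ h
    cases (show ITrans (Term.new P) ι κ P' from h) with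
    | @new _ _ R _ _ h1 => exact ⟨(ι, κ, R), h1, rfl⟩

theorem iset_finite {V : Type u} (P : Term 𝕊 Kind.proc V) : (iset P).Finite :=
  iset_finite_aux P rfl

variable {N : Type u}

theorem Trans.length_lt {P P' : Proc 𝕊 N} {a : Label N} (h : Trans P a P') :
    P'.locs.length < P.locs.length := by
  cases h with
  | vis h => rw [Term.locs_rename]; exact h.length_lt
  | tau h => exact h.length_lt

theorem trans_finite (P : Proc 𝕊 N) :
    {t : Label N × Proc 𝕊 N | Trans P t.1 t.2}.Finite := by
  refine (((vset_finite P).image (fun t => (Label.vis t.1 t.2.1 t.2.2.1,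
      t.2.2.2.rename (fun o => o.getD (t.1.child t.2.1 t.2.2.1))))).union
    ((iset_finite P).image (fun t => (Label.tau t.1 t.2.1, t.2.2)))).subset ?_
  rintro ⟨a, P'⟩ h
  cases (show Trans P a P' from h) with
  | @vis x ε ι R h1 => exact Or.inl ⟨(x, ε, ι, R), h1, rfl⟩
  | @tau _ ι κ h1 => exact Or.inr ⟨(ι, κ, P'), h1, rfl⟩

theorem interactions_finite (P : Proc 𝕊 N) : {p | ∃ P', TransSeq P p P'}.Finite := by
  induction hn : P.locs.length using Nat.strong_induction_on generalizing P with
  | _ n ih =>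
    have h1 : (⋃ t ∈ {t : Label N × Proc 𝕊 N | Trans P t.1 t.2},
        (fun p => t.1 :: p) '' {p | ∃ P', TransSeq t.2 p P'}).Finite := by
      refine (trans_finite P).biUnion ?_
      intro t ht
      refine Set.Finite.image _ (ih _ ?_ t.2 rfl)
      rw [← hn]
      exact Trans.length_lt ht
    refine ((Set.finite_singleton []).union h1).subset ?_
    rintro p ⟨P', h⟩
    cases h with
    | nil => exact Or.inl rfl
    | @cons _ P1 _ a p h h2 =>
      refine Or.inr ?_
      simp only [Set.mem_iUnion]
      exact ⟨(a, P1), h, p, ⟨P', h2⟩, rfl⟩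

instance (P : Proc 𝕊 N) : Finite (Interaction P) := (interactions_finite P).to_subtype

instance (P : Proc 𝕊 N) : Finite (Pretrace P) := Quotient.finite _

theorem Pretrace.finite_labels {P : Proc 𝕊 N} (ρ : Pretrace P) : {a | ρ.HasLabel a}.Finite := by
  refine (Set.finite_iUnion (fun p : Interaction P => List.finite_toSet p.1)).subset ?_
  rintro a ⟨p, _, h⟩
  exact Set.mem_iUnion.2 ⟨p, h⟩

end Finiteness

/-! ## Simple terms -/

/-- Inaction sets: non-empty sums of inactions `α.0`. -/
inductive Inactions (V : Type u) : Type u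
  | single (ι : ℕ) (a : V) (ε : Pola)
  | sum (S T : Inactions V)

namespace Inactions

/-- The branching denoted by an inaction set. -/
def toTerm (𝕊 : Type v) [Zero 𝕊] {V : Type u} : Inactions V → Term 𝕊 Kind.branching V
  | single ι a ε => Term.act ι a ε (Term.out 0)
  | sum S T => Term.sum (S.toTerm 𝕊) (T.toTerm 𝕊)

/-- The locations of the inactions. -/
def locs {V : Type u} : Inactions V → List ℕ
  | single ι _ _ => [ι]
  | sum S T => S.locs ++ T.locs

end Inactions

/-- Simple terms. The linear action `α.P` with linear prefix `α` of location `ι` comes with the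
locations of the three auxiliary actions on its fresh name `w`, namely `ι₁` for `w.1`, `ι₀` for
`w.0` and `κ` for the action of opposite polarity. -/
inductive Simple : Type u → Type (u + 1)
  | one {V : Type u} : Simple V
  | inact {V : Type u} (S : Inactions V) : Simple V
  | lin {V : Type u} (ι ι₁ ι₀ κ : ℕ) (a : V) (ε : Pola) (P : Simple (Option V)) : Simple V
  | par {V : Type u} (P Q : Simple V) : Simple V
  | new {V : Type u} (P : Simple (Option V)) : Simple V

namespace Simple

/-- The process denoted by a simple term; the linear action of `α` on `P` is
`(ν w) (α.(P | w.1) | w.0 | w̄.1)`. -/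
def toTerm (𝕊 : Type v) [CommSemiring 𝕊] : {V : Type u} → Simple V → Term 𝕊 Kind.proc V
  | _, one => Term.out 1
  | _, inact S => Term.br (S.toTerm 𝕊)
  | _, lin ι ι₁ ι₀ κ a ε P =>
      Term.new (Term.par (Term.par
        (Term.br (Term.act ι (some a) ε
          (Term.par ((toTerm 𝕊 P).rename (Option.map some))
            (Term.br (Term.act ι₁ (some none) Pola.pos (Term.out 1))))))
        (Term.br (Term.act ι₀ none Pola.pos (Term.out 0))))
        (Term.br (Term.act κ none Pola.neg (Term.out 1))))
  | _, par P Q => Term.par (toTerm 𝕊 P) (toTerm 𝕊 Q)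
  | _, new P => Term.new (toTerm 𝕊 P)

/-- The locations whose triggering means that a linear action is triggered: those of the
actions `w.1`. -/
def linearLocs : {V : Type u} → Simple V → List ℕ
  | _, one => []
  | _, inact _ => []
  | _, lin _ ι₁ _ _ _ _ P => ι₁ :: linearLocs P
  | _, par P Q => linearLocs P ++ linearLocs Q
  | _, new P => linearLocs P

/-- The locations of the inactions (including the `w.0` of the linear actions). -/
def inactionLocs : {V : Type u} → Simple V → List ℕ
  | _, one => []
  | _, inact S => S.locs
  | _, lin _ _ ι₀ _ _ _ P => ι₀ :: inactionLocs P
  | _, par P Q => inactionLocs P ++ inactionLocs Q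
  | _, new P => inactionLocs P

variable {N : Type u}

/-- The process denoted by a simple term, with free names seen as channels. -/
def proc (𝕊 : Type v) [CommSemiring 𝕊] (P : Simple N) : Proc 𝕊 N :=
  (P.toTerm 𝕊).rename Channel.ofName

/-- A pre-trace of a simple term is exhaustive if it triggers all linear actions and no inaction,
and leaves no dual inactions in parallel. -/
def Exhaustive {𝕊 : Type v} [CommSemiring 𝕊] (P : Simple N) (ρ : Pretrace (P.proc 𝕊)) : Prop :=
  (∀ ι ∈ P.linearLocs, ρ.Triggers ι) ∧ (∀ ι ∈ P.inactionLocs, ¬ ρ.Triggers ι) ∧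
    ¬ ρ.reduct.HasDualInactions

end Simple

/-! ## The arena of the calculus -/

/-- The last component of an event: an occurrence number, or one of the two marks `⊥` and `⊤`. -/
inductive Slot : Type
  | loc (n : ℕ)
  | bot
  | top

namespace Slot

/-- Action of a function on occurrence numbers. -/
def map (f : ℕ → ℕ) : Slot → Slot
  | loc n => loc (f n)
  | bot => bot
  | top => top

/-- Exchange of `⊥` and `⊤`. -/
def flip : Slot → Slot
  | loc n => loc n
  | bot => top
  | top => bot

theorem flip_flip (s : Slot) : s.flip.flip = s := by cases s <;> rfl

instance : Countable Slot :=
  Function.Injective.countable (f := fun s : Slot => match s with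
    | loc n => (Sum.inl n : ℕ ⊕ Bool)
    | bot => Sum.inr false
    | top => Sum.inr true) (by
      intro a b h
      cases a <;> cases b <;> simp_all)

end Slot

/-- Events: `(x, ε, n)` is the event `x⋅εn`. -/
abbrev Event (N : Type u) : Type u := Channel N × Pola × Slot

/-- On paths: `renamePath q ε f` maps `q⋅εn⋅z` to `q⋅εf(n)⋅z` and leaves the other paths
unchanged. -/
def renamePath (ε : Pola) (f : ℕ → ℕ) : List (Pola × ℕ) → List (Pola × ℕ) → List (Pola × ℕ)
  | _, [] => []
  | [], (η, n) :: z => if η = ε then (η, f n) :: z else (η, n) :: z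
  | b :: q, a :: z => if a = b then a :: renamePath ε f q z else a :: z

theorem renamePath_spec (ε : Pola) (f : ℕ → ℕ) (q : List (Pola × ℕ)) (n : ℕ)
    (z : List (Pola × ℕ)) :
    renamePath ε f q (q ++ (ε, n) :: z) = q ++ (ε, f n) :: z := by
  induction q with
  | nil => simp [renamePath]
  | cons b q ih => simp [renamePath, ih]

theorem renamePath_of_not (ε : Pola) (f : ℕ → ℕ) (q p : List (Pola × ℕ))
    (h : ∀ n z, p ≠ q ++ (ε, n) :: z) : renamePath ε f q p = p := by
  induction q generalizing p with
  | nil =>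
    rcases p with _ | ⟨⟨η, n⟩, z⟩
    · rfl
    · have : η ≠ ε := by
        rintro rfl
        exact h n z rfl
      simp [renamePath, this]
  | cons b q ih =>
    rcases p with _ | ⟨a, z⟩
    · rfl
    · by_cases hab : a = b
      · subst hab
        simp only [renamePath, if_true]
        rw [ih]
        intro n w hw
        exact h n w (by simp [hw])
      · simp [renamePath, hab]

theorem renamePath_leftInverse (ε : Pola) (f g : ℕ → ℕ) (hfg : ∀ n, g (f n) = n)
    (q p : List (Pola × ℕ)) : renamePath ε g q (renamePath ε f q p) = p := by
  by_cases h : ∃ n z, p = q ++ (ε, n) :: z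
  · obtain ⟨n, z, rfl⟩ := h
    rw [renamePath_spec, renamePath_spec, hfg]
  · push Not at h
    rw [renamePath_of_not ε f q p h, renamePath_of_not ε g q p h]

theorem renamePath_eq_self_iff (ε : Pola) (f : ℕ → ℕ) (q p : List (Pola × ℕ)) :
    renamePath ε f q p = q ↔ p = q := by
  by_cases h : ∃ n z, p = q ++ (ε, n) :: z
  · obtain ⟨n, z, rfl⟩ := h
    rw [renamePath_spec]
    simp
  · push Not at h
    rw [renamePath_of_not ε f q p h]

section Arena

variable {N : Type u}

open Classical in
/-- The function `x⋅εn⋅z ↦ x⋅εf(n)⋅z` on events, where `z` is empty or leads to another event;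
the other events are unchanged. -/
noncomputable def renameEvent (x : Channel N) (ε : Pola) (f : ℕ → ℕ) (e : Event N) : Event N :=
  if e.1.1 = x.1 then
    ((e.1.1, renamePath ε f x.2 e.1.2), e.2.1,
      if e.1.2 = x.2 ∧ e.2.1 = ε then e.2.2.map f else e.2.2)
  else e

theorem renameEvent_leftInverse (x : Channel N) (ε : Pola) (f g : ℕ → ℕ)
    (hfg : ∀ n, g (f n) = n) (e : Event N) :
    renameEvent x ε g (renameEvent x ε f e) = e := by
  obtain ⟨⟨u, p⟩, η, s⟩ := e
  by_cases hu : u = x.1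
  · by_cases hp : p = x.2 ∧ η = ε
    · obtain ⟨h1, h2⟩ := hp
      have h3 : renamePath ε f x.2 x.2 = x.2 := (renamePath_eq_self_iff ε f x.2 x.2).2 rfl
      have h4 : renamePath ε g x.2 x.2 = x.2 := (renamePath_eq_self_iff ε g x.2 x.2).2 rfl
      cases s <;> simp [renameEvent, hu, h1, h2, h3, h4, Slot.map, hfg]
    · simp [renameEvent, hu, hp, renamePath_eq_self_iff, renamePath_leftInverse ε f g hfg]
  · simp [renameEvent, hu]

/-- The permutation `(x, ε, σ)` of the events. -/
noncomputable def generator (x : Channel N) (ε : Pola) (σ : Equiv.Perm ℕ) :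
    Equiv.Perm (Event N) where
  toFun := renameEvent x ε σ
  invFun := renameEvent x ε σ.symm
  left_inv := renameEvent_leftInverse x ε _ _ (by simp)
  right_inv := renameEvent_leftInverse x ε _ _ (by simp)

variable (N)

/-- The arena of the calculus with finite set `N` of free names. -/
noncomputable def arena [Finite N] : OrderAlgebra.Arena.{u} where
  web := Event N
  countable_web := by
    have : Countable N := Finite.to_countable
    have : Countable Pola := Finite.to_countable
    infer_instance
  group := Subgroup.closure
    {π | ∃ (x : Channel N) (ε : Pola) (σ : Equiv.Perm ℕ), π = generator x ε σ}

/-- The involution of the events that inverts all polarities and exchanges `⊥` and `⊤`. -/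
def invert : Equiv.Perm (Event N) :=
  Function.Involutive.toPerm
    (fun e => ((e.1.1, e.1.2.map (fun b => (b.1.op, b.2))), e.2.1.op, e.2.2.flip)) (by
      rintro ⟨⟨u, p⟩, η, s⟩
      simp [Slot.flip_flip, Function.comp_def])

/-- The linear map `u ↦ ū` that inverts polarities and exchanges `⊥` and `⊤` in plays. -/
noncomputable def bar (𝕊 : Type v) [CommSemiring 𝕊] [Finite N] :
    OrderAlgebra.PreOrderAlgebra 𝕊 (arena N) →ₗ[𝕊]
      OrderAlgebra.PreOrderAlgebra 𝕊 (arena N) :=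
  Finsupp.lmapDomain 𝕊 𝕊 (OrderAlgebra.Play.map (X := arena N) (invert N))

end Arena

/-! ## Translation of simple terms -/

section Translation

variable {𝕊 : Type v} {N : Type u} {P : Proc 𝕊 N}

/-- The names known after `ρ`: the free names and those revealed by visible actions of `ρ`. -/
def Pretrace.Known (ρ : Pretrace P) (x : Channel N) : Prop :=
  (∃ u : N, x = Channel.ofName u) ∨
    ∃ y ε n, ρ.HasLabel (Label.vis y ε n) ∧ x = y.child ε n

/-- The support of the trace induced by `ρ`. -/
def Pretrace.traceSupport (ρ : Pretrace P) : Set (Event N) :=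
  {e | (∃ x ε n, ρ.HasLabel (Label.vis x ε n) ∧ e = (x, ε, Slot.loc n)) ∨
    ∃ x ε, ρ.Known x ∧ (e = (x, ε, Slot.bot) ∨ e = (x, ε, Slot.top))}

theorem Pretrace.traceSupport_finite [Finite N] (ρ : Pretrace P) : ρ.traceSupport.Finite := by
  have hL := ρ.finite_labels
  have hK : {x | ρ.Known x}.Finite := by
    have h1 : (⋃ a ∈ {a | ρ.HasLabel a},
        {x : Channel N | ∃ y ε n, a = Label.vis y ε n ∧ x = y.child ε n}).Finite := by
      refine hL.biUnion fun a _ => Set.Subsingleton.finite ?_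
      rintro x ⟨y, ε, n, rfl, rfl⟩ x2 ⟨y2, ε2, n2, h, rfl⟩
      cases h
      rfl
    refine ((Set.finite_range (Channel.ofName (N := N))).union h1).subset ?_
    rintro x (⟨u, rfl⟩ | ⟨y, ε, n, h, rfl⟩)
    · exact Or.inl ⟨u, rfl⟩
    · refine Or.inr ?_
      simp only [Set.mem_iUnion]
      exact ⟨_, h, y, ε, n, rfl, rfl⟩
  have h2 : (⋃ a ∈ {a | ρ.HasLabel a},
      {e : Event N | ∃ x ε n, a = Label.vis x ε n ∧ e = (x, ε, Slot.loc n)}).Finite := by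
    refine hL.biUnion fun a _ => Set.Subsingleton.finite ?_
    rintro e ⟨x, ε, n, rfl, rfl⟩ e2 ⟨x2, ε2, n2, h, rfl⟩
    cases h
    rfl
  have h3 : ({x | ρ.Known x} ×ˢ (Set.univ : Set Pola) ×ˢ
      ({Slot.bot, Slot.top} : Set Slot)).Finite :=
    hK.prod (Set.finite_univ.prod (Set.toFinite _))
  refine (h2.union h3).subset ?_
  rintro e (⟨x, ε, n, h, rfl⟩ | ⟨x, ε, h, rfl | rfl⟩)
  · refine Or.inl ?_
    simp only [Set.mem_iUnion]
    exact ⟨_, h, x, ε, n, rfl, rfl⟩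
  · exact Or.inr ⟨h, trivial, Or.inl rfl⟩
  · exact Or.inr ⟨h, trivial, Or.inr rfl⟩

/-- The trace induced by `ρ`: its preorder is the causal order on visible actions, augmented with
`x⋅ε⊥ < x⋅ε⊤` for each inaction `x^ε.0` that occurs in `P/ρ`. -/
noncomputable def Pretrace.trace [Zero 𝕊] [Finite N] (ρ : Pretrace P) :
    OrderAlgebra.Play (arena N) :=
  OrderAlgebra.Play.generate (X := arena N) ρ.traceSupport_finite.toFinset
    (fun e f : Event N =>
      (∃ x ε n y η m, e = (x, ε, Slot.loc n) ∧ f = (y, η, Slot.loc m) ∧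
        ρ.Causal (Label.vis x ε n) (Label.vis y η m)) ∨
      (∃ x ε, e = (x, ε, Slot.bot) ∧ f = (x, ε, Slot.top) ∧
        ρ.reduct.HasInaction ε x))

/-- The translation of a simple term: its value at a play `t` is the number of exhaustive
pre-traces that induce `t`. -/
noncomputable def translate (𝕊 : Type v) [CommSemiring 𝕊] [Finite N] (P : Simple N) :
    OrderAlgebra.PreOrderAlgebra 𝕊 (arena N) :=
  Finsupp.ofSupportFinite
    (fun t => (Nat.card {ρ : Pretrace (P.proc 𝕊) // P.Exhaustive ρ ∧ ρ.trace = t} : 𝕊)) (by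
      refine (Set.finite_range (fun ρ : Pretrace (P.proc 𝕊) => ρ.trace)).subset ?_
      intro t ht
      by_contra hn
      refine ht ?_
      have : IsEmpty {ρ : Pretrace (P.proc 𝕊) // P.Exhaustive ρ ∧ ρ.trace = t} :=
        ⟨fun ρ => hn ⟨ρ.1, ρ.2.2⟩⟩
      simp)

end Translation

end PiI

/-!
The outcome of a simple term counts its exhaustive internal pre-traces: a run that triggers an
inaction ends in state zero, while a run that triggers none ends in state one, and it can only stop
after it has triggered all linear actions (`Simple.outcome_eq_card`). The right-hand side of the
theorem is also a cardinality. Expanded bilinearly, it is a sum over exhaustive pre-traces `ρ` of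
`P` and `σ` of `Q`. The factor `μ(s)` turns a number of plays in the orbit of the dual trace `s` of
`σ` into a number of cosets of the pointwise stabilizer of its support
(`Play.multiplicity_mul_card`), so the term for `ρ` and `σ` is the number of cosets of permutations
`g` for which the trace of `ρ` and the play `g s` have the same support and a consistent
synchronisation. It remains to match such triples `(ρ, σ, g)` with the exhaustive internal
pre-traces of `P | Q` (`nonempty_syncTriple_equiv`).

Since all locations are distinct, homotopy is well behaved: an interaction can be rearranged into
any order that respects prefixing, two interactions of the same term are homotopic as soon as they
are permutations of each other, and homotopic interactions lead to the same term up to commutation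
of restrictions (`TransSeq.rearrange`, `TransSeq.homotopic_of_perm`). In particular the visible
actions of a pre-trace can be played in any order compatible with causality
(`Pretrace.exists_has_sorted`).

A permutation `g` composed with the inversion of polarities acts on events as a duality
(`isDuality_of_mem`): a map of the forest of channels which says with which action of `P` each
visible action of `Q` synchronises. Interactions of `P` and of `Q` whose visible actions correspond
in the same order merge into a sequence of internal transitions of `P | Q` (`Merge.iseq`).
Conversely each such sequence splits into interactions of the two sides, and the permutation along
which they synchronise is built on the way, by exchanging two occurrence numbers below the subject
of each synchronisation (`exists_merge_of_iseq`). It is determined on the support of the trace of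
`σ`, that is, its coset is determined (`Syncs.dualEvent_eq`).

The plays detect all this (`sync_consistent_iff`). A consistent synchronisation extends to a linear
order, in which the visible actions of `ρ` and `σ` can be played simultaneously. The pairs `⊥ < ⊤`
recorded for the inactions left by `ρ` are reversed in the dual trace of `σ`, so consistency also
says that no inaction left by `ρ` faces a dual inaction left by `σ`, which is what exhaustiveness
of the synchronised pre-trace requires beyond that of `ρ` and `σ` (`Simple.exhaustive_par_iff`).
-/

namespace PiI

variable {𝕊 : Type v}

/-! ### Renaming and free names -/

namespace Term

/-- Induction on processes that ignores the inside of branchings. -/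
theorem proc_induction {motive : ∀ {V : Type u}, Term 𝕊 Kind.proc V → Prop}
    (out : ∀ {V : Type u} (c : 𝕊), motive (out (V := V) c))
    (br : ∀ {V : Type u} (S : Term 𝕊 Kind.branching V), motive (br S))
    (par : ∀ {V : Type u} (P Q : Term 𝕊 Kind.proc V), motive P → motive Q → motive (par P Q))
    (new : ∀ {V : Type u} (P : Term 𝕊 Kind.proc (Option V)), motive P → motive (new P))
    {V : Type u} (P : Term 𝕊 Kind.proc V) : motive P := by
  have key : ∀ {k : Kind} {V : Type u} (P : Term 𝕊 k V) (hk : k = Kind.proc),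
      motive (hk ▸ P) := by
    intro k V P
    induction P with
    | act => intro hk; cases hk
    | sum => intro hk; cases hk
    | out c => intro _; exact out c
    | br S => intro _; exact br S
    | par P Q ihP ihQ => intro _; exact par P Q (ihP rfl) (ihQ rfl)
    | new P ih => intro _; exact new P (ih rfl)
  exact key P rfl

theorem rename_rename {k : Kind} {V : Type u} (P : Term 𝕊 k V) {W X : Type u}
    (f : V → W) (g : W → X) : (P.rename f).rename g = P.rename (g ∘ f) := by
  induction P generalizing W X <;> simp_all [rename, Option.map_comp_map]

@[simp] theorem rename_id {k : Kind} {V : Type u} (P : Term 𝕊 k V) : P.rename id = P := by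
  induction P <;> simp_all [rename]

/-- The free names of a term. -/
def free : {k : Kind} → {V : Type u} → Term 𝕊 k V → Set V
  | _, _, act _ a _ P => insert a (some ⁻¹' free P)
  | _, _, sum S T => free S ∪ free T
  | _, _, out _ => ∅
  | _, _, br S => free S
  | _, _, par P Q => free P ∪ free Q
  | _, _, new P => some ⁻¹' free P

theorem rename_congr {k : Kind} {V : Type u} (P : Term 𝕊 k V) {W : Type u} {f g : V → W}
    (h : ∀ a ∈ P.free, f a = g a) : P.rename f = P.rename g := by
  induction P generalizing W with
  | act ι a ε P ih =>
    simp only [rename]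
    rw [h a (Set.mem_insert _ _), ih]
    rintro (_ | b) hb
    · rfl
    · simpa using h b (Or.inr hb)
  | sum S T ihS ihT =>
    simp only [rename]
    rw [ihS (fun a ha => h a (Or.inl ha)), ihT (fun a ha => h a (Or.inr ha))]
  | out c => rfl
  | br S ih => simp only [rename]; rw [ih h]
  | par P Q ihP ihQ =>
    simp only [rename]
    rw [ihP (fun a ha => h a (Or.inl ha)), ihQ (fun a ha => h a (Or.inr ha))]
  | new P ih =>
    simp only [rename]
    rw [ih]
    rintro (_ | b) hb
    · rfl
    · simpa using h b hb

theorem mem_free_rename {k : Kind} {V : Type u} (P : Term 𝕊 k V) {W : Type u} {f : V → W}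
    {b : W} : b ∈ (P.rename f).free ↔ ∃ a ∈ P.free, f a = b := by
  induction P generalizing W with
  | act ι a ε P ih =>
    simp only [rename, free, Set.mem_insert_iff, Set.mem_preimage, ih, Option.exists, Option.map]
    grind
  | sum S T ihS ihT => simp only [rename, free, Set.mem_union, ihS, ihT]; grind
  | out c => simp [rename, free]
  | br S ih => simp only [rename, free, ih]
  | par P Q ihP ihQ => simp only [rename, free, Set.mem_union, ihP, ihQ]; grind
  | new P ih =>
    simp only [rename, free, Set.mem_preimage, ih, Option.exists, Option.map]
    grind

theorem prefixing_rename {k : Kind} {V : Type u} (P : Term 𝕊 k V) {W : Type u} (f : V → W)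
    (ι κ : ℕ) : (P.rename f).Prefixing ι κ ↔ P.Prefixing ι κ := by
  induction P generalizing W <;> simp_all [rename, Prefixing, locs_rename]

theorem Prefixing.mem_right {k : Kind} {V : Type u} {P : Term 𝕊 k V} {ι κ : ℕ}
    (h : P.Prefixing ι κ) : κ ∈ P.locs := by
  induction P <;> simp_all [Prefixing, locs] <;> grind

theorem rename_eq_out {V W : Type u} {P : Term 𝕊 Kind.proc V} {f : V → W} {c : 𝕊} :
    P.rename f = out c ↔ P = out c := by
  cases P <;> simp [rename]

theorem hasInaction_rename [Zero 𝕊] {k : Kind} {V : Type u} (P : Term 𝕊 k V) {W : Type u}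
    (f : V → W) (ε : Pola) (b : W) :
    (P.rename f).HasInaction ε b ↔ ∃ a, f a = b ∧ P.HasInaction ε a := by
  induction P generalizing W with
  | act ι a η P ih =>
    simp only [rename, HasInaction, ih, Option.exists, Option.map, rename_eq_out]
    grind
  | sum S T ihS ihT => simp only [rename, HasInaction, ihS, ihT]; grind
  | out c => simp [rename, HasInaction]
  | br S ih => simp only [rename, HasInaction, ih]
  | par P Q ihP ihQ => simp only [rename, HasInaction, ihP, ihQ]; grind
  | new P ih =>
    simp only [rename, HasInaction, ih, Option.exists, Option.map]
    grind

theorem HasInaction.mem_free [Zero 𝕊] {k : Kind} {V : Type u} {P : Term 𝕊 k V} {ε : Pola} {a : V}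
    (h : P.HasInaction ε a) : a ∈ P.free := by
  induction P with
  | act ι b η P ih =>
    rcases h with ⟨rfl, _⟩ | h
    · exact Or.inl rfl
    · exact Or.inr (ih h)
  | sum S T ihS ihT => exact h.imp ihS ihT
  | out c => exact h
  | br S ih => exact ih h
  | par P Q ihP ihQ => exact h.imp ihP ihQ
  | new P ih => exact ih h

theorem hasDualInactions_rename [Zero 𝕊] {k : Kind} {V : Type u} (P : Term 𝕊 k V) {W : Type u}
    (f : V → W) (hf : Function.Injective f) :
    (P.rename f).HasDualInactions ↔ P.HasDualInactions := by
  induction P generalizing W with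
  | act ι a η P ih => exact ih _ (Option.map_injective hf)
  | sum S T ihS ihT => simp only [rename, HasDualInactions, ihS _ hf, ihT _ hf]
  | out c => simp [rename, HasDualInactions]
  | br S ih => exact ih _ hf
  | par P Q ihP ihQ =>
    simp only [rename, HasDualInactions, ihP _ hf, ihQ _ hf, hasInaction_rename]
    have := @hf
    unfold Function.Injective at *
    grind
  | new P ih => exact ih _ (Option.map_injective hf)

end Term

open Term

theorem swapNames_swapNames {V : Type u} :
    (swapNames (V := V)) ∘ swapNames = id := by
  funext a; rcases a with _ | _ | a <;> rfl

theorem swapNames_comp_map {V W : Type u} (f : V → W) :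
    swapNames ∘ Option.map (Option.map f) = Option.map (Option.map f) ∘ swapNames := by
  funext a; rcases a with _ | _ | a <;> rfl

theorem swapNames_injective {V : Type u} : Function.Injective (swapNames (V := V)) :=
  Function.LeftInverse.injective (g := swapNames) (congrFun swapNames_swapNames)

/-! ### Inversion of transitions, and transitions of renamed terms -/

section Inversion

variable {V : Type u}

theorem vtrans_act {ι : ℕ} {a b : V} {ε η : Pola} {κ : ℕ} {P T : Term 𝕊 Kind.proc (Option V)} :
    VTrans (Term.act ι a ε P) b η κ T ↔ b = a ∧ η = ε ∧ κ = ι ∧ T = P := by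
  constructor
  · intro h; cases h; exact ⟨rfl, rfl, rfl, rfl⟩
  · rintro ⟨rfl, rfl, rfl, rfl⟩; exact .act

theorem vtrans_sum {S S' : Term 𝕊 Kind.branching V} {a : V} {ε : Pola} {ι : ℕ}
    {T : Term 𝕊 Kind.proc (Option V)} :
    VTrans (Term.sum S S') a ε ι T ↔ VTrans S a ε ι T ∨ VTrans S' a ε ι T := by
  constructor
  · intro h
    cases h with
    | sumLeft h => exact Or.inl h
    | sumRight h => exact Or.inr h
  · rintro (h | h)
    · exact .sumLeft h
    · exact .sumRight h

theorem vtrans_br {S : Term 𝕊 Kind.branching V} {a : V} {ε : Pola} {ι : ℕ}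
    {T : Term 𝕊 Kind.proc (Option V)} :
    VTrans (Term.br S) a ε ι T ↔ VTrans S a ε ι T := by
  constructor
  · intro h
    cases h with
    | br h => exact h
  · exact .br

theorem vtrans_out {c : 𝕊} {a : V} {ε : Pola} {ι : ℕ} {T : Term 𝕊 Kind.proc (Option V)} :
    ¬ VTrans (Term.out c) a ε ι T := by
  intro h; cases h

theorem vtrans_par {P Q : Term 𝕊 Kind.proc V} {a : V} {ε : Pola} {ι : ℕ}
    {T : Term 𝕊 Kind.proc (Option V)} :
    VTrans (Term.par P Q) a ε ι T ↔
      (∃ P', VTrans P a ε ι P' ∧ T = Term.par P' (Q.rename some)) ∨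
      ∃ Q', VTrans Q a ε ι Q' ∧ T = Term.par (P.rename some) Q' := by
  constructor
  · intro h
    cases h with
    | parLeft h => exact Or.inl ⟨_, h, rfl⟩
    | parRight h => exact Or.inr ⟨_, h, rfl⟩
  · rintro (⟨_, h, rfl⟩ | ⟨_, h, rfl⟩)
    · exact .parLeft h
    · exact .parRight h

theorem vtrans_new {P : Term 𝕊 Kind.proc (Option V)} {a : V} {ε : Pola} {ι : ℕ}
    {T : Term 𝕊 Kind.proc (Option V)} :
    VTrans (Term.new P) a ε ι T ↔
      ∃ P', VTrans P (some a) ε ι P' ∧ T = Term.new (P'.rename swapNames) := by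
  constructor
  · intro h
    cases h with
    | new h => exact ⟨_, h, rfl⟩
  · rintro ⟨_, h, rfl⟩
    exact .new h

theorem itrans_out {c : 𝕊} {ι κ : ℕ} {T : Term 𝕊 Kind.proc V} : ¬ ITrans (Term.out c) ι κ T := by
  intro h; cases h

theorem itrans_br {S : Term 𝕊 Kind.branching V} {ι κ : ℕ} {T : Term 𝕊 Kind.proc V} :
    ¬ ITrans (Term.br S) ι κ T := by
  intro h; cases h

theorem itrans_par {P Q : Term 𝕊 Kind.proc V} {ι κ : ℕ} {T : Term 𝕊 Kind.proc V} :
    ITrans (Term.par P Q) ι κ T ↔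
      (∃ a ε P' Q', VTrans P a ε ι P' ∧ VTrans Q a ε.op κ Q' ∧
        T = Term.new (Term.par P' Q')) ∨
      (∃ P', ITrans P ι κ P' ∧ T = Term.par P' Q) ∨
      ∃ Q', ITrans Q ι κ Q' ∧ T = Term.par P Q' := by
  constructor
  · intro h
    cases h with
    | sync h1 h2 => exact Or.inl ⟨_, _, _, _, h1, h2, rfl⟩
    | parLeft h => exact Or.inr (Or.inl ⟨_, h, rfl⟩)
    | parRight h => exact Or.inr (Or.inr ⟨_, h, rfl⟩)
  · rintro (⟨_, _, _, _, h1, h2, rfl⟩ | ⟨_, h, rfl⟩ | ⟨_, h, rfl⟩)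
    · exact .sync h1 h2
    · exact .parLeft h
    · exact .parRight h

theorem itrans_new {P : Term 𝕊 Kind.proc (Option V)} {ι κ : ℕ} {T : Term 𝕊 Kind.proc V} :
    ITrans (Term.new P) ι κ T ↔ ∃ P', ITrans P ι κ P' ∧ T = Term.new P' := by
  constructor
  · intro h
    cases h with
    | new h => exact ⟨_, h, rfl⟩
  · rintro ⟨_, h, rfl⟩
    exact .new h

end Inversion

theorem VTrans.rename {k : Kind} {V : Type u} {P : Term 𝕊 k V} {a : V} {ε : Pola} {ι : ℕ}
    {P' : Term 𝕊 Kind.proc (Option V)} (h : VTrans P a ε ι P') {W : Type u} (f : V → W) :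
    VTrans (P.rename f) (f a) ε ι (P'.rename (Option.map f)) := by
  induction h generalizing W with
  | act => exact .act
  | sumLeft _ ih => exact .sumLeft (ih f)
  | sumRight _ ih => exact .sumRight (ih f)
  | br _ ih => exact .br (ih f)
  | @parLeft V P Q a ε ι P' _ ih =>
    refine vtrans_par.2 (Or.inl ⟨_, ih f, ?_⟩)
    simp only [Term.rename, rename_rename]
    rfl
  | @parRight V P Q a ε ι P' _ ih =>
    refine vtrans_par.2 (Or.inr ⟨_, ih f, ?_⟩)
    simp only [Term.rename, rename_rename]
    rfl
  | @new V P a ε ι P' _ ih =>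
    refine vtrans_new.2 ⟨_, ih (Option.map f), ?_⟩
    simp only [Term.rename, rename_rename, swapNames_comp_map]

theorem VTrans.of_rename {k : Kind} {V : Type u} {P : Term 𝕊 k V} {W : Type u} {f : V → W} {b : W}
    {ε : Pola} {ι : ℕ} {T : Term 𝕊 Kind.proc (Option W)} (h : VTrans (P.rename f) b ε ι T) :
    ∃ a P', b = f a ∧ VTrans P a ε ι P' ∧ T = P'.rename (Option.map f) := by
  induction P generalizing W with
  | act κ a η P ih =>
    obtain ⟨rfl, rfl, rfl, rfl⟩ := vtrans_act.1 h
    exact ⟨a, P, rfl, .act, rfl⟩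
  | sum S S' ih ih' =>
    rcases vtrans_sum.1 h with h1 | h1
    · obtain ⟨a, P', rfl, h2, rfl⟩ := ih h1
      exact ⟨a, P', rfl, .sumLeft h2, rfl⟩
    · obtain ⟨a, P', rfl, h2, rfl⟩ := ih' h1
      exact ⟨a, P', rfl, .sumRight h2, rfl⟩
  | out c => exact absurd h vtrans_out
  | br S ih =>
    obtain ⟨a, P', rfl, h2, rfl⟩ := ih (vtrans_br.1 h)
    exact ⟨a, P', rfl, .br h2, rfl⟩
  | par P Q ihP ihQ =>
    rcases vtrans_par.1 h with ⟨P', h1, rfl⟩ | ⟨P', h1, rfl⟩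
    · obtain ⟨a, P', rfl, h2, rfl⟩ := ihP h1
      refine ⟨a, _, rfl, .parLeft h2, ?_⟩
      simp only [Term.rename, rename_rename]
      rfl
    · obtain ⟨a, P', rfl, h2, rfl⟩ := ihQ h1
      refine ⟨a, _, rfl, .parRight h2, ?_⟩
      simp only [Term.rename, rename_rename]
      rfl
  | new P ih =>
    obtain ⟨P', h1, rfl⟩ := vtrans_new.1 h
    obtain ⟨a, P', ha, h2, rfl⟩ := ih h1
    rcases a with _ | a
    · simp at ha
    · obtain rfl : b = f a := by simpa using ha
      refine ⟨a, _, rfl, .new h2, ?_⟩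
      simp only [Term.rename, rename_rename, swapNames_comp_map]

theorem VTrans.mem_free {k : Kind} {V : Type u} {P : Term 𝕊 k V} {a : V} {ε : Pola} {ι : ℕ}
    {P' : Term 𝕊 Kind.proc (Option V)} (h : VTrans P a ε ι P') : a ∈ P.free := by
  induction h with
  | act => exact Or.inl rfl
  | sumLeft _ ih => exact Or.inl ih
  | sumRight _ ih => exact Or.inr ih
  | br _ ih => exact ih
  | parLeft _ ih => exact Or.inl ih
  | parRight _ ih => exact Or.inr ih
  | new _ ih => exact ih

theorem VTrans.free_subset {k : Kind} {V : Type u} {P : Term 𝕊 k V} {a : V} {ε : Pola} {ι : ℕ}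
    {P' : Term 𝕊 Kind.proc (Option V)} (h : VTrans P a ε ι P') {b : V}
    (hb : some b ∈ P'.free) : b ∈ P.free := by
  induction h with
  | act => exact Or.inr hb
  | sumLeft _ ih => exact Or.inl (ih hb)
  | sumRight _ ih => exact Or.inr (ih hb)
  | br _ ih => exact ih hb
  | parLeft _ ih =>
    rcases hb with hb | hb
    · exact Or.inl (ih hb)
    · obtain ⟨c, hc, h⟩ := (mem_free_rename _).1 hb
      cases h
      exact Or.inr hc
  | parRight _ ih =>
    rcases hb with hb | hb
    · obtain ⟨c, hc, h⟩ := (mem_free_rename _).1 hb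
      cases h
      exact Or.inl hc
    · exact Or.inr (ih hb)
  | new _ ih =>
    obtain ⟨c, hc, h⟩ := (mem_free_rename _).1 hb
    rcases c with _ | _ | c <;> cases h
    exact ih hc

theorem ITrans.free_subset {V : Type u} {P : Term 𝕊 Kind.proc V} {ι κ : ℕ}
    {P' : Term 𝕊 Kind.proc V} (h : ITrans P ι κ P') : P'.free ⊆ P.free := by
  induction h with
  | sync h h' =>
    rintro b (hb | hb)
    · exact Or.inl (h.free_subset hb)
    · exact Or.inr (h'.free_subset hb)
  | parLeft _ ih => exact Set.union_subset_union ih subset_rfl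
  | parRight _ ih => exact Set.union_subset_union subset_rfl ih
  | new _ ih => exact Set.preimage_mono ih

theorem ITrans.rename {V : Type u} {P : Term 𝕊 Kind.proc V} {ι κ : ℕ}
    {P' : Term 𝕊 Kind.proc V} (h : ITrans P ι κ P') {W : Type u} (f : V → W) :
    ITrans (P.rename f) ι κ (P'.rename f) := by
  induction h generalizing W with
  | sync h h' => exact .sync (h.rename f) (h'.rename f)
  | parLeft _ ih => exact .parLeft (ih f)
  | parRight _ ih => exact .parRight (ih f)
  | new _ ih => exact .new (ih _)

theorem ITrans.of_rename {V : Type u} {P : Term 𝕊 Kind.proc V} {W : Type u} {f : V → W}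
    {ι κ : ℕ} {T : Term 𝕊 Kind.proc W} (h : ITrans (P.rename f) ι κ T)
    (hf : Set.InjOn f P.free) : ∃ P', ITrans P ι κ P' ∧ T = P'.rename f := by
  induction P using Term.proc_induction generalizing W with
  | out c => exact absurd h itrans_out
  | br S => exact absurd h itrans_br
  | par P Q ihP ihQ =>
    rcases itrans_par.1 h with ⟨b, ε, P', Q', h1, h2, rfl⟩ | ⟨P', h1, rfl⟩ | ⟨Q', h1, rfl⟩
    · obtain ⟨a, P', rfl, h3, rfl⟩ := h1.of_rename
      obtain ⟨a', Q', ha, h4, rfl⟩ := h2.of_rename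
      obtain rfl := hf (Or.inl h3.mem_free) (Or.inr h4.mem_free) ha
      exact ⟨_, .sync h3 h4, rfl⟩
    · obtain ⟨P', h3, rfl⟩ := ihP h1 (hf.mono Set.subset_union_left)
      exact ⟨_, .parLeft h3, rfl⟩
    · obtain ⟨P', h3, rfl⟩ := ihQ h1 (hf.mono Set.subset_union_right)
      exact ⟨_, .parRight h3, rfl⟩
  | new P ih =>
    obtain ⟨P', h1, rfl⟩ := itrans_new.1 h
    obtain ⟨P', h3, rfl⟩ := ih h1 (by
      rintro (_ | a) ha (_ | b) hb hab
      · rfl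
      · simp at hab
      · simp at hab
      · rw [hf ha hb (by simpa using hab)])
    exact ⟨_, .new h3, rfl⟩

/-! ### Locations and prefixing along transitions -/

theorem VTrans.mem_locs {k : Kind} {V : Type u} {P : Term 𝕊 k V} {a : V} {ε : Pola} {ι : ℕ}
    {P' : Term 𝕊 Kind.proc (Option V)} (h : VTrans P a ε ι P') : ι ∈ P.locs := by
  induction h <;> simp_all [Term.locs]

theorem VTrans.locs_sublist {k : Kind} {V : Type u} {P : Term 𝕊 k V} {a : V} {ε : Pola} {ι : ℕ}
    {P' : Term 𝕊 Kind.proc (Option V)} (h : VTrans P a ε ι P') : P'.locs.Sublist P.locs := by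
  induction h with
  | act => exact List.sublist_cons_self _ _
  | sumLeft _ ih => exact ih.trans (List.sublist_append_left _ _)
  | sumRight _ ih => exact ih.trans (List.sublist_append_right _ _)
  | br _ ih => exact ih
  | parLeft _ ih => simpa only [Term.locs, locs_rename] using ih.append (List.Sublist.refl _)
  | parRight _ ih => simpa only [Term.locs, locs_rename] using (List.Sublist.refl _).append ih
  | new _ ih => simpa only [Term.locs, locs_rename] using ih

theorem VTrans.not_mem_locs {k : Kind} {V : Type u} {P : Term 𝕊 k V} {a : V} {ε : Pola} {ι : ℕ}
    {P' : Term 𝕊 Kind.proc (Option V)} (h : VTrans P a ε ι P') (hn : P.locs.Nodup) :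
    ι ∉ P'.locs := by
  induction h with
  | act => exact (List.nodup_cons.1 hn).1
  | sumLeft _ ih => exact ih (List.nodup_append.1 hn).1
  | sumRight _ ih => exact ih (List.nodup_append.1 hn).2.1
  | br _ ih => exact ih hn
  | parLeft h ih =>
    have := h.mem_locs
    simp only [Term.locs, List.nodup_append, locs_rename, List.mem_append] at hn ⊢
    grind
  | parRight h ih =>
    have := h.mem_locs
    simp only [Term.locs, List.nodup_append, locs_rename, List.mem_append] at hn ⊢
    grind
  | new _ ih => simpa only [Term.locs, locs_rename] using ih hn

theorem VTrans.prefixing_of {k : Kind} {V : Type u} {P : Term 𝕊 k V} {a : V} {ε : Pola} {ι : ℕ}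
    {P' : Term 𝕊 Kind.proc (Option V)} (h : VTrans P a ε ι P') {κ μ : ℕ}
    (hp : P'.Prefixing κ μ) : P.Prefixing κ μ := by
  induction h with
  | act => exact Or.inr hp
  | sumLeft _ ih => exact Or.inl (ih hp)
  | sumRight _ ih => exact Or.inr (ih hp)
  | br _ ih => exact ih hp
  | parLeft _ ih => exact hp.imp ih (prefixing_rename _ _ _ _).1
  | parRight _ ih => exact hp.imp (prefixing_rename _ _ _ _).1 ih
  | new _ ih => exact ih ((prefixing_rename _ _ _ _).1 hp)

/-- An enabled action is not prefixed by any other action. -/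
theorem VTrans.not_prefixing {k : Kind} {V : Type u} {P : Term 𝕊 k V} {a : V} {ε : Pola} {ι : ℕ}
    {P' : Term 𝕊 Kind.proc (Option V)} (h : VTrans P a ε ι P') (hn : P.locs.Nodup) (κ : ℕ) :
    ¬ P.Prefixing κ ι := by
  induction h with
  | act =>
    rintro (h | h)
    · exact (List.nodup_cons.1 hn).1 h.2
    · exact (List.nodup_cons.1 hn).1 h.mem_right
  | sumLeft h ih =>
    have h1 := h.mem_locs
    have h2 := List.nodup_append.1 hn
    rintro (h | h)
    · exact ih h2.1 h
    · exact h2.2.2 _ h1 _ h.mem_right rfl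
  | sumRight h ih =>
    have h1 := h.mem_locs
    have h2 := List.nodup_append.1 hn
    rintro (h | h)
    · exact h2.2.2 _ h.mem_right _ h1 rfl
    · exact ih h2.2.1 h
  | br _ ih => exact ih hn
  | parLeft h ih =>
    have h1 := h.mem_locs
    have h2 := List.nodup_append.1 hn
    rintro (h | h)
    · exact ih h2.1 h
    · exact h2.2.2 _ h1 _ h.mem_right rfl
  | parRight h ih =>
    have h1 := h.mem_locs
    have h2 := List.nodup_append.1 hn
    rintro (h | h)
    · exact h2.2.2 _ h.mem_right _ h1 rfl
    · exact ih h2.2.1 h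
  | new _ ih => exact ih hn

/-- Prefixing persists as long as neither action is triggered or discarded. -/
theorem VTrans.prefixing {k : Kind} {V : Type u} {P : Term 𝕊 k V} {a : V} {ε : Pola} {ι : ℕ}
    {P' : Term 𝕊 Kind.proc (Option V)} (h : VTrans P a ε ι P') (hn : P.locs.Nodup) {κ μ : ℕ}
    (hp : P.Prefixing κ μ) (hκ : κ ≠ ι) (hμ : μ ∈ P'.locs) : P'.Prefixing κ μ := by
  induction h with
  | act => exact hp.resolve_left (fun h => hκ h.1)
  | sumLeft h ih =>
    have h2 := List.nodup_append.1 hn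
    rcases hp with hp | hp
    · exact ih h2.1 hp hκ hμ
    · exact absurd rfl (h2.2.2 _ (h.locs_sublist.subset hμ) _ hp.mem_right)
  | sumRight h ih =>
    have h2 := List.nodup_append.1 hn
    rcases hp with hp | hp
    · exact absurd rfl (h2.2.2 _ hp.mem_right _ (h.locs_sublist.subset hμ))
    · exact ih h2.2.1 hp hκ hμ
  | br _ ih => exact ih hn hp hκ hμ
  | parLeft h ih =>
    have h2 := List.nodup_append.1 hn
    rcases hp with hp | hp
    · refine Or.inl (ih h2.1 hp hκ ?_)
      rcases List.mem_append.1 hμ with h | h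
      · exact h
      · exact absurd rfl (h2.2.2 _ hp.mem_right _ (by rwa [locs_rename] at h))
    · exact Or.inr ((prefixing_rename _ _ _ _).2 hp)
  | parRight h ih =>
    have h2 := List.nodup_append.1 hn
    rcases hp with hp | hp
    · exact Or.inl ((prefixing_rename _ _ _ _).2 hp)
    · refine Or.inr (ih h2.2.1 hp hκ ?_)
      rcases List.mem_append.1 hμ with h | h
      · exact absurd rfl (h2.2.2 _ (by rwa [locs_rename] at h) _ hp.mem_right)
      · exact h
  | new _ ih =>
    simp only [Term.locs, locs_rename] at hμ
    exact (prefixing_rename _ _ _ _).2 (ih hn hp hκ hμ)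

/-- The continuation of a branching is prefixed by the action that triggers it. -/
theorem VTrans.prefixing_branching {k : Kind} {V : Type u} {P : Term 𝕊 k V} {a : V} {ε : Pola}
    {ι : ℕ} {P' : Term 𝕊 Kind.proc (Option V)} (h : VTrans P a ε ι P') (hk : k = Kind.branching)
    {κ : ℕ} (hκ : κ ∈ P'.locs) : P.Prefixing ι κ := by
  induction h with
  | act => exact Or.inl ⟨rfl, hκ⟩
  | sumLeft _ ih => exact Or.inl (ih rfl hκ)
  | sumRight _ ih => exact Or.inr (ih rfl hκ)
  | br => cases hk
  | parLeft => cases hk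
  | parRight => cases hk
  | new => cases hk

theorem VTrans.deterministic {k : Kind} {V : Type u} {P : Term 𝕊 k V} {a b : V} {ε η : Pola}
    {ι : ℕ} {P' P'' : Term 𝕊 Kind.proc (Option V)} (h : VTrans P a ε ι P')
    (h' : VTrans P b η ι P'') (hn : P.locs.Nodup) : a = b ∧ ε = η ∧ P' = P'' := by
  induction h with
  | act =>
    obtain ⟨rfl, rfl, _, rfl⟩ := vtrans_act.1 h'
    exact ⟨rfl, rfl, rfl⟩
  | sumLeft h ih =>
    have h2 := List.nodup_append.1 hn
    rcases vtrans_sum.1 h' with h' | h'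
    · exact ih h' h2.1
    · exact absurd rfl (h2.2.2 _ h.mem_locs _ h'.mem_locs)
  | sumRight h ih =>
    have h2 := List.nodup_append.1 hn
    rcases vtrans_sum.1 h' with h' | h'
    · exact absurd rfl (h2.2.2 _ h'.mem_locs _ h.mem_locs)
    · exact ih h' h2.2.1
  | br _ ih => exact ih (vtrans_br.1 h') hn
  | parLeft h ih =>
    have h2 := List.nodup_append.1 hn
    rcases vtrans_par.1 h' with ⟨_, h3, rfl⟩ | ⟨_, h3, rfl⟩
    · obtain ⟨rfl, rfl, rfl⟩ := ih h3 h2.1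
      exact ⟨rfl, rfl, rfl⟩
    · exact absurd rfl (h2.2.2 _ h.mem_locs _ h3.mem_locs)
  | parRight h ih =>
    have h2 := List.nodup_append.1 hn
    rcases vtrans_par.1 h' with ⟨_, h3, rfl⟩ | ⟨_, h3, rfl⟩
    · exact absurd rfl (h2.2.2 _ h3.mem_locs _ h.mem_locs)
    · obtain ⟨rfl, rfl, rfl⟩ := ih h3 h2.2.1
      exact ⟨rfl, rfl, rfl⟩
  | new _ ih =>
    obtain ⟨_, h3, rfl⟩ := vtrans_new.1 h'
    obtain ⟨h1, rfl, rfl⟩ := ih h3 hn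
    exact ⟨Option.some_injective _ h1, rfl, rfl⟩

theorem ITrans.mem_locs {V : Type u} {P : Term 𝕊 Kind.proc V} {ι κ : ℕ}
    {P' : Term 𝕊 Kind.proc V} (h : ITrans P ι κ P') : ι ∈ P.locs ∧ κ ∈ P.locs := by
  induction h with
  | sync h h' => simp [Term.locs, h.mem_locs, h'.mem_locs]
  | parLeft _ ih => simp [Term.locs, ih]
  | parRight _ ih => simp [Term.locs, ih]
  | new _ ih => exact ih

theorem ITrans.locs_sublist {V : Type u} {P : Term 𝕊 Kind.proc V} {ι κ : ℕ}
    {P' : Term 𝕊 Kind.proc V} (h : ITrans P ι κ P') : P'.locs.Sublist P.locs := by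
  induction h with
  | sync h h' => exact h.locs_sublist.append h'.locs_sublist
  | parLeft _ ih => exact ih.append (List.Sublist.refl _)
  | parRight _ ih => exact (List.Sublist.refl _).append ih
  | new _ ih => exact ih

theorem ITrans.not_mem_locs {V : Type u} {P : Term 𝕊 Kind.proc V} {ι κ : ℕ}
    {P' : Term 𝕊 Kind.proc V} (h : ITrans P ι κ P') (hn : P.locs.Nodup) :
    ι ∉ P'.locs ∧ κ ∉ P'.locs := by
  induction h with
  | sync h h' =>
    have h2 := List.nodup_append.1 hn
    have h3 := h.not_mem_locs h2.1
    have h4 := h'.not_mem_locs h2.2.1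
    have h5 := h.mem_locs
    have h6 := h'.mem_locs
    have h7 := h.locs_sublist.subset
    have h8 := h'.locs_sublist.subset
    simp only [Term.locs, List.mem_append]
    grind
  | parLeft h ih =>
    have h2 := List.nodup_append.1 hn
    have h3 := ih h2.1
    have h4 := h.mem_locs
    simp only [Term.locs, List.mem_append]
    grind
  | parRight h ih =>
    have h2 := List.nodup_append.1 hn
    have h3 := ih h2.2.1
    have h4 := h.mem_locs
    simp only [Term.locs, List.mem_append]
    grind
  | new _ ih => exact ih hn

theorem ITrans.ne {V : Type u} {P : Term 𝕊 Kind.proc V} {ι κ : ℕ}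
    {P' : Term 𝕊 Kind.proc V} (h : ITrans P ι κ P') (hn : P.locs.Nodup) : ι ≠ κ := by
  induction h with
  | sync h h' => exact (List.nodup_append.1 hn).2.2 _ h.mem_locs _ h'.mem_locs
  | parLeft h ih => exact ih (List.nodup_append.1 hn).1
  | parRight h ih => exact ih (List.nodup_append.1 hn).2.1
  | new _ ih => exact ih hn

theorem ITrans.not_prefixing {V : Type u} {P : Term 𝕊 Kind.proc V} {ι κ : ℕ}
    {P' : Term 𝕊 Kind.proc V} (h : ITrans P ι κ P') (hn : P.locs.Nodup) (μ : ℕ) :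
    ¬ P.Prefixing μ ι ∧ ¬ P.Prefixing μ κ := by
  induction h with
  | sync h h' =>
    have h2 := List.nodup_append.1 hn
    refine ⟨?_, ?_⟩
    · rintro (h3 | h3)
      · exact h.not_prefixing h2.1 _ h3
      · exact h2.2.2 _ h.mem_locs _ h3.mem_right rfl
    · rintro (h3 | h3)
      · exact h2.2.2 _ h3.mem_right _ h'.mem_locs rfl
      · exact h'.not_prefixing h2.2.1 _ h3
  | parLeft h ih =>
    have h2 := List.nodup_append.1 hn
    refine ⟨?_, ?_⟩
    · rintro (h3 | h3)
      · exact (ih h2.1).1 h3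
      · exact h2.2.2 _ h.mem_locs.1 _ h3.mem_right rfl
    · rintro (h3 | h3)
      · exact (ih h2.1).2 h3
      · exact h2.2.2 _ h.mem_locs.2 _ h3.mem_right rfl
  | parRight h ih =>
    have h2 := List.nodup_append.1 hn
    refine ⟨?_, ?_⟩
    · rintro (h3 | h3)
      · exact h2.2.2 _ h3.mem_right _ h.mem_locs.1 rfl
      · exact (ih h2.2.1).1 h3
    · rintro (h3 | h3)
      · exact h2.2.2 _ h3.mem_right _ h.mem_locs.2 rfl
      · exact (ih h2.2.1).2 h3
  | new _ ih => exact ih hn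

theorem ITrans.prefixing_of {V : Type u} {P : Term 𝕊 Kind.proc V} {ι κ : ℕ}
    {P' : Term 𝕊 Kind.proc V} (h : ITrans P ι κ P') {μ ν : ℕ}
    (hp : P'.Prefixing μ ν) : P.Prefixing μ ν := by
  induction h with
  | sync h h' => exact hp.imp h.prefixing_of h'.prefixing_of
  | parLeft _ ih => exact hp.imp_left ih
  | parRight _ ih => exact hp.imp_right ih
  | new _ ih => exact ih hp

theorem ITrans.prefixing {V : Type u} {P : Term 𝕊 Kind.proc V} {ι κ : ℕ}
    {P' : Term 𝕊 Kind.proc V} (h : ITrans P ι κ P') (hn : P.locs.Nodup) {μ ν : ℕ}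
    (hp : P.Prefixing μ ν) (hι : μ ≠ ι) (hκ : μ ≠ κ) (hν : ν ∈ P'.locs) :
    P'.Prefixing μ ν := by
  induction h with
  | sync h h' =>
    have h2 := List.nodup_append.1 hn
    rcases hp with hp | hp
    · refine Or.inl (h.prefixing h2.1 hp hι ((List.mem_append.1 hν).resolve_right fun h3 => ?_))
      exact h2.2.2 _ hp.mem_right _ (h'.locs_sublist.subset h3) rfl
    · refine Or.inr (h'.prefixing h2.2.1 hp hκ ((List.mem_append.1 hν).resolve_left fun h3 => ?_))
      exact h2.2.2 _ (h.locs_sublist.subset h3) _ hp.mem_right rfl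
  | parLeft h ih =>
    have h2 := List.nodup_append.1 hn
    rcases hp with hp | hp
    · refine Or.inl (ih h2.1 hp hι hκ ((List.mem_append.1 hν).resolve_right fun h3 => ?_))
      exact h2.2.2 _ hp.mem_right _ h3 rfl
    · exact Or.inr hp
  | parRight h ih =>
    have h2 := List.nodup_append.1 hn
    rcases hp with hp | hp
    · exact Or.inl hp
    · refine Or.inr (ih h2.2.1 hp hι hκ ((List.mem_append.1 hν).resolve_left fun h3 => ?_))
      exact h2.2.2 _ h3 _ hp.mem_right rfl
  | new _ ih => exact ih hn hp hι hκ hν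

theorem ITrans.deterministic {V : Type u} {P : Term 𝕊 Kind.proc V} {ι κ : ℕ}
    {P' P'' : Term 𝕊 Kind.proc V} (h : ITrans P ι κ P') (h' : ITrans P ι κ P'')
    (hn : P.locs.Nodup) : P' = P'' := by
  induction h with
  | sync h1 h2 =>
    have hd := List.nodup_append.1 hn
    rcases itrans_par.1 h' with ⟨_, _, _, _, h3, h4, rfl⟩ | ⟨_, h3, rfl⟩ | ⟨_, h3, rfl⟩
    · obtain ⟨_, _, rfl⟩ := h1.deterministic h3 hd.1
      obtain ⟨_, _, rfl⟩ := h2.deterministic h4 hd.2.1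
      rfl
    · exact absurd rfl (hd.2.2 _ h3.mem_locs.2 _ h2.mem_locs)
    · exact absurd rfl (hd.2.2 _ h1.mem_locs _ h3.mem_locs.1)
  | parLeft h1 ih =>
    have hd := List.nodup_append.1 hn
    rcases itrans_par.1 h' with ⟨_, _, _, _, h3, h4, rfl⟩ | ⟨_, h3, rfl⟩ | ⟨_, h3, rfl⟩
    · exact absurd rfl (hd.2.2 _ h1.mem_locs.2 _ h4.mem_locs)
    · rw [ih h3 hd.1]
    · exact absurd rfl (hd.2.2 _ h1.mem_locs.1 _ h3.mem_locs.1)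
  | parRight h1 ih =>
    have hd := List.nodup_append.1 hn
    rcases itrans_par.1 h' with ⟨_, _, _, _, h3, h4, rfl⟩ | ⟨_, h3, rfl⟩ | ⟨_, h3, rfl⟩
    · exact absurd rfl (hd.2.2 _ h3.mem_locs _ h1.mem_locs.1)
    · exact absurd rfl (hd.2.2 _ h3.mem_locs.1 _ h1.mem_locs.1)
    · rw [ih h3 hd.2.1]
  | new _ ih =>
    obtain ⟨_, h3, rfl⟩ := itrans_new.1 h'
    rw [ih h3 hn]

end PiI

namespace PiI

variable {𝕊 : Type v}
open Term

/-! ### Commutation of restrictions -/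

/-- Equality of processes up to commutation of restrictions that are not under a prefix. -/
inductive SEq : {V : Type u} → Term 𝕊 Kind.proc V → Term 𝕊 Kind.proc V → Prop
  | refl {V : Type u} (P : Term 𝕊 Kind.proc V) : SEq P P
  | trans {V : Type u} {P Q R : Term 𝕊 Kind.proc V} : SEq P Q → SEq Q R → SEq P R
  | par {V : Type u} {P P' Q Q' : Term 𝕊 Kind.proc V} :
      SEq P P' → SEq Q Q' → SEq (Term.par P Q) (Term.par P' Q')
  | new {V : Type u} {P P' : Term 𝕊 Kind.proc (Option V)} :
      SEq P P' → SEq (Term.new P) (Term.new P')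
  | swap {V : Type u} (P : Term 𝕊 Kind.proc (Option (Option V))) :
      SEq (Term.new (Term.new P)) (Term.new (Term.new (P.rename swapNames)))

/-- The three innermost bound names: the exchanges of neighbours satisfy the braid relation. -/
theorem swapNames_braid {V : Type u} :
    swapNames ∘ Option.map swapNames ∘ (swapNames (V := Option V)) =
      Option.map swapNames ∘ swapNames ∘ Option.map swapNames := by
  funext a; rcases a with _ | _ | _ | a <;> rfl

theorem swapNames_comp_some {V : Type u} :
    (swapNames (V := V)) ∘ some = Option.map some := by
  funext a; rcases a with _ | a <;> rfl

theorem swapNames_comp_map_some {V : Type u} :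
    (swapNames (V := V)) ∘ Option.map some = some := by
  funext a; rcases a with _ | a <;> rfl

namespace SEq

theorem rename {V : Type u} {P Q : Term 𝕊 Kind.proc V} (h : SEq P Q) {W : Type u} (f : V → W) :
    SEq (P.rename f) (Q.rename f) := by
  induction h generalizing W with
  | refl P => exact refl _
  | trans _ _ ih ih' => exact (ih f).trans (ih' f)
  | par _ _ ih ih' => exact par (ih f) (ih' f)
  | new _ ih => exact new (ih _)
  | swap P =>
    have := swap (P.rename (Option.map (Option.map f)))
    rw [rename_rename, swapNames_comp_map, ← rename_rename] at this
    exact this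

theorem hasInaction_iff [Zero 𝕊] {V : Type u} {P Q : Term 𝕊 Kind.proc V} (h : SEq P Q)
    (ε : Pola) (a : V) : P.HasInaction ε a ↔ Q.HasInaction ε a := by
  induction h with
  | refl P => exact Iff.rfl
  | trans _ _ ih ih' => exact (ih a).trans (ih' a)
  | par _ _ ih ih' => exact or_congr (ih a) (ih' a)
  | new _ ih => exact ih _
  | swap P =>
    simp only [HasInaction, hasInaction_rename]
    constructor
    · exact fun h => ⟨some (some a), rfl, h⟩
    · rintro ⟨_ | _ | b, hb, h⟩ <;> cases hb
      exact h

theorem hasDualInactions_iff [Zero 𝕊] {V : Type u} {P Q : Term 𝕊 Kind.proc V} (h : SEq P Q) :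
    P.HasDualInactions ↔ Q.HasDualInactions := by
  induction h with
  | refl P => exact Iff.rfl
  | trans _ _ ih ih' => exact ih.trans ih'
  | par h h' ih ih' =>
    simp only [HasDualInactions, ih, ih', h.hasInaction_iff, h'.hasInaction_iff]
  | new _ ih => exact ih
  | swap P => exact (hasDualInactions_rename P _ swapNames_injective).symm

theorem vtrans {V : Type u} {P Q : Term 𝕊 Kind.proc V} (h : SEq P Q) {a : V} {ε : Pola} {ι : ℕ}
    {P' : Term 𝕊 Kind.proc (Option V)} (hP : VTrans P a ε ι P') :
    ∃ Q', VTrans Q a ε ι Q' ∧ SEq P' Q' := by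
  induction h with
  | refl P => exact ⟨_, hP, refl _⟩
  | trans _ _ ih ih' =>
    obtain ⟨_, h1, h2⟩ := ih hP
    obtain ⟨_, h3, h4⟩ := ih' h1
    exact ⟨_, h3, h2.trans h4⟩
  | par h h' ih ih' =>
    rcases vtrans_par.1 hP with ⟨_, h1, rfl⟩ | ⟨_, h1, rfl⟩
    · obtain ⟨_, h2, h3⟩ := ih h1
      exact ⟨_, .parLeft h2, h3.par (h'.rename _)⟩
    · obtain ⟨_, h2, h3⟩ := ih' h1
      exact ⟨_, .parRight h2, (h.rename _).par h3⟩
  | new _ ih =>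
    obtain ⟨_, h1, rfl⟩ := vtrans_new.1 hP
    obtain ⟨_, h2, h3⟩ := ih h1
    exact ⟨_, .new h2, (h3.rename _).new⟩
  | swap P =>
    obtain ⟨_, h1, rfl⟩ := vtrans_new.1 hP
    obtain ⟨R, h2, rfl⟩ := vtrans_new.1 h1
    refine ⟨_, .new (.new (h2.rename swapNames)), ?_⟩
    have := swap ((R.rename swapNames).rename (Option.map swapNames))
    simp only [Term.rename, rename_rename] at this ⊢
    rw [swapNames_braid] at this
    exact this

theorem itrans {V : Type u} {P Q : Term 𝕊 Kind.proc V} (h : SEq P Q) {ι κ : ℕ}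
    {P' : Term 𝕊 Kind.proc V} (hP : ITrans P ι κ P') :
    ∃ Q', ITrans Q ι κ Q' ∧ SEq P' Q' := by
  induction h with
  | refl P => exact ⟨_, hP, refl _⟩
  | trans _ _ ih ih' =>
    obtain ⟨_, h1, h2⟩ := ih hP
    obtain ⟨_, h3, h4⟩ := ih' h1
    exact ⟨_, h3, h2.trans h4⟩
  | par h h' ih ih' =>
    rcases itrans_par.1 hP with ⟨_, _, _, _, h1, h2, rfl⟩ | ⟨_, h1, rfl⟩ | ⟨_, h1, rfl⟩
    · obtain ⟨_, h3, h4⟩ := h.vtrans h1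
      obtain ⟨_, h5, h6⟩ := h'.vtrans h2
      exact ⟨_, .sync h3 h5, (h4.par h6).new⟩
    · obtain ⟨_, h2, h3⟩ := ih h1
      exact ⟨_, .parLeft h2, h3.par h'⟩
    · obtain ⟨_, h2, h3⟩ := ih' h1
      exact ⟨_, .parRight h2, h.par h3⟩
  | new _ ih =>
    obtain ⟨_, h1, rfl⟩ := itrans_new.1 hP
    obtain ⟨_, h2, h3⟩ := ih h1
    exact ⟨_, .new h2, h3.new⟩
  | swap P =>
    obtain ⟨_, h1, rfl⟩ := itrans_new.1 hP
    obtain ⟨R, h2, rfl⟩ := itrans_new.1 h1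
    exact ⟨_, .new (.new (h2.rename swapNames)), swap R⟩

end SEq

/-! ### Commutation of independent transitions -/

/-- Two visible transitions commute unless the first action prefixes the second. In particular, the
subject of the second one is not the name that the first one reveals. -/
theorem VTrans.comm_vtrans {k : Kind} {V : Type u} {P : Term 𝕊 k V} {a : V} {ε : Pola} {ι : ℕ}
    {P1 : Term 𝕊 Kind.proc (Option V)} (h : VTrans P a ε ι P1) {c : Option V} {η : Pola} {κ : ℕ}
    {P2 : Term 𝕊 Kind.proc (Option (Option V))} (h' : VTrans P1 c η κ P2)
    (hp : ¬ P.Prefixing ι κ) :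
    ∃ b P1' P2', c = some b ∧ VTrans P b η κ P1' ∧ VTrans P1' (some a) ε ι P2' ∧
      SEq (P2.rename swapNames) P2' := by
  induction h with
  -- The second action would lie in the continuation of the first one.
  | act => exact absurd (Or.inl ⟨rfl, h'.mem_locs⟩) hp
  | sumLeft _ ih =>
    obtain ⟨b, P1', P2', hc, h1, h2⟩ := ih h' (fun h => hp (Or.inl h))
    exact ⟨b, P1', P2', hc, .sumLeft h1, h2⟩
  | sumRight _ ih =>
    obtain ⟨b, P1', P2', hc, h1, h2⟩ := ih h' (fun h => hp (Or.inr h))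
    exact ⟨b, P1', P2', hc, .sumRight h1, h2⟩
  | br _ ih =>
    obtain ⟨b, P1', P2', hc, h1, h2⟩ := ih h' hp
    exact ⟨b, P1', P2', hc, .br h1, h2⟩
  | parLeft h ih =>
    rcases vtrans_par.1 h' with ⟨_, h1, rfl⟩ | ⟨_, h1, rfl⟩
    · obtain ⟨b, P1', P2', hc, h2, h3, h4⟩ := ih h1 (fun h => hp (Or.inl h))
      refine ⟨b, _, _, hc, .parLeft h2, .parLeft h3, ?_⟩
      simp only [Term.rename, rename_rename]
      exact h4.par (.refl _)
    · obtain ⟨b, B1, rfl, h2, rfl⟩ := h1.of_rename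
      refine ⟨b, _, _, rfl, .parRight h2, .parLeft (h.rename some), ?_⟩
      simp only [Term.rename, rename_rename, swapNames_comp_some, swapNames_comp_map_some]
      exact .refl _
  | parRight h ih =>
    rcases vtrans_par.1 h' with ⟨_, h1, rfl⟩ | ⟨_, h1, rfl⟩
    · obtain ⟨b, B1, rfl, h2, rfl⟩ := h1.of_rename
      refine ⟨b, _, _, rfl, .parLeft h2, .parRight (h.rename some), ?_⟩
      simp only [Term.rename, rename_rename, swapNames_comp_some, swapNames_comp_map_some]
      exact .refl _
    · obtain ⟨b, P1', P2', hc, h2, h3, h4⟩ := ih h1 (fun h => hp (Or.inr h))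
      refine ⟨b, _, _, hc, .parRight h2, .parRight h3, ?_⟩
      simp only [Term.rename, rename_rename]
      exact (SEq.refl _).par h4
  | new h ih =>
    obtain ⟨_, h1, rfl⟩ := vtrans_new.1 h'
    obtain ⟨d, A2, hd, h2, rfl⟩ := h1.of_rename
    obtain ⟨b, A1', A2', rfl, h3, h4, h5⟩ := ih h2 hp
    rcases b with _ | b
    · cases hd
    obtain rfl : c = some b := Option.some_injective _ hd
    refine ⟨b, _, _, rfl, .new h3, .new (h4.rename swapNames), ?_⟩
    have := (h5.rename (swapNames ∘ Option.map swapNames)).new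
    simp only [Term.rename, rename_rename] at this ⊢
    rw [Function.comp_assoc, swapNames_braid] at this
    exact this

theorem VTrans.comm_itrans {V : Type u} {P : Term 𝕊 Kind.proc V} {a : V} {ε : Pola} {ι : ℕ}
    {P1 : Term 𝕊 Kind.proc (Option V)} (h : VTrans P a ε ι P1) {κ μ : ℕ}
    {P2 : Term 𝕊 Kind.proc (Option V)} (h' : ITrans P1 κ μ P2)
    (hκ : ¬ P.Prefixing ι κ) (hμ : ¬ P.Prefixing ι μ) :
    ∃ P1' P2', ITrans P κ μ P1' ∧ VTrans P1' a ε ι P2' ∧ SEq P2 P2' := by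
  induction P using Term.proc_induction with
  | out c => exact absurd h vtrans_out
  | br S => exact absurd ((vtrans_br.1 h).prefixing_branching rfl h'.mem_locs.1) hκ
  | par A B ihA ihB =>
    rcases vtrans_par.1 h with ⟨A1, h1, rfl⟩ | ⟨B1, h1, rfl⟩
    · rcases itrans_par.1 h' with ⟨c, η, A2, B2, h2, h3, rfl⟩ | ⟨A2, h2, rfl⟩ | ⟨B2, h2, rfl⟩
      · obtain ⟨b, A1', A2', rfl, h4, h5, h6⟩ := h1.comm_vtrans h2 (fun h => hκ (Or.inl h))
        obtain ⟨b', B1, hb, h7, rfl⟩ := h3.of_rename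
        obtain rfl := Option.some_injective _ hb
        refine ⟨_, _, .sync h4 h7, .new (.parLeft h5), ?_⟩
        have := h6.rename swapNames
        simp only [Term.rename, rename_rename, swapNames_swapNames, swapNames_comp_some,
          rename_id] at this ⊢
        exact (this.par (.refl _)).new
      · obtain ⟨A1', A2', h3, h4, h5⟩ := ihA h1 h2 (fun h => hκ (Or.inl h)) (fun h => hμ (Or.inl h))
        exact ⟨_, _, .parLeft h3, .parLeft h4, h5.par (.refl _)⟩
      · obtain ⟨B1, h3, rfl⟩ := h2.of_rename (Option.some_injective _).injOn
        exact ⟨_, _, .parRight h3, .parLeft h1, .refl _⟩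
    · rcases itrans_par.1 h' with ⟨c, η, A2, B2, h2, h3, rfl⟩ | ⟨A2, h2, rfl⟩ | ⟨B2, h2, rfl⟩
      · obtain ⟨b, B1', B2', rfl, h4, h5, h6⟩ := h1.comm_vtrans h3 (fun h => hμ (Or.inr h))
        obtain ⟨b', A1, hb, h7, rfl⟩ := h2.of_rename
        obtain rfl := Option.some_injective _ hb
        refine ⟨_, _, .sync h7 h4, .new (.parRight h5), ?_⟩
        have := h6.rename swapNames
        simp only [Term.rename, rename_rename, swapNames_swapNames, swapNames_comp_some,
          rename_id] at this ⊢
        exact ((SEq.refl _).par this).new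
      · obtain ⟨A1, h3, rfl⟩ := h2.of_rename (Option.some_injective _).injOn
        exact ⟨_, _, .parLeft h3, .parRight h1, .refl _⟩
      · obtain ⟨B1', B2', h3, h4, h5⟩ := ihB h1 h2 (fun h => hκ (Or.inr h)) (fun h => hμ (Or.inr h))
        exact ⟨_, _, .parRight h3, .parRight h4, (SEq.refl _).par h5⟩
  | new A ih =>
    obtain ⟨A1, h1, rfl⟩ := vtrans_new.1 h
    obtain ⟨_, h2, rfl⟩ := itrans_new.1 h'
    obtain ⟨A2, h3, rfl⟩ := h2.of_rename swapNames_injective.injOn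
    obtain ⟨A1', A2', h4, h5, h6⟩ := ih h1 h3 hκ hμ
    exact ⟨_, _, .new h4, .new h5, (h6.rename _).new⟩

theorem ITrans.comm_vtrans {V : Type u} {P P1 : Term 𝕊 Kind.proc V} {ι κ : ℕ}
    (h : ITrans P ι κ P1) {c : V} {η : Pola} {μ : ℕ} {P2 : Term 𝕊 Kind.proc (Option V)}
    (h' : VTrans P1 c η μ P2) (hι : ¬ P.Prefixing ι μ) (hκ : ¬ P.Prefixing κ μ) :
    ∃ P1' P2', VTrans P c η μ P1' ∧ ITrans P1' ι κ P2' ∧ SEq P2 P2' := by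
  induction h with
  | sync hA hB =>
    obtain ⟨_, h1, rfl⟩ := vtrans_new.1 h'
    rcases vtrans_par.1 h1 with ⟨_, h2, rfl⟩ | ⟨_, h2, rfl⟩
    · obtain ⟨b, A1', A2', hb, h4, h5, h6⟩ := hA.comm_vtrans h2 (fun h => hι (Or.inl h))
      obtain rfl := Option.some_injective _ hb
      refine ⟨_, _, .parLeft h4, .sync h5 (hB.rename some), ?_⟩
      simp only [Term.rename, rename_rename, swapNames_comp_some]
      exact (h6.par (.refl _)).new
    · obtain ⟨b, A1', A2', hb, h4, h5, h6⟩ := hB.comm_vtrans h2 (fun h => hκ (Or.inr h))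
      obtain rfl := Option.some_injective _ hb
      refine ⟨_, _, .parRight h4, .sync (hA.rename some) h5, ?_⟩
      simp only [Term.rename, rename_rename, swapNames_comp_some]
      exact ((SEq.refl _).par h6).new
  | parLeft hA ih =>
    rcases vtrans_par.1 h' with ⟨_, h2, rfl⟩ | ⟨_, h2, rfl⟩
    · obtain ⟨A1', A2', h3, h4, h5⟩ := ih h2 (fun h => hι (Or.inl h)) (fun h => hκ (Or.inl h))
      exact ⟨_, _, .parLeft h3, .parLeft h4, h5.par (.refl _)⟩
    · exact ⟨_, _, .parRight h2, .parLeft (hA.rename some), .refl _⟩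
  | parRight hA ih =>
    rcases vtrans_par.1 h' with ⟨_, h2, rfl⟩ | ⟨_, h2, rfl⟩
    · exact ⟨_, _, .parLeft h2, .parRight (hA.rename some), .refl _⟩
    · obtain ⟨A1', A2', h3, h4, h5⟩ := ih h2 (fun h => hι (Or.inr h)) (fun h => hκ (Or.inr h))
      exact ⟨_, _, .parRight h3, .parRight h4, (SEq.refl _).par h5⟩
  | new hA ih =>
    obtain ⟨_, h1, rfl⟩ := vtrans_new.1 h'
    obtain ⟨A1', A2', h3, h4, h5⟩ := ih h1 hι hκ
    exact ⟨_, _, .new h3, .new (h4.rename _), (h5.rename _).new⟩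

theorem ITrans.comm_itrans {V : Type u} {P P1 : Term 𝕊 Kind.proc V} {ι κ : ℕ}
    (h : ITrans P ι κ P1) {μ ν : ℕ} {P2 : Term 𝕊 Kind.proc V}
    (h' : ITrans P1 μ ν P2) (hp : ∀ i j, i = ι ∨ i = κ → j = μ ∨ j = ν → ¬ P.Prefixing i j) :
    ∃ P1' P2', ITrans P μ ν P1' ∧ ITrans P1' ι κ P2' ∧ SEq P2 P2' := by
  induction h with
  | sync hA hB =>
    obtain ⟨_, h1, rfl⟩ := itrans_new.1 h'
    rcases itrans_par.1 h1 with ⟨c, η, A2, B2, h2, h3, rfl⟩ | ⟨A2, h2, rfl⟩ | ⟨B2, h2, rfl⟩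
    · obtain ⟨b, A1', A2', rfl, h4, h5, h6⟩ :=
        hA.comm_vtrans h2 (fun h => hp _ _ (Or.inl rfl) (Or.inl rfl) (Or.inl h))
      obtain ⟨b', B1', B2', hb, h7, h8, h9⟩ :=
        hB.comm_vtrans h3 (fun h => hp _ _ (Or.inr rfl) (Or.inr rfl) (Or.inr h))
      obtain rfl := Option.some_injective _ hb
      -- Two synchronisations between the same sides create their restrictions in either order.
      exact ⟨_, _, .sync h4 h7, .new (.sync h5 h8), (SEq.swap _).trans (h6.par h9).new.new⟩
    · obtain ⟨A1', A2', h4, h5, h6⟩ := hA.comm_itrans h2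
        (fun h => hp _ _ (Or.inl rfl) (Or.inl rfl) (Or.inl h))
        (fun h => hp _ _ (Or.inl rfl) (Or.inr rfl) (Or.inl h))
      exact ⟨_, _, .parLeft h4, .sync h5 hB, (h6.par (.refl _)).new⟩
    · obtain ⟨A1', A2', h4, h5, h6⟩ := hB.comm_itrans h2
        (fun h => hp _ _ (Or.inr rfl) (Or.inl rfl) (Or.inr h))
        (fun h => hp _ _ (Or.inr rfl) (Or.inr rfl) (Or.inr h))
      exact ⟨_, _, .parRight h4, .sync hA h5, ((SEq.refl _).par h6).new⟩
  | parLeft hA ih =>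
    rcases itrans_par.1 h' with ⟨c, η, A2, B2, h2, h3, rfl⟩ | ⟨A2, h2, rfl⟩ | ⟨B2, h2, rfl⟩
    · obtain ⟨A1', A2', h4, h5, h6⟩ := hA.comm_vtrans h2
        (fun h => hp _ _ (Or.inl rfl) (Or.inl rfl) (Or.inl h))
        (fun h => hp _ _ (Or.inr rfl) (Or.inl rfl) (Or.inl h))
      exact ⟨_, _, .sync h4 h3, .new (.parLeft h5), (h6.par (.refl _)).new⟩
    · obtain ⟨A1', A2', h3, h4, h5⟩ := ih h2 (fun i j hi hj h => hp i j hi hj (Or.inl h))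
      exact ⟨_, _, .parLeft h3, .parLeft h4, h5.par (.refl _)⟩
    · exact ⟨_, _, .parRight h2, .parLeft hA, .refl _⟩
  | parRight hA ih =>
    rcases itrans_par.1 h' with ⟨c, η, A2, B2, h2, h3, rfl⟩ | ⟨A2, h2, rfl⟩ | ⟨B2, h2, rfl⟩
    · obtain ⟨A1', A2', h4, h5, h6⟩ := hA.comm_vtrans h3
        (fun h => hp _ _ (Or.inl rfl) (Or.inr rfl) (Or.inr h))
        (fun h => hp _ _ (Or.inr rfl) (Or.inr rfl) (Or.inr h))
      exact ⟨_, _, .sync h2 h4, .new (.parRight h5), ((SEq.refl _).par h6).new⟩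
    · exact ⟨_, _, .parLeft h2, .parRight hA, .refl _⟩
    · obtain ⟨A1', A2', h3, h4, h5⟩ := ih h2 (fun i j hi hj h => hp i j hi hj (Or.inr h))
      exact ⟨_, _, .parRight h3, .parRight h4, (SEq.refl _).par h5⟩
  | new hA ih =>
    obtain ⟨_, h1, rfl⟩ := itrans_new.1 h'
    obtain ⟨A1', A2', h3, h4, h5⟩ := ih h1 hp
    exact ⟨_, _, .new h3, .new h4, h5.new⟩

end PiI

namespace PiI

/-! ### Order of occurrence in lists -/

theorem idxOf_lt_of_pair_sublist {α : Type*} [DecidableEq α] {l : List α} (hl : l.Nodup) {a b : α}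
    (h : List.Sublist [a, b] l) : l.idxOf a < l.idxOf b := by
  induction l with
  | nil => simp at h
  | cons c l ih =>
    have hn := List.nodup_cons.1 hl
    by_cases hca : c = a
    · subst hca
      have hb : b ∈ l := by
        cases h with
        | cons _ h => exact h.subset (by simp)
        | cons_cons _ h => exact h.subset (by simp)
      have : c ≠ b := fun h => hn.1 (h ▸ hb)
      rw [List.idxOf_cons_self, List.idxOf_cons_ne _ this]
      omega
    · cases h with
      | cons _ h =>
        have hb : b ∈ l := h.subset (by simp)
        have : c ≠ b := fun h => hn.1 (h ▸ hb)
        rw [List.idxOf_cons_ne _ hca, List.idxOf_cons_ne _ this]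
        have := ih hn.2 h
        omega
      | cons_cons _ h => exact absurd rfl hca

theorem pair_sublist_of_idxOf_lt {α : Type*} [DecidableEq α] {l : List α} {a b : α} (hb : b ∈ l)
    (h : l.idxOf a < l.idxOf b) : List.Sublist [a, b] l := by
  induction l with
  | nil => simp at hb
  | cons c l ih =>
    have hcb : c ≠ b := by
      rintro rfl
      simp at h
    have hb' : b ∈ l := (List.mem_cons.1 hb).resolve_left (Ne.symm hcb)
    by_cases hca : c = a
    · subst hca
      exact List.Sublist.cons_cons _ (List.singleton_sublist.2 hb')
    · rw [List.idxOf_cons_ne _ hca, List.idxOf_cons_ne _ hcb] at h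
      exact List.Sublist.cons _ (ih hb' (by omega))

variable {𝕊 : Type v}
open Term

/-! ### Labelled transitions of processes over channels -/

section Sequences

variable {N : Type u}

/-- The locations of the process are distinct, and the channels that are free in it only go
through other locations, so that a channel revealed by a transition is always fresh. -/
structure Wf (P : Proc 𝕊 N) : Prop where
  nodup : P.locs.Nodup
  fresh : ∀ x ∈ P.free, ∀ b ∈ x.2, b.2 ∉ P.locs

theorem Wf.child_notMem {P : Proc 𝕊 N} (h : Wf P) (x : Channel N) (ε : Pola) {ι : ℕ}
    (hι : ι ∈ P.locs) : x.child ε ι ∉ P.free := by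
  intro hx
  exact h.fresh _ hx (ε, ι) (by simp [Channel.child]) hι

/-- Some action of the label `a` prefixes some action of the label `b`. -/
def Dep (P : Proc 𝕊 N) (a b : Label N) : Prop :=
  ∃ ι ∈ a.locs, ∃ κ ∈ b.locs, P.Prefixing ι κ

namespace Trans

theorem locs_sublist {P P' : Proc 𝕊 N} {a : Label N} (h : Trans P a P') :
    P'.locs.Sublist P.locs := by
  cases h with
  | vis h => rw [locs_rename]; exact h.locs_sublist
  | tau h => exact h.locs_sublist

theorem mem_locs {P P' : Proc 𝕊 N} {a : Label N} (h : Trans P a P') {ι : ℕ}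
    (hι : ι ∈ a.locs) : ι ∈ P.locs := by
  cases h with
  | vis h => simp only [Label.locs, List.mem_singleton] at hι; exact hι ▸ h.mem_locs
  | tau h =>
    have := h.mem_locs
    simp only [Label.locs, List.mem_cons, List.not_mem_nil, or_false] at hι
    rcases hι with rfl | rfl
    · exact this.1
    · exact this.2

theorem not_mem_locs {P P' : Proc 𝕊 N} {a : Label N} (h : Trans P a P') (hn : P.locs.Nodup)
    {ι : ℕ} (hι : ι ∈ a.locs) : ι ∉ P'.locs := by
  cases h with
  | vis h =>
    simp only [Label.locs, List.mem_singleton] at hι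
    rw [locs_rename]; exact hι ▸ h.not_mem_locs hn
  | tau h =>
    have := h.not_mem_locs hn
    simp only [Label.locs, List.mem_cons, List.not_mem_nil, or_false] at hι
    rcases hι with rfl | rfl
    · exact this.1
    · exact this.2

theorem label_nodup {P P' : Proc 𝕊 N} {a : Label N} (h : Trans P a P') (hn : P.locs.Nodup) :
    a.locs.Nodup := by
  cases h with
  | vis h => simp [Label.locs]
  | tau h => simpa [Label.locs] using h.ne hn

theorem not_prefixing {P P' : Proc 𝕊 N} {a : Label N} (h : Trans P a P') (hn : P.locs.Nodup)
    {ι : ℕ} (hι : ι ∈ a.locs) (κ : ℕ) : ¬ P.Prefixing κ ι := by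
  cases h with
  | vis h =>
    simp only [Label.locs, List.mem_singleton] at hι
    exact hι ▸ h.not_prefixing hn κ
  | tau h =>
    have := h.not_prefixing hn κ
    simp only [Label.locs, List.mem_cons, List.not_mem_nil, or_false] at hι
    rcases hι with rfl | rfl
    · exact this.1
    · exact this.2

theorem prefixing {P P' : Proc 𝕊 N} {a : Label N} (h : Trans P a P') (hn : P.locs.Nodup)
    {κ μ : ℕ} (hp : P.Prefixing κ μ) (hκ : κ ∉ a.locs) (hμ : μ ∈ P'.locs) :
    P'.Prefixing κ μ := by
  cases h with
  | vis h =>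
    simp only [Label.locs, List.mem_singleton] at hκ
    rw [locs_rename] at hμ
    exact (prefixing_rename _ _ _ _).2 (h.prefixing hn hp hκ hμ)
  | tau h =>
    simp only [Label.locs, List.mem_cons, List.not_mem_nil, or_false, not_or] at hκ
    exact h.prefixing hn hp hκ.1 hκ.2 hμ

theorem prefixing_of {P P' : Proc 𝕊 N} {a : Label N} (h : Trans P a P') {κ μ : ℕ}
    (hp : P'.Prefixing κ μ) : P.Prefixing κ μ := by
  cases h with
  | vis h => exact h.prefixing_of ((prefixing_rename _ _ _ _).1 hp)
  | tau h => exact h.prefixing_of hp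

theorem wf {P P' : Proc 𝕊 N} {a : Label N} (h : Trans P a P') (hP : Wf P) : Wf P' := by
  have hs := h.locs_sublist
  refine ⟨hs.nodup hP.nodup, ?_⟩
  cases h with
  | @vis x ε ι R h =>
    intro y hy b hb hb'
    obtain ⟨c, hc, rfl⟩ := (mem_free_rename _).1 hy
    rcases c with _ | c
    · simp only [Option.getD_none, Channel.child, List.mem_append, List.mem_singleton] at hb
      rcases hb with hb | rfl
      · exact hP.fresh _ h.mem_free b hb (hs.subset hb')
      · rw [locs_rename] at hb'
        exact h.not_mem_locs hP.nodup hb'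
    · exact hP.fresh _ (h.free_subset hc) b hb (hs.subset hb')
  | tau h =>
    intro y hy b hb hb'
    exact hP.fresh _ (h.free_subset hy) b hb (hs.subset hb')

theorem deterministic {P P' P'' : Proc 𝕊 N} {a b : Label N} (h : Trans P a P')
    (h' : Trans P b P'') (hn : P.locs.Nodup) (hab : a.locs = b.locs) : a = b ∧ P' = P'' := by
  cases h with
  | vis h =>
    cases h' with
    | vis h' =>
      simp only [Label.locs, List.cons.injEq, and_true] at hab
      subst hab
      obtain ⟨rfl, rfl, rfl⟩ := h.deterministic h' hn
      exact ⟨rfl, rfl⟩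
    | tau h' => simp [Label.locs] at hab
  | tau h =>
    cases h' with
    | vis h' => simp [Label.locs] at hab
    | tau h' =>
      simp only [Label.locs, List.cons.injEq, and_true] at hab
      obtain ⟨rfl, rfl⟩ := hab
      exact ⟨rfl, h.deterministic h' hn⟩

theorem comm {P P1 P2 : Proc 𝕊 N} {a b : Label N} (h : Trans P a P1) (h' : Trans P1 b P2)
    (hP : Wf P) (hd : ¬ Dep P a b) :
    ∃ P1' P2', Trans P b P1' ∧ Trans P1' a P2' ∧ SEq P2 P2' := by
  cases h with
  | @vis x ε ι R h =>
    cases h' with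
    | @vis y η κ R2 h' =>
      obtain ⟨c, R2', rfl, h1, rfl⟩ := h'.of_rename
      obtain ⟨b, A1, A2, rfl, h2, h3, h4⟩ := h.comm_vtrans h1
        (fun hp => hd ⟨ι, by simp [Label.locs], κ, by simp [Label.locs], hp⟩)
      refine ⟨_, _, .vis h2, .vis (h3.rename (fun o => o.getD (b.child η κ))), ?_⟩
      have := h4.rename ((fun o => Option.getD o (x.child ε ι)) ∘
        Option.map (fun o => Option.getD o (b.child η κ)))
      simp only [rename_rename, Option.getD_some] at this ⊢
      convert this using 2
      funext z
      rcases z with _ | _ | z <;> rfl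
    | @tau _ κ μ h' =>
      obtain ⟨R2, h1, rfl⟩ := h'.of_rename (by
        have hx := hP.child_notMem x ε h.mem_locs
        rintro (_ | y) hy (_ | z) hz hyz
        · rfl
        · exact absurd (h.free_subset hz) ((show x.child ε ι = z from hyz) ▸ hx)
        · exact absurd (h.free_subset hy) ((show y = x.child ε ι from hyz) ▸ hx)
        · exact congrArg some hyz)
      obtain ⟨P1', R2', h2, h3, h4⟩ := h.comm_itrans h1
        (fun hp => hd ⟨ι, by simp [Label.locs], κ, by simp [Label.locs], hp⟩)
        (fun hp => hd ⟨ι, by simp [Label.locs], μ, by simp [Label.locs], hp⟩)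
      exact ⟨_, _, .tau h2, .vis h3, h4.rename _⟩
  | @tau _ ι κ h =>
    cases h' with
    | @vis y η μ R2 h' =>
      obtain ⟨P1', R2', h2, h3, h4⟩ := h.comm_vtrans h'
        (fun hp => hd ⟨ι, by simp [Label.locs], μ, by simp [Label.locs], hp⟩)
        (fun hp => hd ⟨κ, by simp [Label.locs], μ, by simp [Label.locs], hp⟩)
      exact ⟨_, _, .vis h2, .tau (h3.rename _), h4.rename _⟩
    | @tau _ μ ν h' =>
      obtain ⟨P1', R2', h2, h3, h4⟩ := h.comm_itrans h'
        (fun i j hi hj hp => hd ⟨i, by simpa [Label.locs] using hi, j,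
          by simpa [Label.locs] using hj, hp⟩)
      exact ⟨_, _, .tau h2, .tau h3, h4⟩

end Trans

theorem SEq.transition {P Q P' : Proc 𝕊 N} {a : Label N} (h : SEq P Q) (hP : Trans P a P') :
    ∃ Q', Trans Q a Q' ∧ SEq P' Q' := by
  cases hP with
  | vis h1 =>
    obtain ⟨_, h2, h3⟩ := h.vtrans h1
    exact ⟨_, .vis h2, h3.rename _⟩
  | tau h1 =>
    obtain ⟨_, h2, h3⟩ := h.itrans h1
    exact ⟨_, .tau h2, h3⟩

theorem SEq.transSeq {P Q P' : Proc 𝕊 N} {p : List (Label N)} (h : SEq P Q)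
    (hP : TransSeq P p P') : ∃ Q', TransSeq Q p Q' ∧ SEq P' Q' := by
  induction hP generalizing Q with
  | nil => exact ⟨Q, .nil, h⟩
  | cons h1 _ ih =>
    obtain ⟨_, h2, h3⟩ := h.transition h1
    obtain ⟨_, h4, h5⟩ := ih h3
    exact ⟨_, .cons h2 h4, h5⟩

/-! ### Sequences of transitions -/

namespace TransSeq

theorem append {P Q R : Proc 𝕊 N} {p q : List (Label N)} (h : TransSeq P p Q)
    (h' : TransSeq Q q R) : TransSeq P (p ++ q) R := by
  induction h with
  | nil => exact h'
  | cons h1 _ ih => exact .cons h1 (ih h')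

theorem of_append {P R : Proc 𝕊 N} {p q : List (Label N)} (h : TransSeq P (p ++ q) R) :
    ∃ Q, TransSeq P p Q ∧ TransSeq Q q R := by
  induction p generalizing P with
  | nil => exact ⟨P, .nil, h⟩
  | cons a p ih =>
    cases h with
    | cons h1 h2 =>
      obtain ⟨Q, h3, h4⟩ := ih h2
      exact ⟨Q, .cons h1 h3, h4⟩

theorem locs_sublist {P Q : Proc 𝕊 N} {p : List (Label N)} (h : TransSeq P p Q) :
    Q.locs.Sublist P.locs := by
  induction h with
  | nil => exact List.Sublist.refl _
  | cons h1 _ ih => exact ih.trans h1.locs_sublist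

theorem mem_locs {P Q : Proc 𝕊 N} {p : List (Label N)} (h : TransSeq P p Q) {a : Label N}
    (ha : a ∈ p) {ι : ℕ} (hι : ι ∈ a.locs) : ι ∈ P.locs := by
  induction h with
  | nil => cases ha
  | cons h1 _ ih =>
    rcases List.mem_cons.1 ha with rfl | ha
    · exact h1.mem_locs hι
    · exact h1.locs_sublist.subset (ih ha)

theorem not_mem_locs {P Q : Proc 𝕊 N} {p : List (Label N)} (h : TransSeq P p Q)
    (hn : P.locs.Nodup) {a : Label N} (ha : a ∈ p) {ι : ℕ} (hι : ι ∈ a.locs) : ι ∉ Q.locs := by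
  induction h with
  | nil => cases ha
  | cons h1 h2 ih =>
    rcases List.mem_cons.1 ha with rfl | ha
    · exact fun h => h1.not_mem_locs hn hι (h2.locs_sublist.subset h)
    · exact ih (h1.locs_sublist.nodup hn) ha

theorem flatMap_nodup {P Q : Proc 𝕊 N} {p : List (Label N)} (h : TransSeq P p Q)
    (hn : P.locs.Nodup) : (p.flatMap Label.locs).Nodup := by
  induction h with
  | nil => simp
  | cons h1 h2 ih =>
    rw [List.flatMap_cons, List.nodup_append]
    refine ⟨h1.label_nodup hn, ih (h1.locs_sublist.nodup hn), ?_⟩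
    rintro ι hι κ hκ rfl
    obtain ⟨b, hb, hκ⟩ := List.mem_flatMap.1 hκ
    exact h1.not_mem_locs hn hι (h2.mem_locs hb hκ)

/-- A location determines the label of an interaction in which it occurs. -/
theorem label_unique {P Q : Proc 𝕊 N} {p : List (Label N)} (h : TransSeq P p Q)
    (hn : P.locs.Nodup) {a b : Label N} (ha : a ∈ p) (hb : b ∈ p) {ι : ℕ} (hιa : ι ∈ a.locs)
    (hιb : ι ∈ b.locs) : a = b := by
  induction h with
  | nil => cases ha
  | cons h1 h2 ih =>
    rcases List.mem_cons.1 ha with rfl | ha' <;> rcases List.mem_cons.1 hb with rfl | hb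
    · rfl
    · exact absurd (h2.mem_locs hb hιb) (h1.not_mem_locs hn hιa)
    · exact absurd (h2.mem_locs ha' hιa) (h1.not_mem_locs hn hιb)
    · exact ih (h1.locs_sublist.nodup hn) ha' hb

theorem nodup {P Q : Proc 𝕊 N} {p : List (Label N)} (h : TransSeq P p Q)
    (hn : P.locs.Nodup) : p.Nodup := by
  induction h with
  | nil => simp
  | @cons _ _ _ a _ h1 h2 ih =>
    refine List.nodup_cons.2 ⟨fun ha => ?_, ih (h1.locs_sublist.nodup hn)⟩
    obtain ⟨ι, hι⟩ : ∃ ι, ι ∈ a.locs := by cases a <;> simp [Label.locs]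
    exact h1.not_mem_locs hn hι (h2.mem_locs ha hι)

/-- The locations of the labels of an interaction determine its labels and its reduct. -/
theorem deterministic {P Q Q' : Proc 𝕊 N} {p q : List (Label N)} (h : TransSeq P p Q)
    (h' : TransSeq P q Q') (hn : P.locs.Nodup) (hpq : p.map Label.locs = q.map Label.locs) :
    p = q ∧ Q = Q' := by
  induction h generalizing q with
  | nil =>
    obtain rfl : q = [] := by simpa using hpq.symm
    cases h'
    exact ⟨rfl, rfl⟩
  | cons h1 _ ih =>
    cases h' with
    | nil => simp at hpq
    | cons h2 h3 =>
      simp only [List.map_cons, List.cons.injEq] at hpq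
      obtain ⟨rfl, rfl⟩ := h1.deterministic h2 hn hpq.1
      obtain ⟨rfl, rfl⟩ := ih h3 (h1.locs_sublist.nodup hn) hpq.2
      exact ⟨rfl, rfl⟩

/-- In an interaction, no label is causally required by a label that precedes it. -/
theorem pairwise {P Q : Proc 𝕊 N} {p : List (Label N)} (h : TransSeq P p Q)
    (hn : P.locs.Nodup) : p.Pairwise (fun a b => ¬ Dep P b a) := by
  induction h with
  | nil => exact .nil
  | cons h1 h2 ih =>
    refine List.pairwise_cons.2 ⟨?_, (ih (h1.locs_sublist.nodup hn)).imp_of_mem ?_⟩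
    · rintro b _ ⟨ι, _, κ, hκ, hp⟩
      exact h1.not_prefixing hn hκ ι hp
    · rintro a b ha hb hab ⟨ι, hι, κ, hκ, hp⟩
      refine hab ⟨ι, hι, κ, hκ, h1.prefixing hn hp (fun h => ?_) (h2.mem_locs ha hκ)⟩
      exact h1.not_mem_locs hn h (h2.mem_locs hb hι)

theorem not_dep_self {P Q : Proc 𝕊 N} {p : List (Label N)} (h : TransSeq P p Q)
    (hn : P.locs.Nodup) {a : Label N} (ha : a ∈ p) : ¬ Dep P a a := by
  induction h with
  | nil => cases ha
  | cons h1 h2 ih =>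
    rintro ⟨ι, hι, κ, hκ, hp⟩
    rcases List.mem_cons.1 ha with rfl | ha
    · exact h1.not_prefixing hn hκ ι hp
    · refine ih (h1.locs_sublist.nodup hn) ha
        ⟨ι, hι, κ, hκ, h1.prefixing hn hp (fun h => ?_) (h2.mem_locs ha hκ)⟩
      exact h1.not_mem_locs hn h (h2.mem_locs ha hι)

/-- Exchange of two consecutive labels. -/
theorem swap {P T : Proc 𝕊 N} {l r : List (Label N)} {a b : Label N}
    (h : TransSeq P (l ++ a :: b :: r) T) (hP : Wf P) (hd : ¬ Dep P a b) :
    ∃ T', TransSeq P (l ++ b :: a :: r) T' ∧ SEq T T' := by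
  induction l generalizing P with
  | nil =>
    cases h with
    | cons h1 h2 =>
      cases h2 with
      | cons h2 h3 =>
        obtain ⟨_, _, h4, h5, h6⟩ := h1.comm h2 hP hd
        obtain ⟨_, h7, h8⟩ := h6.transSeq h3
        exact ⟨_, .cons h4 (.cons h5 h7), h8⟩
  | cons c l ih =>
    cases h with
    | cons h1 h2 =>
      obtain ⟨_, h3, h4⟩ := ih h2 (h1.wf hP) (by
        rintro ⟨ι, hι, κ, hκ, hp⟩
        exact hd ⟨ι, hι, κ, hκ, h1.prefixing_of hp⟩)
      exact ⟨_, .cons h1 h3, h4⟩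

end TransSeq

/-- Two lists of labels are homotopic interactions. -/
def Homotopic (P : Proc 𝕊 N) (p q : List (Label N)) : Prop :=
  ∃ (hp : ∃ P', TransSeq P p P') (hq : ∃ P', TransSeq P q P'), homotopy P ⟨p, hp⟩ ⟨q, hq⟩

namespace Homotopic

theorem refl {P T : Proc 𝕊 N} {p : List (Label N)} (h : TransSeq P p T) : Homotopic P p p :=
  ⟨⟨T, h⟩, ⟨T, h⟩, (homotopy P).refl _⟩

theorem trans {P : Proc 𝕊 N} {p q r : List (Label N)} (h : Homotopic P p q)
    (h' : Homotopic P q r) : Homotopic P p r := by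
  obtain ⟨hp, _, h1⟩ := h
  obtain ⟨_, hr, h2⟩ := h'
  exact ⟨hp, hr, (homotopy P).trans h1 h2⟩

end Homotopic

theorem homotopy.perm {P : Proc 𝕊 N} {p q : Interaction P} (h : homotopy P p q) :
    p.1.Perm q.1 := by
  change Relation.EqvGen _ p q at h
  induction h with
  | rel p q h =>
    obtain ⟨l, r, a, b, _, hp, hq⟩ := h
    rw [hp, hq]
    exact List.Perm.append_left _ (List.Perm.swap _ _ _)
  | refl => exact List.Perm.refl _
  | symm _ _ _ ih => exact ih.symm
  | trans _ _ _ _ _ ih ih' => exact ih.trans ih'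

theorem TransSeq.independent {P T : Proc 𝕊 N} {l r : List (Label N)} {a b : Label N}
    (h : TransSeq P (l ++ a :: b :: r) T) (hP : Wf P) (hd : ¬ Dep P a b) :
    Independent P a b := by
  have h1 := h.flatMap_nodup hP.nodup
  have h2 := h.pairwise hP.nodup
  have h3 : ¬ Dep P b a := by
    have := (List.pairwise_append.1 h2).2.1
    exact (List.pairwise_cons.1 this).1 b (by simp)
  have h4 := h.not_dep_self hP.nodup (a := a) (by simp)
  have h5 := h.not_dep_self hP.nodup (a := b) (by simp)
  constructor
  · simp only [List.flatMap_append, List.flatMap_cons] at h1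
    rw [← List.append_assoc a.locs] at h1
    exact (List.nodup_append.1 (List.nodup_append.1 h1).2.1).1
  · intro ι hι κ hκ hp
    rcases List.mem_append.1 hι with hι | hι <;> rcases List.mem_append.1 hκ with hκ | hκ
    · exact h4 ⟨ι, hι, κ, hκ, hp⟩
    · exact hd ⟨ι, hι, κ, hκ, hp⟩
    · exact h3 ⟨ι, hι, κ, hκ, hp⟩
    · exact h5 ⟨ι, hι, κ, hκ, hp⟩

/-- In an interaction, a label can be moved to the front of a block that does not cause it. -/
theorem TransSeq.move {P T : Proc 𝕊 N} {c l r : List (Label N)} {a : Label N}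
    (h : TransSeq P (c ++ (l ++ a :: r)) T) (hP : Wf P) (hd : ∀ b ∈ l, ¬ Dep P b a) :
    ∃ T', TransSeq P (c ++ a :: (l ++ r)) T' ∧ SEq T T' ∧
      Homotopic P (c ++ (l ++ a :: r)) (c ++ a :: (l ++ r)) := by
  induction l using List.reverseRecOn generalizing r T with
  | nil => exact ⟨T, h, .refl _, .refl h⟩
  | append_singleton l b ih =>
    have e : c ++ (l ++ [b] ++ a :: r) = (c ++ l) ++ b :: a :: r := by simp
    have e' : (c ++ l) ++ a :: b :: r = c ++ (l ++ a :: b :: r) := by simp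
    have e'' : c ++ a :: (l ++ [b] ++ r) = c ++ a :: (l ++ b :: r) := by simp
    rw [e] at h ⊢
    have hba := hd b (by simp)
    obtain ⟨T1, h1, h2⟩ := h.swap hP hba
    have hh : Homotopic P ((c ++ l) ++ b :: a :: r) ((c ++ l) ++ a :: b :: r) :=
      ⟨⟨_, h⟩, ⟨_, h1⟩, Relation.EqvGen.rel _ _ ⟨_, _, _, _, h.independent hP hba, rfl, rfl⟩⟩
    rw [e'] at h1 hh
    obtain ⟨T2, h3, h4, h5⟩ := ih h1 (fun d hd' => hd d (by simp [hd']))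
    rw [e'']
    exact ⟨T2, h3, h2.trans h4, hh.trans h5⟩

/-- A rearrangement of an interaction that respects prefixing is an homotopic interaction. -/
theorem TransSeq.rearrange {P T : Proc 𝕊 N} {c p q : List (Label N)}
    (h : TransSeq P (c ++ p) T) (hP : Wf P) (hpq : p.Perm q)
    (hq : q.Pairwise (fun a b => ¬ Dep P b a)) :
    ∃ T', TransSeq P (c ++ q) T' ∧ SEq T T' ∧ Homotopic P (c ++ p) (c ++ q) := by
  induction q generalizing c p T with
  | nil =>
    obtain rfl := hpq.eq_nil
    exact ⟨T, h, .refl _, .refl h⟩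
  | cons a q ih =>
    obtain ⟨l, r, rfl⟩ := List.append_of_mem (hpq.mem_iff.2 List.mem_cons_self)
    have hlr : (l ++ r).Perm q :=
      List.Perm.cons_inv (List.perm_middle.symm.trans hpq)
    rw [List.pairwise_cons] at hq
    obtain ⟨T1, h1, h2, h3⟩ := h.move hP
      (fun b hb => hq.1 b (hlr.subset (List.mem_append_left _ hb)))
    have e : ∀ s, c ++ a :: s = (c ++ [a]) ++ s := by simp
    rw [e] at h1 h3 ⊢
    obtain ⟨T2, h4, h5, h6⟩ := ih h1 hlr hq.2
    exact ⟨T2, h4, h2.trans h5, h3.trans h6⟩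

theorem TransSeq.homotopic_of_perm {P T T' : Proc 𝕊 N} {p q : List (Label N)}
    (h : TransSeq P p T) (h' : TransSeq P q T') (hP : Wf P) (hpq : p.Perm q) :
    Homotopic P p q ∧ SEq T T' := by
  obtain ⟨T1, h1, h2, h3⟩ := TransSeq.rearrange (c := []) h hP hpq (h'.pairwise hP.nodup)
  obtain ⟨_, rfl⟩ := TransSeq.deterministic (p := q) h1 h' hP.nodup rfl
  exact ⟨h3, h2⟩

/-- The pre-trace of an interaction. -/
def TransSeq.pretrace {P T : Proc 𝕊 N} {p : List (Label N)} (h : TransSeq P p T) : Pretrace P :=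
  Quotient.mk (homotopy P) ⟨p, ⟨T, h⟩⟩

/-- The list of labels `p` belongs to the pre-trace `ρ`. -/
def Pretrace.Has {P : Proc 𝕊 N} (ρ : Pretrace P) (p : List (Label N)) : Prop :=
  ∃ h : ∃ T, TransSeq P p T, ρ.Contains ⟨p, h⟩

namespace Pretrace

variable {P : Proc 𝕊 N}

theorem has_pretrace {T : Proc 𝕊 N} {p : List (Label N)} (h : TransSeq P p T) :
    h.pretrace.Has p := ⟨⟨T, h⟩, rfl⟩

theorem exists_has (ρ : Pretrace P) : ∃ p, ρ.Has p :=
  ⟨(Quotient.out ρ).1, (Quotient.out ρ).2, Quotient.out_eq ρ⟩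

theorem Has.transSeq {ρ : Pretrace P} {p : List (Label N)} (h : ρ.Has p) :
    ∃ T, TransSeq P p T := h.1

theorem Has.perm {ρ : Pretrace P} {p q : List (Label N)} (hp : ρ.Has p) (hq : ρ.Has q) :
    p.Perm q := by
  obtain ⟨hp', hp⟩ := hp
  obtain ⟨hq', hq⟩ := hq
  exact homotopy.perm (Quotient.exact (hp.trans hq.symm))

theorem Has.of_perm (hP : Wf P) {ρ : Pretrace P} {p q : List (Label N)} {T : Proc 𝕊 N}
    (hp : ρ.Has p) (hq : TransSeq P q T) (hpq : p.Perm q) : ρ.Has q := by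
  obtain ⟨⟨T', hp'⟩, hp⟩ := hp
  obtain ⟨⟨_, _, h⟩, _⟩ := hp'.homotopic_of_perm hq hP hpq
  exact ⟨⟨_, hq⟩, (Quotient.sound h).symm.trans hp⟩

/-- The labels of an interaction, up to permutation, determine its pre-trace. -/
theorem Has.unique (hP : Wf P) {ρ σ : Pretrace P} {p q : List (Label N)}
    (hp : ρ.Has p) (hq : σ.Has q) (hpq : p.Perm q) : ρ = σ := by
  obtain ⟨T, hT⟩ := hq.transSeq
  obtain ⟨_, h⟩ := hp.of_perm hP hT hpq
  obtain ⟨_, h'⟩ := hq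
  exact h.symm.trans h'

theorem Has.hasLabel_iff {ρ : Pretrace P} {p : List (Label N)} (hp : ρ.Has p) (a : Label N) :
    ρ.HasLabel a ↔ a ∈ p := by
  constructor
  · rintro ⟨q, hq, ha⟩
    exact (hp.perm ⟨q.2, hq⟩).mem_iff.2 ha
  · exact fun ha => ⟨⟨p, hp.1⟩, hp.2, ha⟩

theorem Has.triggers_iff {ρ : Pretrace P} {p : List (Label N)} (hp : ρ.Has p) (ι : ℕ) :
    ρ.Triggers ι ↔ ι ∈ p.flatMap Label.locs := by
  simp only [Triggers, hp.hasLabel_iff, List.mem_flatMap]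

theorem reduct_transSeq (ρ : Pretrace P) : ∃ p, ρ.Has p ∧ TransSeq P p ρ.reduct :=
  ⟨(Quotient.out ρ).1, ⟨(Quotient.out ρ).2, Quotient.out_eq ρ⟩,
    Classical.choose_spec (Quotient.out ρ).2⟩

theorem Has.seq_reduct (hP : Wf P) {ρ : Pretrace P} {p : List (Label N)} (hp : ρ.Has p)
    {T : Proc 𝕊 N} (hT : TransSeq P p T) : SEq ρ.reduct T := by
  obtain ⟨q, hq, h⟩ := ρ.reduct_transSeq
  exact (h.homotopic_of_perm hT hP (hq.perm hp)).2

/-- Prefixing implies causality: homotopy never exchanges an action with one of its prefixes. -/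
theorem Has.causal_of_dep (hP : Wf P) {ρ : Pretrace P} {p : List (Label N)} (hp : ρ.Has p)
    {a b : Label N} (ha : a ∈ p) (hb : b ∈ p) (hd : Dep P a b) : ρ.Causal a b := by
  refine ⟨(hp.hasLabel_iff a).2 ha, (hp.hasLabel_iff b).2 hb, Or.inr fun q hq => ?_⟩
  have hq' : ρ.Has q.1 := ⟨q.2, hq⟩
  obtain ⟨T, hT⟩ := hq'.transSeq
  have ha' := (hp.perm hq').mem_iff.1 ha
  have hb' := (hp.perm hq').mem_iff.1 hb
  obtain ⟨l, r, e⟩ := List.append_of_mem ha'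
  have hpw := hT.pairwise hP.nodup
  rw [e] at hb' hpw ⊢
  rcases List.mem_append.1 hb' with hb' | hb'
  · exact absurd hd ((List.pairwise_append.1 hpw).2.2 b hb' a List.mem_cons_self)
  · rcases List.mem_cons.1 hb' with rfl | hb'
    · exact absurd hd (hT.not_dep_self hP.nodup ha')
    · refine List.Sublist.trans ?_ (List.sublist_append_right _ _)
      exact List.Sublist.cons_cons _ (List.singleton_sublist.2 hb')

theorem Has.causal_trans {ρ : Pretrace P} (hn : P.locs.Nodup)
    {a b c : Label N} (hab : ρ.Causal a b) (hbc : ρ.Causal b c) : ρ.Causal a c := by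
  classical
  obtain ⟨ha, hb, hab⟩ := hab
  obtain ⟨_, hc, hbc⟩ := hbc
  refine ⟨ha, hc, ?_⟩
  rcases hab with rfl | hab
  · exact hbc
  rcases hbc with rfl | hbc
  · exact Or.inr hab
  refine Or.inr fun q hq => ?_
  obtain ⟨T, hT⟩ := q.2
  have hnd := hT.nodup hn
  have h1 := hab q hq
  have h2 := hbc q hq
  exact pair_sublist_of_idxOf_lt (h2.subset (by simp))
    ((idxOf_lt_of_pair_sublist hnd h1).trans (idxOf_lt_of_pair_sublist hnd h2))

end Pretrace

end Sequences

end PiI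

namespace PiI

variable {𝕊 : Type v}
open Term

/-! ### Sorting the visible actions of a pre-trace -/

theorem exists_perm_map_eq {α β : Type*} (f : α → β) {l : List α} {m : List β}
    (h : (l.map f).Perm m) : ∃ l', l.Perm l' ∧ l'.map f = m := by
  generalize hk : l.map f = k at h
  induction h generalizing l with
  | nil => exact ⟨l, .refl _, hk⟩
  | cons x _ ih =>
    obtain ⟨a, l, rfl, rfl, rfl⟩ := List.map_eq_cons_iff.1 hk
    obtain ⟨l', h1, rfl⟩ := ih rfl
    exact ⟨a :: l', h1.cons a, rfl⟩
  | swap x y k =>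
    obtain ⟨a, l, rfl, rfl, h⟩ := List.map_eq_cons_iff.1 hk
    obtain ⟨b, l, rfl, rfl, rfl⟩ := List.map_eq_cons_iff.1 h
    exact ⟨b :: a :: l, .swap _ _ _, rfl⟩
  | trans _ _ ih ih' =>
    obtain ⟨l1, h1, h2⟩ := ih hk
    obtain ⟨l2, h3, h4⟩ := ih' h2
    exact ⟨l2, h1.trans h3, h4⟩

section

variable {N : Type u}

/-- The event of a visible label. -/
def Label.event : Label N → Option (Event N)
  | vis x ε ι => some (x, ε, Slot.loc ι)
  | tau _ _ => none

theorem Label.event_eq_some {a : Label N} {e : Event N} (h : a.event = some e) :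
    ∃ x ε ι, a = vis x ε ι ∧ e = (x, ε, Slot.loc ι) := by
  cases a with
  | vis x ε ι => exact ⟨x, ε, ι, rfl, by simpa [event] using h.symm⟩
  | tau => simp [event] at h

/-- The events of the visible labels of a list, in order. -/
def events (p : List (Label N)) : List (Event N) := p.filterMap Label.event

theorem mem_events {p : List (Label N)} {x : Channel N} {ε : Pola} {s : Slot} :
    ((x, ε, s) : Event N) ∈ events p ↔ ∃ ι, s = Slot.loc ι ∧ Label.vis x ε ι ∈ p := by
  rw [events, List.mem_filterMap]
  constructor
  · rintro ⟨a, ha, h⟩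
    obtain ⟨y, η, ι, rfl, h⟩ := Label.event_eq_some h
    cases h
    exact ⟨ι, rfl, ha⟩
  · rintro ⟨ι, rfl, h⟩
    exact ⟨_, h, rfl⟩

theorem Label.event_injective {a b : Label N} {e : Event N} (ha : a.event = some e)
    (hb : b.event = some e) : a = b := by
  obtain ⟨x, ε, ι, rfl, rfl⟩ := Label.event_eq_some ha
  obtain ⟨y, η, κ, rfl, h⟩ := Label.event_eq_some hb
  cases h
  rfl

theorem events_nodup {p : List (Label N)} (hp : p.Nodup) : (events p).Nodup :=
  hp.filterMap fun _ _ _ hb hb' => Label.event_injective hb hb'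

open Classical in
/-- An interaction can be rearranged so that the ranks of its visible actions increase, if the
ranks increase along causality. The actions that come first are a visible one of least rank and
the internal ones that cause it. -/
theorem TransSeq.exists_sorted {P T : Proc 𝕊 N} {c p : List (Label N)}
    (h : TransSeq P (c ++ p) T) (hP : Wf P) (r : Event N → ℕ)
    (hr : ∀ a ∈ p, ∀ b ∈ p, ∀ e f, a.event = some e → b.event = some f →
      Relation.ReflTransGen (fun a b => a ∈ p ∧ b ∈ p ∧ Dep P a b) a b → r e ≤ r f) :
    ∃ p', p.Perm p' ∧ (∃ T', TransSeq P (c ++ p') T') ∧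
      (events p').Pairwise (fun e f => r e ≤ r f) := by
  induction hn : p.length using Nat.strong_induction_on generalizing c p T with
  | _ n ih =>
    by_cases hv : ∃ a ∈ p, ∃ e, a.event = some e
    · obtain ⟨a, ⟨ha, e, he⟩, hmin⟩ : ∃ a, (a ∈ p ∧ ∃ e, a.event = some e) ∧
          ∀ b, (b ∈ p ∧ ∃ e, b.event = some e) →
            (a.event.map r).getD 0 ≤ (b.event.map r).getD 0 := by
        obtain ⟨a, ha, e, he⟩ := hv
        have hne : {b | b ∈ p ∧ ∃ e, b.event = some e}.Nonempty := ⟨a, ha, e, he⟩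
        obtain ⟨b, hb, hmin⟩ := WellFounded.has_min
          (InvImage.wf (fun b : Label N => (b.event.map r).getD 0) Nat.lt_wfRel.wf) _ hne
        exact ⟨b, hb, fun d hd => not_lt.1 (hmin d hd)⟩
      set R := fun a b => a ∈ p ∧ b ∈ p ∧ Dep P a b with hR
      -- The causes of the visible action `a` of least rank, itself included, come first.
      set q1 := p.filter (fun b => decide (Relation.ReflTransGen R b a)) with hq1
      set q2 := p.filter (fun b => !decide (Relation.ReflTransGen R b a)) with hq2
      have hperm : p.Perm (q1 ++ q2) := (List.filter_append_perm _ p).symm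
      have hpw := h.pairwise hP.nodup
      rw [List.pairwise_append] at hpw
      have hpw' : (q1 ++ q2).Pairwise (fun a b => ¬ Dep P b a) := by
        refine List.pairwise_append.2 ⟨hpw.2.1.filter _, hpw.2.1.filter _, ?_⟩
        intro x hx y hy hd
        simp only [hq1, hq2, List.mem_filter, decide_eq_true_eq, Bool.not_eq_true',
          decide_eq_false_iff_not] at hx hy
        exact hy.2 (Relation.ReflTransGen.head ⟨hy.1, hx.1, hd⟩ hx.2)
      obtain ⟨T1, h1, _, _⟩ := h.rearrange hP hperm hpw'
      rw [← List.append_assoc] at h1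
      have haq : a ∈ q1 := by
        simp only [hq1, List.mem_filter, decide_eq_true_eq]
        exact ⟨ha, .refl⟩
      have hlen : q2.length < n := by
        have := hperm.length_eq
        rw [List.length_append] at this
        have := List.length_pos_of_mem haq
        omega
      have hsub : ∀ {x}, x ∈ q2 → x ∈ p := fun h => (List.mem_filter.1 h).1
      obtain ⟨p2, h2, ⟨T2, h3⟩, h4⟩ := ih _ hlen h1 (by
        intro x hx y hy e f he hf hxy
        refine hr x (hsub hx) y (hsub hy) e f he hf (Relation.ReflTransGen.mono
          (fun s t ⟨hs, ht, hd⟩ => ⟨hsub hs, hsub ht, hd⟩) x y hxy)) rfl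
      rw [List.append_assoc] at h3
      refine ⟨q1 ++ p2, hperm.trans (h2.append_left q1), ⟨T2, h3⟩, ?_⟩
      -- A visible cause of `a` has rank at most, hence exactly, that of `a`.
      have hle : ∀ f ∈ events q1, r f ≤ r e := by
        intro f hf
        obtain ⟨b, hb, hbf⟩ := List.mem_filterMap.1 hf
        obtain ⟨hb, hba⟩ := List.mem_filter.1 hb
        exact hr b hb a ha f e hbf he (by simpa using hba)
      have hge : ∀ f ∈ events p, r e ≤ r f := by
        intro f hf
        obtain ⟨b, hb, hbf⟩ := List.mem_filterMap.1 hf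
        simpa [he, hbf] using hmin b ⟨hb, f, hbf⟩
      have hev : events (q1 ++ p2) = events q1 ++ events p2 := List.filterMap_append
      rw [hev, List.pairwise_append]
      have hin : ∀ f ∈ events (q1 ++ q2), f ∈ events p :=
        fun f hf => ((hperm.filterMap _).mem_iff).2 hf
      have hev' : events (q1 ++ q2) = events q1 ++ events q2 := List.filterMap_append
      rw [hev'] at hin
      refine ⟨?_, h4, ?_⟩
      · refine List.pairwise_of_forall_mem_list ?_
        intro x hx y hy
        exact (hle x hx).trans (hge y (hin y (List.mem_append_left _ hy)))
      · intro x hx y hy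
        have hy' : y ∈ events q2 := ((h2.filterMap _).mem_iff).2 hy
        exact (hle x hx).trans (hge y (hin y (List.mem_append_right _ hy')))
    · refine ⟨p, .refl _, ⟨T, h⟩, ?_⟩
      have : events p = [] := by
        rw [events, List.filterMap_eq_nil_iff]
        intro a ha
        by_contra hne
        obtain ⟨e, he⟩ := Option.ne_none_iff_exists'.1 hne
        exact hv ⟨a, ha, e, he⟩
      rw [this]
      exact .nil

/-- The visible actions of a pre-trace can be played in any order compatible with causality. -/
theorem Pretrace.exists_has_sorted {P : Proc 𝕊 N} (hP : Wf P) (ρ : Pretrace P)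
    (r : Event N → ℕ)
    (hr : ∀ x ε ι y η κ, ρ.Causal (Label.vis x ε ι) (Label.vis y η κ) →
      r (x, ε, Slot.loc ι) ≤ r (y, η, Slot.loc κ)) :
    ∃ p, ρ.Has p ∧ (events p).Pairwise (fun e f => r e ≤ r f) := by
  obtain ⟨p, hp⟩ := ρ.exists_has
  obtain ⟨T, hT⟩ := hp.transSeq
  obtain ⟨p', h1, ⟨T', h2⟩, h3⟩ := TransSeq.exists_sorted (c := []) hT hP r (by
    intro a ha b hb e f he hf hab
    have hc : ρ.Causal a b := by
      clear hb hf
      induction hab with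
      | refl => exact ⟨(hp.hasLabel_iff a).2 ha, (hp.hasLabel_iff a).2 ha, Or.inl rfl⟩
      | tail _ h ih =>
        exact Pretrace.Has.causal_trans hP.nodup ih (hp.causal_of_dep hP h.1 h.2.1 h.2.2)
    obtain ⟨x, ε, ι, rfl, rfl⟩ := Label.event_eq_some he
    obtain ⟨y, η, κ, rfl, rfl⟩ := Label.event_eq_some hf
    exact hr _ _ _ _ _ _ hc)
  exact ⟨p', hp.of_perm hP h2 h1, h3⟩

end

end PiI

namespace PiI

open Term

/-! ### Residuals of simple terms -/

namespace Inactions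

/-- Renaming of free names. -/
def rename {V W : Type u} (f : V → W) : Inactions V → Inactions W
  | single ι a ε => single ι (f a) ε
  | sum S T => sum (S.rename f) (T.rename f)

theorem locs_rename {V W : Type u} (f : V → W) (S : Inactions V) :
    (S.rename f).locs = S.locs := by
  induction S <;> simp_all [rename, locs]

variable {𝕊 : Type v} [CommSemiring 𝕊] {V : Type u}

theorem toTerm_rename {W : Type u} (f : V → W) (S : Inactions V) :
    (S.rename f).toTerm 𝕊 = (S.toTerm 𝕊).rename f := by
  induction S <;> simp_all [rename, toTerm, Term.rename]

theorem locs_toTerm (S : Inactions V) : (S.toTerm 𝕊).locs = S.locs := by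
  induction S <;> simp_all [locs, toTerm, Term.locs]

theorem vtrans {S : Inactions V} {a : V} {ε : Pola} {ι : ℕ} {T : Term 𝕊 Kind.proc (Option V)}
    (h : VTrans (S.toTerm 𝕊) a ε ι T) : ι ∈ S.locs ∧ T = Term.out 0 := by
  induction S with
  | single κ b η =>
    obtain ⟨rfl, rfl, rfl, rfl⟩ := vtrans_act.1 h
    simp [locs]
  | sum S S' ih ih' =>
    rcases vtrans_sum.1 h with h | h
    · simp [locs, ih h]
    · simp [locs, ih' h]

theorem hasInaction_iff (S : Inactions V) (ε : Pola) (a : V) :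
    (S.toTerm 𝕊).HasInaction ε a ↔ ∃ ι T, VTrans (S.toTerm 𝕊) a ε ι T := by
  induction S with
  | single κ b η =>
    simp only [toTerm, HasInaction, vtrans_act]
    grind
  | sum S S' ih ih' =>
    simp only [toTerm, HasInaction, vtrans_sum, ih, ih']
    grind

theorem not_hasDualInactions (S : Inactions V) : ¬ (S.toTerm 𝕊).HasDualInactions := by
  induction S <;> simp_all [toTerm, HasDualInactions]

end Inactions

/-- The terms that a simple term can reach without triggering an inaction: linear actions may be
pending (`lin`) or half-way (`run`), when the prefix has been triggered but its `w.1` has not. -/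
inductive Residual : Type u → Type (u + 1)
  | one {V : Type u} : Residual V
  | inact {V : Type u} (S : Inactions V) : Residual V
  | lin {V : Type u} (ι ι₁ ι₀ κ : ℕ) (a : V) (ε : Pola) (P : Residual (Option V)) : Residual V
  | run {V : Type u} (ι₁ ι₀ κ : ℕ) (P : Residual V) : Residual V
  | par {V : Type u} (P Q : Residual V) : Residual V
  | new {V : Type u} (P : Residual (Option V)) : Residual V

namespace Residual

/-- A simple term as a residual. -/
def ofSimple : {V : Type u} → Simple V → Residual V
  | _, .one => one
  | _, .inact S => inact S
  | _, .lin ι ι₁ ι₀ κ a ε P => lin ι ι₁ ι₀ κ a ε (ofSimple P)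
  | _, .par P Q => par (ofSimple P) (ofSimple Q)
  | _, .new P => new (ofSimple P)

/-- The process denoted by a residual. -/
def toTerm (𝕊 : Type v) [CommSemiring 𝕊] : {V : Type u} → Residual V → Term 𝕊 Kind.proc V
  | _, one => Term.out 1
  | _, inact S => Term.br (S.toTerm 𝕊)
  | _, lin ι ι₁ ι₀ κ a ε P =>
      Term.new (Term.par (Term.par
        (Term.br (Term.act ι (some a) ε
          (Term.par ((toTerm 𝕊 P).rename (Option.map some))
            (Term.br (Term.act ι₁ (some none) Pola.pos (Term.out 1))))))
        (Term.br (Term.act ι₀ none Pola.pos (Term.out 0))))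
        (Term.br (Term.act κ none Pola.neg (Term.out 1))))
  | _, run ι₁ ι₀ κ P =>
      Term.new (Term.par (Term.par (Term.par ((toTerm 𝕊 P).rename some)
            (Term.br (Term.act ι₁ none Pola.pos (Term.out 1))))
        (Term.br (Term.act ι₀ none Pola.pos (Term.out 0))))
        (Term.br (Term.act κ none Pola.neg (Term.out 1))))
  | _, par P Q => Term.par (toTerm 𝕊 P) (toTerm 𝕊 Q)
  | _, new P => Term.new (toTerm 𝕊 P)

/-- The locations of the actions `w.1` of the linear actions that are not completed. -/
def lins : {V : Type u} → Residual V → List ℕ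
  | _, one => []
  | _, inact _ => []
  | _, lin _ ι₁ _ _ _ _ P => ι₁ :: lins P
  | _, run ι₁ _ _ P => ι₁ :: lins P
  | _, par P Q => lins P ++ lins Q
  | _, new P => lins P

/-- The locations of the inactions. -/
def inacts : {V : Type u} → Residual V → List ℕ
  | _, one => []
  | _, inact S => S.locs
  | _, lin _ _ ι₀ _ _ _ P => ι₀ :: inacts P
  | _, run _ ι₀ _ P => ι₀ :: inacts P
  | _, par P Q => inacts P ++ inacts Q
  | _, new P => inacts P

/-- Renaming of free names. -/
def rename : {V : Type u} → Residual V → {W : Type u} → (V → W) → Residual W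
  | _, one, _, _ => one
  | _, inact S, _, f => inact (S.rename f)
  | _, lin ι ι₁ ι₀ κ a ε P, _, f => lin ι ι₁ ι₀ κ (f a) ε (rename P (Option.map f))
  | _, run ι₁ ι₀ κ P, _, f => run ι₁ ι₀ κ (rename P f)
  | _, par P Q, _, f => par (rename P f) (rename Q f)
  | _, new P, _, f => new (rename P (Option.map f))

theorem lins_rename {V : Type u} (R : Residual V) {W : Type u} (f : V → W) :
    (R.rename f).lins = R.lins := by
  induction R generalizing W <;> simp_all [rename, lins]

theorem inacts_rename {V : Type u} (R : Residual V) {W : Type u} (f : V → W) :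
    (R.rename f).inacts = R.inacts := by
  induction R generalizing W <;> simp_all [rename, inacts, Inactions.locs_rename]

theorem lins_ofSimple {V : Type u} (P : Simple V) : (ofSimple P).lins = P.linearLocs := by
  induction P <;> simp_all [ofSimple, lins, Simple.linearLocs]

theorem inacts_ofSimple {V : Type u} (P : Simple V) : (ofSimple P).inacts = P.inactionLocs := by
  induction P <;> simp_all [ofSimple, inacts, Simple.inactionLocs]

variable {𝕊 : Type v} [CommSemiring 𝕊]

theorem toTerm_ofSimple {V : Type u} (P : Simple V) : (ofSimple P).toTerm 𝕊 = P.toTerm 𝕊 := by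
  induction P <;> simp_all [ofSimple, toTerm, Simple.toTerm]

theorem toTerm_rename {V : Type u} (R : Residual V) {W : Type u} (f : V → W) :
    (R.rename f).toTerm 𝕊 = (R.toTerm 𝕊).rename f := by
  induction R generalizing W with
  | one => rfl
  | inact S => simp [rename, toTerm, Term.rename, Inactions.toTerm_rename]
  | lin ι ι₁ ι₀ κ a ε P ih =>
    simp only [rename, toTerm, Term.rename, ih, rename_rename, Option.map_comp_map]
    rfl
  | run ι₁ ι₀ κ P ih =>
    simp only [rename, toTerm, Term.rename, ih, rename_rename]
    rfl
  | par P Q ihP ihQ => simp only [rename, toTerm, Term.rename, ihP, ihQ]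
  | new P ih => simp only [rename, toTerm, Term.rename, ih]

theorem lins_subset {V : Type u} (R : Residual V) : R.lins ⊆ (R.toTerm 𝕊).locs := by
  induction R <;> simp_all [lins, toTerm, Term.locs, Term.locs_rename, List.subset_def]
  all_goals grind

theorem inacts_subset {V : Type u} (R : Residual V) : R.inacts ⊆ (R.toTerm 𝕊).locs := by
  induction R <;> simp_all [inacts, toTerm, Term.locs, Term.locs_rename, List.subset_def,
    Inactions.locs_toTerm]
  all_goals grind

theorem _root_.PiI.Term.state_rename {k : Kind} {V : Type u} (P : Term 𝕊 k V) {W : Type u}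
    (f : V → W) : (P.rename f).state = P.state := by
  induction P generalizing W <;> simp_all [Term.rename, state]

theorem state_toTerm {V : Type u} (R : Residual V) : (R.toTerm 𝕊).state = 1 := by
  induction R <;> simp_all [toTerm, state, state_rename]

/-- A visible transition of a residual triggers an inaction, or the prefix of a linear action. -/
theorem vtrans {V : Type u} {R : Residual V} {a : V} {ε : Pola} {ι : ℕ}
    {T : Term 𝕊 Kind.proc (Option V)} (h : VTrans (R.toTerm 𝕊) a ε ι T) :
    (ι ∈ R.inacts ∧ T.state = 0) ∨
      ∃ R' : Residual (Option V), T = R'.toTerm 𝕊 ∧ R'.inacts = R.inacts ∧ R'.lins = R.lins := by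
  induction R with
  | one => exact absurd h vtrans_out
  | inact S =>
    obtain ⟨h1, rfl⟩ := Inactions.vtrans (vtrans_br.1 h)
    exact Or.inl ⟨h1, rfl⟩
  | lin κ ι₁ ι₀ κ' b η P ih =>
    obtain ⟨_, h1, rfl⟩ := vtrans_new.1 h
    rcases vtrans_par.1 h1 with ⟨_, h2, rfl⟩ | ⟨_, h2, rfl⟩
    · rcases vtrans_par.1 h2 with ⟨_, h3, rfl⟩ | ⟨_, h3, rfl⟩
      · obtain ⟨_, rfl, rfl, rfl⟩ := vtrans_act.1 (vtrans_br.1 h3)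
        refine Or.inr ⟨run ι₁ ι₀ κ' P, ?_, rfl, rfl⟩
        simp only [toTerm, Term.rename, rename_rename, swapNames_comp_map_some]
        rfl
      · cases (vtrans_act.1 (vtrans_br.1 h3)).1
    · cases (vtrans_act.1 (vtrans_br.1 h2)).1
  | run ι₁ ι₀ κ' P ih =>
    obtain ⟨_, h1, rfl⟩ := vtrans_new.1 h
    rcases vtrans_par.1 h1 with ⟨_, h2, rfl⟩ | ⟨_, h2, rfl⟩
    · rcases vtrans_par.1 h2 with ⟨_, h3, rfl⟩ | ⟨_, h3, rfl⟩
      · rcases vtrans_par.1 h3 with ⟨_, h4, rfl⟩ | ⟨_, h4, rfl⟩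
        · obtain ⟨c, P', hc, h5, rfl⟩ := h4.of_rename
          obtain rfl := Option.some_injective _ hc
          rcases ih h5 with ⟨h6, h7⟩ | ⟨R', rfl, h6, h7⟩
          · exact Or.inl ⟨List.mem_cons_of_mem _ h6, by simp [state, state_rename, h7]⟩
          · refine Or.inr ⟨run ι₁ ι₀ κ' R', ?_, by simp [inacts, h6], by simp [lins, h7]⟩
            simp only [toTerm, Term.rename, rename_rename, swapNames_comp_map_some]
            rfl
        · cases (vtrans_act.1 (vtrans_br.1 h4)).1
      · cases (vtrans_act.1 (vtrans_br.1 h3)).1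
    · cases (vtrans_act.1 (vtrans_br.1 h2)).1
  | par P Q ihP ihQ =>
    rcases vtrans_par.1 h with ⟨_, h1, rfl⟩ | ⟨_, h1, rfl⟩
    · rcases ihP h1 with ⟨h6, h7⟩ | ⟨R', rfl, h6, h7⟩
      · exact Or.inl ⟨List.mem_append_left _ h6, by simp [state, h7]⟩
      · exact Or.inr ⟨par R' (Q.rename some), by simp [toTerm, toTerm_rename],
          by simp [inacts, h6, inacts_rename], by simp [lins, h7, lins_rename]⟩
    · rcases ihQ h1 with ⟨h6, h7⟩ | ⟨R', rfl, h6, h7⟩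
      · exact Or.inl ⟨List.mem_append_right _ h6, by simp [state, h7]⟩
      · exact Or.inr ⟨par (P.rename some) R', by simp [toTerm, toTerm_rename],
          by simp [inacts, h6, inacts_rename], by simp [lins, h7, lins_rename]⟩
  | new P ih =>
    obtain ⟨_, h1, rfl⟩ := vtrans_new.1 h
    rcases ih h1 with ⟨h6, h7⟩ | ⟨R', rfl, h6, h7⟩
    · exact Or.inl ⟨h6, by simp [state, state_rename, h7]⟩
    · exact Or.inr ⟨new (R'.rename swapNames), by simp [toTerm, toTerm_rename],
        by simp [inacts, h6, inacts_rename], by simp [lins, h7, lins_rename]⟩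

/-- What a transition at the locations in `L` that triggers no inaction can do to a residual `R`:
the inactions of the result `R'` are those of `R`, and the linear actions that disappear are
triggered, at a location in `L`. -/
structure Step {V W : Type u} (R : Residual V) (L : List ℕ) (R' : Residual W) : Prop where
  inacts : ∀ μ, μ ∈ R'.inacts ↔ μ ∈ R.inacts
  lins_subset : ∀ μ ∈ R'.lins, μ ∈ R.lins
  lins : ∀ μ ∈ R.lins, μ ∈ R'.lins ∨ μ ∈ L

/-- An internal transition of a residual triggers an inaction, which makes the state zero, or leads
to a residual with the same inactions. -/
theorem itrans {V : Type u} {R : Residual V} {ι κ : ℕ}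
    {T : Term 𝕊 Kind.proc V} (h : ITrans (R.toTerm 𝕊) ι κ T) :
    ((ι ∈ R.inacts ∨ κ ∈ R.inacts) ∧ T.state = 0) ∨
      ∃ R' : Residual V, T = R'.toTerm 𝕊 ∧ Step R [ι, κ] R' := by
  induction R with
  | one => exact absurd h itrans_out
  | inact S => exact absurd h itrans_br
  | lin ι' ι₁ ι₀ κ' b η P ih =>
    obtain ⟨_, h1, rfl⟩ := itrans_new.1 h
    rcases itrans_par.1 h1 with ⟨_, _, _, _, h2, h3, rfl⟩ | ⟨_, h2, rfl⟩ | ⟨_, h2, rfl⟩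
    · obtain ⟨rfl, h4, rfl, rfl⟩ := vtrans_act.1 (vtrans_br.1 h3)
      rcases vtrans_par.1 h2 with ⟨_, h5, rfl⟩ | ⟨_, h5, rfl⟩
      · cases (vtrans_act.1 (vtrans_br.1 h5)).1
      · obtain ⟨_, _, rfl, rfl⟩ := vtrans_act.1 (vtrans_br.1 h5)
        exact Or.inl ⟨Or.inl (by simp [inacts]), by simp [state]⟩
    · rcases itrans_par.1 h2 with ⟨_, _, _, _, h3, h4, rfl⟩ | ⟨_, h3, rfl⟩ | ⟨_, h3, rfl⟩
      · obtain ⟨rfl, _⟩ := vtrans_act.1 (vtrans_br.1 h4)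
        cases (vtrans_act.1 (vtrans_br.1 h3)).1
      · exact absurd h3 itrans_br
      · exact absurd h3 itrans_br
    · exact absurd h2 itrans_br
  | run ι₁ ι₀ κ' P ih =>
    obtain ⟨_, h1, rfl⟩ := itrans_new.1 h
    rcases itrans_par.1 h1 with ⟨_, _, _, _, h2, h3, rfl⟩ | ⟨_, h2, rfl⟩ | ⟨_, h2, rfl⟩
    · obtain ⟨rfl, h4, rfl, rfl⟩ := vtrans_act.1 (vtrans_br.1 h3)
      rcases vtrans_par.1 h2 with ⟨_, h5, rfl⟩ | ⟨_, h5, rfl⟩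
      · rcases vtrans_par.1 h5 with ⟨_, h6, rfl⟩ | ⟨_, h6, rfl⟩
        · obtain ⟨c, P', hc, _⟩ := h6.of_rename
          cases hc
        · obtain ⟨_, _, rfl, rfl⟩ := vtrans_act.1 (vtrans_br.1 h6)
          -- The linear action is completed: its `w.0` stays as an ordinary inaction, under the
          -- restrictions of `w` and of the name that the synchronisation reveals.
          refine Or.inr ⟨new (new (par (par (par ((P.rename some).rename some) one)
            (inact (.single ι₀ (some none) Pola.pos))) one)), ?_, ?_, ?_, ?_⟩
          · simp [toTerm, toTerm_rename, Term.rename, Inactions.toTerm]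
          · simp [inacts, inacts_rename, Inactions.locs, or_comm]
          · simp +contextual [lins, lins_rename]
          · simp +contextual [lins, lins_rename]
      · obtain ⟨_, _, rfl, rfl⟩ := vtrans_act.1 (vtrans_br.1 h5)
        exact Or.inl ⟨Or.inl (by simp [inacts]), by simp [state]⟩
    · rcases itrans_par.1 h2 with ⟨_, _, _, _, h3, h4, rfl⟩ | ⟨_, h3, rfl⟩ | ⟨_, h3, rfl⟩
      · obtain ⟨rfl, h4, _⟩ := vtrans_act.1 (vtrans_br.1 h4)
        rcases vtrans_par.1 h3 with ⟨_, h6, rfl⟩ | ⟨_, h6, rfl⟩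
        · obtain ⟨c, P', hc, _⟩ := h6.of_rename
          cases hc
        · obtain ⟨_, rfl, _⟩ := vtrans_act.1 (vtrans_br.1 h6)
          cases h4
      · rcases itrans_par.1 h3 with ⟨_, _, _, _, h4, h5, rfl⟩ | ⟨_, h4, rfl⟩ | ⟨_, h4, rfl⟩
        · obtain ⟨c, P', rfl, _⟩ := h4.of_rename
          cases (vtrans_act.1 (vtrans_br.1 h5)).1
        · obtain ⟨P', h5, rfl⟩ := h4.of_rename (Option.some_injective _).injOn
          rcases ih h5 with ⟨h6, h7⟩ | ⟨R', rfl, h6⟩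
          · exact Or.inl ⟨h6.imp (List.mem_cons_of_mem _) (List.mem_cons_of_mem _),
              by simp [state, state_rename, h7]⟩
          · refine Or.inr ⟨run ι₁ ι₀ κ' R', rfl, ?_, ?_, ?_⟩
            · simp [inacts, h6.inacts]
            · simp only [lins, List.mem_cons]
              exact fun μ hμ => hμ.imp_right (h6.lins_subset μ)
            · simp only [lins, List.mem_cons]
              rintro μ (rfl | hμ)
              · exact Or.inl (Or.inl rfl)
              · exact (h6.lins μ hμ).imp Or.inr (by simp)
        · exact absurd h4 itrans_br
      · exact absurd h3 itrans_br
    · exact absurd h2 itrans_br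
  | par P Q ihP ihQ =>
    rcases itrans_par.1 h with ⟨_, _, _, _, h1, h2, rfl⟩ | ⟨_, h1, rfl⟩ | ⟨_, h1, rfl⟩
    · rcases vtrans h1 with ⟨h3, h4⟩ | ⟨R, rfl, h3, h4⟩
      · exact Or.inl ⟨Or.inl (List.mem_append_left _ h3), by simp [state, h4]⟩
      rcases vtrans h2 with ⟨h5, h6⟩ | ⟨R', rfl, h5, h6⟩
      · exact Or.inl ⟨Or.inr (List.mem_append_right _ h5), by simp [state, h6]⟩
      refine Or.inr ⟨new (par R R'), rfl, ?_, ?_, ?_⟩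
      · simp [inacts, h3, h5]
      · simp [lins, h4, h6]
      · simp +contextual [lins, h4, h6]
    · rcases ihP h1 with ⟨h2, h3⟩ | ⟨R', rfl, h2⟩
      · exact Or.inl ⟨h2.imp (List.mem_append_left _) (List.mem_append_left _),
          by simp [state, h3]⟩
      · refine Or.inr ⟨par R' Q, rfl, ?_, ?_, ?_⟩
        · simp [inacts, h2.inacts]
        · simp only [lins, List.mem_append]
          exact fun μ hμ => hμ.imp_left (h2.lins_subset μ)
        · simp only [lins, List.mem_append]
          rintro μ (hμ | hμ)
          · exact (h2.lins μ hμ).imp_left Or.inl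
          · exact Or.inl (Or.inr hμ)
    · rcases ihQ h1 with ⟨h2, h3⟩ | ⟨R', rfl, h2⟩
      · exact Or.inl ⟨h2.imp (List.mem_append_right _) (List.mem_append_right _),
          by simp [state, h3]⟩
      · refine Or.inr ⟨par P R', rfl, ?_, ?_, ?_⟩
        · simp [inacts, h2.inacts]
        · simp only [lins, List.mem_append]
          exact fun μ hμ => hμ.imp_right (h2.lins_subset μ)
        · simp only [lins, List.mem_append]
          rintro μ (hμ | hμ)
          · exact Or.inl (Or.inl hμ)
          · exact (h2.lins μ hμ).imp_left Or.inr
  | new P ih =>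
    obtain ⟨_, h1, rfl⟩ := itrans_new.1 h
    rcases ih h1 with ⟨h2, h3⟩ | ⟨R', rfl, h2⟩
    · exact Or.inl ⟨h2, h3⟩
    · exact Or.inr ⟨new R', rfl, h2.inacts, h2.lins_subset, h2.lins⟩

/-- A residual with a linear action that is not completed can progress: outside of prefixes there
is a pair of actions on the name `w` of a linear action. -/
theorem exists_itrans {V : Type u} {R : Residual V} (h : R.lins ≠ []) :
    ∃ ι κ T, ITrans (R.toTerm 𝕊) ι κ T := by
  induction R with
  | one => exact absurd rfl h
  | inact S => exact absurd rfl h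
  | lin ι ι₁ ι₀ κ a ε P ih =>
    exact ⟨ι₀, κ, _, .new (.sync (ε := Pola.pos) (.parRight (.br .act)) (.br .act))⟩
  | run ι₁ ι₀ κ P ih =>
    exact ⟨ι₀, κ, _, .new (.sync (ε := Pola.pos) (.parRight (.br .act)) (.br .act))⟩
  | par P Q ihP ihQ =>
    by_cases hP : P.lins = []
    · obtain ⟨ι, κ, T, h⟩ := ihQ (by simpa [lins, hP] using h)
      exact ⟨ι, κ, _, .parRight h⟩
    · obtain ⟨ι, κ, T, h⟩ := ihP hP
      exact ⟨ι, κ, _, .parLeft h⟩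
  | new P ih =>
    obtain ⟨ι, κ, T, h⟩ := ih h
    exact ⟨ι, κ, _, .new h⟩

/-- Without linear actions, the only visible transitions are those of the inactions. -/
theorem hasInaction_iff {V : Type u} {R : Residual V} (h : R.lins = []) (ε : Pola) (a : V) :
    (R.toTerm 𝕊).HasInaction ε a ↔ ∃ ι T, VTrans (R.toTerm 𝕊) a ε ι T := by
  induction R with
  | one => simp [toTerm, HasInaction, vtrans_out]
  | inact S => simp only [toTerm, HasInaction, vtrans_br, Inactions.hasInaction_iff]
  | lin ι ι₁ ι₀ κ a ε P ih => simp [lins] at h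
  | run ι₁ ι₀ κ P ih => simp [lins] at h
  | par P Q ihP ihQ =>
    simp only [lins, List.append_eq_nil_iff] at h
    simp only [toTerm, HasInaction, ihP h.1, ihQ h.2, vtrans_par]
    grind
  | new P ih =>
    simp only [toTerm, HasInaction, ih h, vtrans_new]
    grind

/-- Without linear actions, the internal transitions synchronise dual inactions. -/
theorem hasDualInactions_iff {V : Type u} {R : Residual V} (h : R.lins = []) :
    (R.toTerm 𝕊).HasDualInactions ↔ ∃ ι κ T, ITrans (R.toTerm 𝕊) ι κ T := by
  induction R with
  | one => simp [toTerm, HasDualInactions, itrans_out]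
  | inact S =>
    simp [toTerm, HasDualInactions, itrans_br, Inactions.not_hasDualInactions]
  | lin ι ι₁ ι₀ κ a ε P ih => simp [lins] at h
  | run ι₁ ι₀ κ P ih => simp [lins] at h
  | par P Q ihP ihQ =>
    simp only [lins, List.append_eq_nil_iff] at h
    simp only [toTerm, HasDualInactions, ihP h.1, ihQ h.2, hasInaction_iff h.1,
      hasInaction_iff h.2, itrans_par]
    constructor
    · rintro (⟨ι, κ, T, h⟩ | ⟨ι, κ, T, h⟩ | ⟨a, ε, ⟨ι, T, h1⟩, ⟨κ, T', h2⟩⟩)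
      · exact ⟨ι, κ, _, Or.inr (Or.inl ⟨_, h, rfl⟩)⟩
      · exact ⟨ι, κ, _, Or.inr (Or.inr ⟨_, h, rfl⟩)⟩
      · exact ⟨ι, κ, _, Or.inl ⟨_, _, _, _, h1, h2, rfl⟩⟩
    · rintro ⟨ι, κ, T, ⟨a, ε, _, _, h1, h2, rfl⟩ | ⟨_, h, rfl⟩ | ⟨_, h, rfl⟩⟩
      · exact Or.inr (Or.inr ⟨a, ε, ⟨_, _, h1⟩, ⟨_, _, h2⟩⟩)
      · exact Or.inl ⟨_, _, _, h⟩
      · exact Or.inr (Or.inl ⟨_, _, _, h⟩)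
  | new P ih =>
    simp only [toTerm, HasDualInactions, ih h, itrans_new]
    grind

end Residual

/-! ### The outcome of a simple term -/

/-- All labels of the pre-trace are internal. -/
def Pretrace.Internal {𝕊 : Type v} {N : Type u} {P : Proc 𝕊 N} (ρ : Pretrace P) : Prop :=
  ∀ a, ρ.HasLabel a → ∃ ι κ, a = Label.tau ι κ

/-- Maximality can be read off the chosen reduct, since commutation of restrictions preserves
internal transitions. -/
theorem Pretrace.maximal_iff {𝕊 : Type v} {N : Type u} {P : Proc 𝕊 N} (hP : Wf P)
    (ρ : Pretrace P) :
    (∃ p, ρ.Contains p ∧ IsMaximalPath P p) ↔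
      ρ.Internal ∧ ¬ ∃ ι κ T, ITrans ρ.reduct ι κ T := by
  constructor
  · rintro ⟨p, hp, hint, hmax⟩
    have hp' : ρ.Has p.1 := ⟨p.2, hp⟩
    obtain ⟨T, hT⟩ := p.2
    refine ⟨fun a ha => hint a ((hp'.hasLabel_iff a).1 ha), ?_⟩
    rintro ⟨ι, κ, T', h⟩
    obtain ⟨T'', h', _⟩ := (hp'.seq_reduct hP hT).itrans h
    exact hmax ι κ ⟨_, hT.append (.cons (.tau h') .nil)⟩
  · rintro ⟨hint, hmax⟩
    obtain ⟨p, hp, hT⟩ := ρ.reduct_transSeq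
    refine ⟨⟨p, hp.1⟩, hp.2, fun a ha => hint a ((hp.hasLabel_iff a).2 ha), ?_⟩
    rintro ι κ ⟨T', h⟩
    obtain ⟨T, h1, h2⟩ := h.of_append
    obtain ⟨_, rfl⟩ := h1.deterministic hT hP.nodup rfl
    cases h2 with
    | cons h2 _ =>
      cases h2 with
      | tau h2 => exact hmax ⟨_, _, _, h2⟩

section Outcome

variable {𝕊 : Type v} [CommSemiring 𝕊]

/-- The state is a product to which transitions only contribute further factors. -/
theorem VTrans.state_dvd {k : Kind} {V : Type u} {P : Term 𝕊 k V} {a : V} {ε : Pola} {ι : ℕ}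
    {P' : Term 𝕊 Kind.proc (Option V)} (h : VTrans P a ε ι P') : P.state ∣ P'.state := by
  induction h with
  | act => exact one_dvd _
  | sumLeft => exact one_dvd _
  | sumRight => exact one_dvd _
  | br => exact one_dvd _
  | parLeft _ ih => exact mul_dvd_mul ih (by rw [state_rename])
  | parRight _ ih => exact mul_dvd_mul (by rw [state_rename]) ih
  | new _ ih => simpa only [state, state_rename] using ih

theorem ITrans.state_dvd {V : Type u} {P P' : Term 𝕊 Kind.proc V} {ι κ : ℕ}
    (h : ITrans P ι κ P') : P.state ∣ P'.state := by
  induction h with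
  | sync h h' => exact mul_dvd_mul h.state_dvd h'.state_dvd
  | parLeft _ ih => exact mul_dvd_mul ih dvd_rfl
  | parRight _ ih => exact mul_dvd_mul dvd_rfl ih
  | new _ ih => exact ih

variable {N : Type u}

theorem TransSeq.state_eq_zero {P P' : Proc 𝕊 N} {p : List (Label N)} (h : TransSeq P p P')
    (hP : P.state = 0) : P'.state = 0 := by
  induction h with
  | nil => exact hP
  | cons h1 _ ih =>
    refine ih (zero_dvd_iff.1 ?_)
    rw [← hP]
    cases h1 with
    | vis h => rw [state_rename]; exact h.state_dvd
    | tau h => exact h.state_dvd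

/-- An interaction of a residual triggers an inaction, and then ends with state zero, or leads to a
residual. -/
theorem Residual.transSeq {R : Residual (Channel N)} {S T : Proc 𝕊 N} (hS : R.toTerm 𝕊 = S)
    {p : List (Label N)} (h : TransSeq S p T) :
    (T.state = 0 ∧ ∃ μ ∈ R.inacts, μ ∈ p.flatMap Label.locs) ∨
      ∃ R' : Residual (Channel N), T = R'.toTerm 𝕊 ∧ Step R (p.flatMap Label.locs) R' := by
  induction h generalizing R with
  | nil => exact Or.inr ⟨R, hS.symm, fun _ => Iff.rfl, fun _ h => h, fun _ h => Or.inl h⟩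
  | @cons _ S' _ a p h1 h2 ih =>
    subst hS
    have key : ((∃ μ ∈ a.locs, μ ∈ R.inacts) ∧ S'.state = 0) ∨
        ∃ R' : Residual (Channel N), R'.toTerm 𝕊 = S' ∧ Step R a.locs R' := by
      cases h1 with
      | @vis x ε ι P' h1 =>
        rcases Residual.vtrans h1 with ⟨h3, h4⟩ | ⟨R', rfl, h3, h4⟩
        · exact Or.inl ⟨⟨ι, by simp [Label.locs], h3⟩, by rw [state_rename, h4]⟩
        · refine Or.inr ⟨R'.rename _, toTerm_rename _ _, ?_, ?_, ?_⟩
          · simp [inacts_rename, h3]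
          · simp [lins_rename, h4]
          · exact fun μ hμ => Or.inl (by rwa [lins_rename, h4])
      | @tau _ ι κ h1 =>
        rcases Residual.itrans h1 with ⟨h3 | h3, h4⟩ | ⟨R', rfl, h3⟩
        · exact Or.inl ⟨⟨ι, by simp [Label.locs], h3⟩, h4⟩
        · exact Or.inl ⟨⟨κ, by simp [Label.locs], h3⟩, h4⟩
        · exact Or.inr ⟨R', rfl, h3⟩
    simp only [List.flatMap_cons]
    rcases key with ⟨⟨μ, h3, h4⟩, h5⟩ | ⟨R', h3, h4⟩
    · exact Or.inl ⟨h2.state_eq_zero h5, μ, h4, List.mem_append_left _ h3⟩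
    · rcases ih h3 with ⟨h5, μ, h6, h7⟩ | ⟨R'', h5, h6⟩
      · exact Or.inl ⟨h5, μ, (h4.inacts μ).1 h6, List.mem_append_right _ h7⟩
      · refine Or.inr ⟨R'', h5, fun μ => (h6.inacts μ).trans (h4.inacts μ),
          fun μ hμ => h4.lins_subset μ (h6.lins_subset μ hμ), fun μ hμ => ?_⟩
        rcases h4.lins μ hμ with h | h
        · exact (h6.lins μ h).imp_right (List.mem_append_right _)
        · exact Or.inr (List.mem_append_left _ h)

namespace Simple

theorem proc_eq (P : Simple N) :
    P.proc 𝕊 = ((Residual.ofSimple P).rename Channel.ofName).toTerm 𝕊 := by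
  rw [Residual.toTerm_rename, Residual.toTerm_ofSimple, proc]

theorem wf_proc {P : Simple N} (h : (P.proc 𝕊).locs.Nodup) : Wf (P.proc 𝕊) := by
  refine ⟨h, fun x hx b hb => ?_⟩
  obtain ⟨u, _, rfl⟩ := (mem_free_rename _).1 hx
  simp [Channel.ofName] at hb

theorem linearLocs_subset (P : Simple N) : P.linearLocs ⊆ (P.proc 𝕊).locs := by
  rw [proc_eq, ← Residual.lins_ofSimple, ← Residual.lins_rename _ Channel.ofName]
  exact Residual.lins_subset _

theorem inactionLocs_subset (P : Simple N) : P.inactionLocs ⊆ (P.proc 𝕊).locs := by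
  rw [proc_eq, ← Residual.inacts_ofSimple, ← Residual.inacts_rename _ Channel.ofName]
  exact Residual.inacts_subset _

/-- The reduct of a simple term, if no inaction has been triggered, is a residual whose linear
actions are those that have not been triggered. -/
theorem reduct_cases {P : Simple N} (hn : (P.proc 𝕊).locs.Nodup) (ρ : Pretrace (P.proc 𝕊)) :
    (ρ.reduct.state = 0 ∧ ∃ μ ∈ P.inactionLocs, ρ.Triggers μ) ∨
      ∃ R : Residual (Channel N), ρ.reduct = R.toTerm 𝕊 ∧
        (∀ μ ∈ P.inactionLocs, ¬ ρ.Triggers μ) ∧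
        (R.lins = [] ↔ ∀ μ ∈ P.linearLocs, ρ.Triggers μ) := by
  obtain ⟨p, hp, hT⟩ := ρ.reduct_transSeq
  have hlins : ((Residual.ofSimple P).rename Channel.ofName).lins = P.linearLocs := by
    rw [Residual.lins_rename, Residual.lins_ofSimple]
  have hin : ((Residual.ofSimple P).rename Channel.ofName).inacts = P.inactionLocs := by
    rw [Residual.inacts_rename, Residual.inacts_ofSimple]
  simp only [hp.triggers_iff]
  rcases Residual.transSeq (proc_eq P).symm hT with ⟨h1, h2⟩ | ⟨R, h1, h2⟩
  · rw [hin] at h2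
    exact Or.inl ⟨h1, h2⟩
  · have hnot : ∀ μ, μ ∈ (R.toTerm 𝕊).locs → μ ∉ p.flatMap Label.locs := by
      intro μ hμ hμ'
      obtain ⟨a, ha, hμa⟩ := List.mem_flatMap.1 hμ'
      exact hT.not_mem_locs hn ha hμa (h1 ▸ hμ)
    refine Or.inr ⟨R, h1, fun μ hμ => ?_, ?_⟩
    · exact hnot μ (Residual.inacts_subset R ((h2.inacts μ).2 (hin ▸ hμ)))
    · constructor
      · intro hR μ hμ
        have := h2.lins μ (hlins ▸ hμ)
        rw [hR] at this
        simpa using this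
      · intro h
        refine List.eq_nil_iff_forall_not_mem.2 fun μ hμ => ?_
        exact hnot μ (Residual.lins_subset R hμ) (h μ (hlins ▸ h2.lins_subset μ hμ))

/-- If no inaction has been triggered, then the exhaustive pre-traces are those after which no
internal transition is possible. -/
theorem exhaustive_iff_itrans {P : Simple N} {ρ : Pretrace (P.proc 𝕊)}
    {R : Residual (Channel N)} (h1 : ρ.reduct = R.toTerm 𝕊)
    (h2 : ∀ μ ∈ P.inactionLocs, ¬ ρ.Triggers μ)
    (h3 : R.lins = [] ↔ ∀ μ ∈ P.linearLocs, ρ.Triggers μ) :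
    P.Exhaustive ρ ↔ ¬ ∃ ι κ T, ITrans ρ.reduct ι κ T := by
  constructor
  · rintro ⟨h4, _, h5⟩ h6
    rw [h1] at h5 h6
    exact h5 ((Residual.hasDualInactions_iff (h3.2 h4)).2 h6)
  · intro h4
    have hl : R.lins = [] := by
      by_contra hl
      exact h4 (h1 ▸ Residual.exists_itrans hl)
    refine ⟨h3.1 hl, h2, ?_⟩
    rw [h1] at h4 ⊢
    rwa [Residual.hasDualInactions_iff hl]

open Classical in
/-- The outcome of a simple term counts its exhaustive internal pre-traces: the other runs have
triggered some inaction, which makes their final state zero. -/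
theorem outcome_eq_card {P : Simple N} (hn : (P.proc 𝕊).locs.Nodup) :
    outcome (P.proc 𝕊) =
      (Nat.card {ρ : Pretrace (P.proc 𝕊) // P.Exhaustive ρ ∧ ρ.Internal} : 𝕊) := by
  have hP := wf_proc hn
  have hst : ∀ ρ : Run (P.proc 𝕊),
      ρ.1.reduct.state = if P.Exhaustive ρ.1 then (1 : 𝕊) else 0 := by
    rintro ⟨ρ, hρ⟩
    obtain ⟨_, hmax⟩ := (Pretrace.maximal_iff hP ρ).1 hρ
    rcases reduct_cases hn ρ with ⟨h1, μ, h2, h3⟩ | ⟨R, h1, h2, h3⟩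
    · rw [if_neg, h1]
      exact fun h => h.2.1 μ h2 h3
    · rw [if_pos ((exhaustive_iff_itrans h1 h2 h3).2 hmax), h1, Residual.state_toTerm]
  have : Fintype (Run (P.proc 𝕊)) := Fintype.ofFinite _
  rw [outcome, finsum_eq_sum_of_fintype, Finset.sum_congr rfl (fun ρ _ => hst ρ),
    Finset.sum_boole, ← Fintype.card_subtype, ← Nat.card_eq_fintype_card]
  congr 1
  refine Nat.card_congr ⟨fun ρ => ⟨ρ.1.1, ρ.2, ((Pretrace.maximal_iff hP ρ.1.1).1 ρ.1.2).1⟩,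
    fun ρ => ⟨⟨ρ.1, (Pretrace.maximal_iff hP ρ.1).2 ⟨ρ.2.2, ?_⟩⟩, ρ.2.1⟩,
    fun _ => rfl, fun _ => rfl⟩
  rcases reduct_cases hn ρ.1 with ⟨_, μ, h2, h3⟩ | ⟨R, h1, h2, h3⟩
  · exact absurd h3 (ρ.2.1.2.1 μ h2)
  · exact (exhaustive_iff_itrans h1 h2 h3).1 ρ.2.1

end Simple

end Outcome

end PiI

namespace PiI

open Term

/-! ### Permutations of the arena as maps of channels -/

section TreeMaps

variable {N : Type u}

namespace Channel

theorem child_inj {x y : Channel N} {ε η : Pola} {m n : ℕ} :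
    x.child ε m = y.child η n ↔ x = y ∧ ε = η ∧ m = n := by
  obtain ⟨u, p⟩ := x
  obtain ⟨v, q⟩ := y
  simp only [child, Prod.mk.injEq]
  constructor
  · rintro ⟨rfl, h⟩
    obtain ⟨rfl, h'⟩ := List.append_inj' h rfl
    cases h'
    exact ⟨⟨rfl, rfl⟩, rfl, rfl⟩
  · rintro ⟨⟨rfl, rfl⟩, rfl, rfl⟩
    exact ⟨rfl, rfl⟩

/-- Induction on channels, seen as the nodes of a forest with the free names as its roots. -/
theorem induction {motive : Channel N → Prop} (ofName : ∀ u, motive (ofName u))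
    (child : ∀ x ε n, motive x → motive (x.child ε n)) (x : Channel N) : motive x := by
  obtain ⟨u, p⟩ := x
  induction p using List.reverseRecOn with
  | nil => exact ofName u
  | append_singleton p b ih => exact child (u, p) b.1 b.2 ih

end Channel

/-- The permutation `g` of the events acts as the map `c` on channels, which preserves roots,
children and polarities. -/
structure IsTreeMap (g : Event N → Event N) (c : Channel N → Channel N) : Prop where
  ofName : ∀ u, c (Channel.ofName u) = Channel.ofName u
  bot : ∀ x ε, g (x, ε, Slot.bot) = (c x, ε, Slot.bot)
  top : ∀ x ε, g (x, ε, Slot.top) = (c x, ε, Slot.top)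
  loc : ∀ x ε n, ∃ m, g (x, ε, Slot.loc n) = (c x, ε, Slot.loc m) ∧
    c (x.child ε n) = (c x).child ε m

/-- On the events `y⋅ε⊥` and `y⋅ε⊤`, a generator only changes the channel `y`, in the same way for
all of them. -/
theorem generator_apply_of_slot (x : Channel N) (ε : Pola) (σ : Equiv.Perm ℕ) (e : Event N)
    (h : ∀ f, e.2.2.map f = e.2.2) :
    generator x ε σ e =
      (((generator x ε σ (e.1, Pola.pos, Slot.bot)).1, e.2.1, e.2.2) : Event N) := by
  obtain ⟨⟨u, p⟩, η, s⟩ := e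
  simp only at h
  change renameEvent x ε σ _ = ((renameEvent x ε σ _).1, _)
  by_cases hu : u = x.1 <;> simp [renameEvent, hu, h]

theorem generator_isTreeMap (x : Channel N) (ε : Pola) (σ : Equiv.Perm ℕ) :
    IsTreeMap (generator x ε σ) (fun y => (generator x ε σ (y, Pola.pos, Slot.bot)).1) := by
  refine ⟨fun u => ?_, fun y η => generator_apply_of_slot _ _ _ _ (fun _ => rfl),
    fun y η => generator_apply_of_slot _ _ _ _ (fun _ => rfl), fun y η n => ?_⟩
  · change (renameEvent x ε σ _).1 = _
    by_cases hu : u = x.1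
    · cases hx : x.2 <;> simp [renameEvent, hu, Channel.ofName, renamePath]
    · simp [renameEvent, hu, Channel.ofName]
  · obtain ⟨u, p⟩ := y
    obtain ⟨v, q⟩ := x
    by_cases hu : u = v
    · subst hu
      by_cases hp : p = q ∧ η = ε
      · obtain ⟨rfl, rfl⟩ := hp
        refine ⟨σ n, ?_, ?_⟩
        · change renameEvent _ _ _ _ = ((renameEvent _ _ _ _).1, _)
          simp [renameEvent, Slot.map]
        · change (renameEvent _ _ _ _).1 = Channel.child (renameEvent _ _ _ _).1 _ _
          simp [renameEvent, Channel.child, (renamePath_eq_self_iff η σ p p).2 rfl,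
            renamePath_spec η σ p n []]
      · refine ⟨n, ?_, ?_⟩
        · change renameEvent _ _ _ _ = ((renameEvent _ _ _ _).1, _)
          simp [renameEvent, hp]
        · change (renameEvent _ _ _ _).1 = Channel.child (renameEvent _ _ _ _).1 _ _
          simp only [renameEvent, Channel.child, if_true, Prod.mk.injEq, true_and]
          by_cases h : ∃ m z, p = q ++ (ε, m) :: z
          · obtain ⟨m, z, rfl⟩ := h
            rw [renamePath_spec, List.append_assoc, List.cons_append, renamePath_spec]
            simp
          · push Not at h
            rw [renamePath_of_not ε σ q p h, renamePath_of_not]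
            intro m z hz
            rcases List.eq_nil_or_concat z with rfl | ⟨z, b, rfl⟩
            · obtain ⟨rfl, hb⟩ := List.append_inj' hz rfl
              simp only [List.cons.injEq, Prod.mk.injEq, and_true] at hb
              exact hp ⟨rfl, hb.1⟩
            · have : p ++ [(η, n)] = (q ++ (ε, m) :: z) ++ [b] := by simpa using hz
              exact h m z (List.append_inj' this rfl).1
    · exact ⟨n, by change renameEvent _ _ _ _ = ((renameEvent _ _ _ _).1, _)
                   simp [renameEvent, hu],
        by change (renameEvent _ _ _ _).1 = Channel.child (renameEvent _ _ _ _).1 _ _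
           simp [renameEvent, hu, Channel.child]⟩

theorem IsTreeMap.comp {g h : Event N → Event N} {c d : Channel N → Channel N}
    (hg : IsTreeMap g c) (hh : IsTreeMap h d) : IsTreeMap (g ∘ h) (c ∘ d) := by
  refine ⟨fun u => ?_, fun x ε => ?_, fun x ε => ?_, fun x ε n => ?_⟩
  · simp [hh.ofName, hg.ofName]
  · simp [hh.bot, hg.bot]
  · simp [hh.top, hg.top]
  · obtain ⟨m, h1, h2⟩ := hh.loc x ε n
    obtain ⟨k, h3, h4⟩ := hg.loc (d x) ε m
    exact ⟨k, by simp [h1, h3], by simp [h2, h4]⟩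

variable [Finite N]

/-- All permutations of the group act as maps of the forest of channels. -/
theorem exists_isTreeMap {g : Equiv.Perm (Event N)} (hg : g ∈ (arena N).group) :
    ∃ c, IsTreeMap g c := by
  have hg' : g ∈ Subgroup.closure
    {π : Equiv.Perm (Event N) | ∃ (x : Channel N) (ε : Pola) (σ : Equiv.Perm ℕ),
      π = generator x ε σ} := hg
  clear hg
  induction hg' using Subgroup.closure_induction'' with
  | mem _ h =>
    obtain ⟨x, ε, σ, rfl⟩ := h
    exact ⟨_, generator_isTreeMap x ε σ⟩
  | inv_mem _ h =>
    obtain ⟨x, ε, σ, rfl⟩ := h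
    exact ⟨_, generator_isTreeMap x ε σ⁻¹⟩
  | one => exact ⟨id, fun _ => rfl, fun _ _ => rfl, fun _ _ => rfl, fun _ _ n => ⟨n, rfl, rfl⟩⟩
  | mul g h hg hh ihg ihh =>
    obtain ⟨c, hc⟩ := ihg
    obtain ⟨d, hd⟩ := ihh
    exact ⟨_, hc.comp hd⟩

/-- The map `e ↦ g ē` on events, which turns events of a term into the dual events of the other
one. -/
def dualEvent (g : Equiv.Perm (Event N)) (e : Event N) : Event N := g (invert N e)

/-- The map on channels that underlies `dualEvent`. -/
def dualChannel (g : Equiv.Perm (Event N)) (x : Channel N) : Channel N :=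
  (dualEvent g (x, Pola.pos, Slot.bot)).1

end TreeMaps

section Duality

variable {N : Type u}

/-- The map `θ` on events inverts polarities, exchanges `⊥` and `⊤` and acts on channels as `β`,
which preserves roots and children. -/
structure IsDuality (θ : Event N → Event N) (β : Channel N → Channel N) : Prop where
  injective : Function.Injective θ
  ofName : ∀ u, β (Channel.ofName u) = Channel.ofName u
  bot : ∀ x ε, θ (x, ε, Slot.bot) = (β x, ε.op, Slot.top)
  top : ∀ x ε, θ (x, ε, Slot.top) = (β x, ε.op, Slot.bot)
  loc : ∀ x ε n, ∃ m, θ (x, ε, Slot.loc n) = (β x, ε.op, Slot.loc m) ∧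
    β (x.child ε n) = (β x).child ε.op m

namespace IsDuality

variable {θ : Event N → Event N} {β : Channel N → Channel N}

theorem injective_channel (h : IsDuality θ β) : Function.Injective β := by
  intro x y hxy
  have := h.bot x Pola.pos
  rw [hxy, ← h.bot y] at this
  exact congrArg Prod.fst (h.injective this)

theorem of_loc (h : IsDuality θ β) {x y : Channel N} {ε η : Pola} {ι κ : ℕ}
    (he : θ (y, η, Slot.loc κ) = (x, ε, Slot.loc ι)) :
    x = β y ∧ ε = η.op ∧ β (y.child η κ) = x.child ε ι := by
  obtain ⟨m, h1, h2⟩ := h.loc y η κ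
  rw [h1] at he
  cases he
  exact ⟨rfl, rfl, h2⟩

theorem of_child (h : IsDuality θ β) {x y : Channel N} {ε η : Pola} {ι κ : ℕ}
    (he : β (y.child η κ) = x.child ε ι) : θ (y, η, Slot.loc κ) = (x, ε, Slot.loc ι) := by
  obtain ⟨m, h1, h2⟩ := h.loc y η κ
  rw [h2, Channel.child_inj] at he
  obtain ⟨rfl, rfl, rfl⟩ := he
  exact h1

/-- The initial segments of the image of a channel are images of its initial segments. -/
theorem exists_prefix (h : IsDuality θ β) (z v : Channel N) (s : List (Pola × ℕ))
    (hz : β z = (v.1, v.2 ++ s)) : ∃ (z' : Channel N) (r : List (Pola × ℕ)),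
      z = (z'.1, z'.2 ++ r) ∧ β z' = v := by
  induction z using Channel.induction generalizing s with
  | ofName u =>
    rw [h.ofName] at hz
    have h2 := congrArg Prod.snd hz
    simp only [Channel.ofName, List.nil_eq, List.append_eq_nil_iff] at h2
    refine ⟨Channel.ofName u, [], by simp [Channel.ofName], ?_⟩
    rw [h.ofName, hz, h2.2, List.append_nil]
  | child x ε n ih =>
    rcases List.eq_nil_or_concat s with rfl | ⟨s, b, rfl⟩
    · exact ⟨x.child ε n, [], by simp, by simpa using hz⟩
    · obtain ⟨m, _, h2⟩ := h.loc x ε n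
      rw [h2] at hz
      have hz' : (β x).child ε.op m = Channel.child (v.1, v.2 ++ s) b.1 b.2 := by
        rw [hz]
        simp [Channel.child]
      obtain ⟨z', r, rfl, h3⟩ := ih s (Channel.child_inj.1 hz').1
      exact ⟨z', r ++ [(ε, n)], by simp [Channel.child], h3⟩

end IsDuality

variable [Finite N]

theorem isDuality_of_mem {g : Equiv.Perm (Event N)} (hg : g ∈ (arena N).group) :
    IsDuality (dualEvent g) (dualChannel g) := by
  obtain ⟨c, hc⟩ := exists_isTreeMap hg
  have hd : ∀ x : Channel N, dualChannel g x = c (x.1, x.2.map (fun b => (b.1.op, b.2))) :=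
    fun x => congrArg Prod.fst
      (hc.top (x.1, x.2.map (fun b : Pola × ℕ => (b.1.op, b.2))) Pola.neg)
  refine ⟨g.injective.comp (invert N).injective, fun u => ?_, fun x ε => ?_, fun x ε => ?_,
    fun x ε n => ?_⟩
  · rw [hd]
    exact hc.ofName u
  · rw [hd]
    exact hc.top _ _
  · rw [hd]
    exact hc.bot _ _
  · obtain ⟨m, h1, h2⟩ := hc.loc (x.1, x.2.map (fun b => (b.1.op, b.2))) ε.op n
    refine ⟨m, ?_, ?_⟩
    · rw [hd]
      exact h1
    · rw [hd, hd, ← h2]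
      simp [Channel.child]

theorem generator_mem (x : Channel N) (ε : Pola) (σ : Equiv.Perm ℕ) :
    (generator x ε σ : Equiv.Perm (Event N)) ∈ (arena N).group :=
  Subgroup.subset_closure ⟨x, ε, σ, rfl⟩

/-- Exchanging the occurrence numbers `m` and `n` below `x` does not affect the channels whose image
goes through neither. -/
theorem dualChannel_generator_mul (x : Channel N) (ε : Pola) (m n : ℕ)
    {g : Equiv.Perm (Event N)} (hg : g ∈ (arena N).group) (z : Channel N)
    (hm : ∀ s, dualChannel g z ≠ (x.1, x.2 ++ (ε, m) :: s))
    (hn : ∀ s, dualChannel g z ≠ (x.1, x.2 ++ (ε, n) :: s)) :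
    dualChannel (generator x ε (Equiv.swap m n) * g) z = dualChannel g z := by
  have h1 : dualEvent g (z, Pola.pos, Slot.bot) = (dualChannel g z, Pola.neg, Slot.top) :=
    (isDuality_of_mem hg).bot z Pola.pos
  change (renameEvent x ε _ (dualEvent g (z, Pola.pos, Slot.bot))).1 = _
  rw [h1]
  generalize dualChannel g z = y at *
  obtain ⟨u, p⟩ := y
  by_cases hu : u = x.1
  · subst hu
    simp only [renameEvent, if_true, Prod.mk.injEq, true_and]
    by_cases h : ∃ k z, p = x.2 ++ (ε, k) :: z
    · obtain ⟨k, s, rfl⟩ := h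
      rw [renamePath_spec, Equiv.swap_apply_of_ne_of_ne]
      · rintro rfl
        exact hm s rfl
      · rintro rfl
        exact hn s rfl
    · push Not at h
      rw [renamePath_of_not _ _ _ _ h]
  · simp [renameEvent, hu]

theorem dualChannel_generator_mul_child {x y : Channel N} {ε η : Pola} {κ m n : ℕ}
    {g : Equiv.Perm (Event N)} (hg : g ∈ (arena N).group)
    (h : dualChannel g (y.child η κ) = x.child ε m) :
    dualChannel (generator x ε (Equiv.swap m n) * g) (y.child η κ) = x.child ε n := by
  have h1 : dualEvent g (y.child η κ, Pola.pos, Slot.bot) =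
      (dualChannel g (y.child η κ), Pola.neg, Slot.top) :=
    (isDuality_of_mem hg).bot _ Pola.pos
  change (renameEvent x ε _ (dualEvent g (y.child η κ, Pola.pos, Slot.bot))).1 = _
  rw [h1, h]
  simp [renameEvent, Channel.child, renamePath_spec]

end Duality

end PiI

namespace PiI

open Term

/-! ### Synchronisation of two interactions -/

section Merge

variable {N : Type u}

/-- The sequence `l` of internal transitions of a parallel composition consists of the interactions
`p` and `q` of its two sides, where the visible labels are synchronised in pairs that the map `θ`
relates. -/
inductive Merge (θ : Event N → Event N) :
    List (Label N) → List (Label N) → List (ℕ × ℕ) → Prop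
  | nil : Merge θ [] [] []
  | left {p q : List (Label N)} {l : List (ℕ × ℕ)} (ι κ : ℕ) :
      Merge θ p q l → Merge θ (Label.tau ι κ :: p) q ((ι, κ) :: l)
  | right {p q : List (Label N)} {l : List (ℕ × ℕ)} (ι κ : ℕ) :
      Merge θ p q l → Merge θ p (Label.tau ι κ :: q) ((ι, κ) :: l)
  | sync {p q : List (Label N)} {l : List (ℕ × ℕ)} {x y : Channel N} {ε η : Pola} {ι κ : ℕ} :
      θ (y, η, Slot.loc κ) = (x, ε, Slot.loc ι) → Merge θ p q l →
      Merge θ (Label.vis x ε ι :: p) (Label.vis y η κ :: q) ((ι, κ) :: l)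

namespace Merge

variable {θ : Event N → Event N} {p q : List (Label N)} {l : List (ℕ × ℕ)}

theorem events_eq (h : Merge θ p q l) : events p = (events q).map θ := by
  induction h with
  | nil => rfl
  | left ι κ _ ih => exact ih
  | right ι κ _ ih => exact ih
  | sync h _ ih =>
    simp only [events] at ih
    simp [events, Label.event, h, ih]

/-- Interactions with the same visible actions, in the same order, merge: internal transitions can
be scheduled freely in between. -/
theorem exists_of_events_eq (h : events p = (events q).map θ) : ∃ l, Merge θ p q l := by
  induction p generalizing q with
  | nil =>
    induction q with
    | nil => exact ⟨_, .nil⟩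
    | cons b q ih =>
      cases b with
      | vis y η κ => simp [events, Label.event] at h
      | tau ι κ =>
        obtain ⟨l, hl⟩ := ih h
        exact ⟨_, .right ι κ hl⟩
  | cons a p ih =>
    cases a with
    | tau ι κ =>
      obtain ⟨l, hl⟩ := ih (q := q) h
      exact ⟨_, .left ι κ hl⟩
    | vis x ε ι =>
      induction q with
      | nil => simp [events, Label.event] at h
      | cons b q ihq =>
        cases b with
        | vis y η κ =>
          have h' : (x, ε, Slot.loc ι) :: events p =
            θ (y, η, Slot.loc κ) :: (events q).map θ := h
          obtain ⟨h1, h2⟩ := List.cons.inj h'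
          obtain ⟨l, hl⟩ := ih h2
          exact ⟨_, .sync h1.symm hl⟩
        | tau ι κ =>
          obtain ⟨l, hl⟩ := ihq h
          exact ⟨_, .right ι κ hl⟩

theorem mem_of_left (h : Merge θ p q l) {ι κ : ℕ} (ha : Label.tau ι κ ∈ p) : (ι, κ) ∈ l := by
  induction h with
  | nil => simp at ha
  | left _ _ _ ih =>
    rcases List.mem_cons.1 ha with h | h
    · cases h; simp
    · exact List.mem_cons_of_mem _ (ih h)
  | right _ _ _ ih => exact List.mem_cons_of_mem _ (ih ha)
  | sync _ _ ih =>
    rcases List.mem_cons.1 ha with h | h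
    · cases h
    · exact List.mem_cons_of_mem _ (ih h)

theorem mem_of_right (h : Merge θ p q l) {ι κ : ℕ} (ha : Label.tau ι κ ∈ q) : (ι, κ) ∈ l := by
  induction h with
  | nil => simp at ha
  | left _ _ _ ih => exact List.mem_cons_of_mem _ (ih ha)
  | right _ _ _ ih =>
    rcases List.mem_cons.1 ha with h | h
    · cases h; simp
    · exact List.mem_cons_of_mem _ (ih h)
  | sync _ _ ih =>
    rcases List.mem_cons.1 ha with h | h
    · cases h
    · exact List.mem_cons_of_mem _ (ih h)

theorem exists_of_vis_left (h : Merge θ p q l) {x : Channel N} {ε : Pola} {ι : ℕ}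
    (ha : Label.vis x ε ι ∈ p) : ∃ y η κ, Label.vis y η κ ∈ q ∧
      θ (y, η, Slot.loc κ) = (x, ε, Slot.loc ι) ∧ (ι, κ) ∈ l := by
  induction h with
  | nil => simp at ha
  | left _ _ _ ih =>
    obtain ⟨y, η, κ, h1, h2, h3⟩ := ih ((List.mem_cons.1 ha).resolve_left (fun h => by cases h))
    exact ⟨y, η, κ, h1, h2, List.mem_cons_of_mem _ h3⟩
  | right _ _ _ ih =>
    obtain ⟨y, η, κ, h1, h2, h3⟩ := ih ha
    exact ⟨y, η, κ, List.mem_cons_of_mem _ h1, h2, List.mem_cons_of_mem _ h3⟩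
  | sync h _ ih =>
    rcases List.mem_cons.1 ha with h' | h'
    · cases h'
      exact ⟨_, _, _, List.mem_cons_self, h, List.mem_cons_self⟩
    · obtain ⟨y, η, κ, h1, h2, h3⟩ := ih h'
      exact ⟨y, η, κ, List.mem_cons_of_mem _ h1, h2, List.mem_cons_of_mem _ h3⟩

theorem exists_of_vis_right (h : Merge θ p q l) {y : Channel N} {η : Pola} {κ : ℕ}
    (ha : Label.vis y η κ ∈ q) : ∃ x ε ι, Label.vis x ε ι ∈ p ∧
      θ (y, η, Slot.loc κ) = (x, ε, Slot.loc ι) ∧ (ι, κ) ∈ l := by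
  induction h with
  | nil => simp at ha
  | left _ _ _ ih =>
    obtain ⟨x, ε, ι, h1, h2, h3⟩ := ih ha
    exact ⟨x, ε, ι, List.mem_cons_of_mem _ h1, h2, List.mem_cons_of_mem _ h3⟩
  | right _ _ _ ih =>
    obtain ⟨x, ε, ι, h1, h2, h3⟩ := ih ((List.mem_cons.1 ha).resolve_left (fun h => by cases h))
    exact ⟨x, ε, ι, h1, h2, List.mem_cons_of_mem _ h3⟩
  | sync h _ ih =>
    rcases List.mem_cons.1 ha with h' | h'
    · cases h'
      exact ⟨_, _, _, List.mem_cons_self, h, List.mem_cons_self⟩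
    · obtain ⟨x, ε, ι, h1, h2, h3⟩ := ih h'
      exact ⟨x, ε, ι, List.mem_cons_of_mem _ h1, h2, List.mem_cons_of_mem _ h3⟩

theorem cases_of_mem (h : Merge θ p q l) {ι κ : ℕ} (hl : (ι, κ) ∈ l) :
    Label.tau ι κ ∈ p ∨ Label.tau ι κ ∈ q ∨ ∃ x ε y η, Label.vis x ε ι ∈ p ∧
      Label.vis y η κ ∈ q ∧ θ (y, η, Slot.loc κ) = (x, ε, Slot.loc ι) := by
  induction h with
  | nil => simp at hl
  | left _ _ _ ih =>
    rcases List.mem_cons.1 hl with h | h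
    · cases h; simp
    · rcases ih h with h | h | ⟨x, ε, y, η, h1, h2, h3⟩
      · exact Or.inl (List.mem_cons_of_mem _ h)
      · exact Or.inr (Or.inl h)
      · exact Or.inr (Or.inr ⟨x, ε, y, η, List.mem_cons_of_mem _ h1, h2, h3⟩)
  | right _ _ _ ih =>
    rcases List.mem_cons.1 hl with h | h
    · cases h; simp
    · rcases ih h with h | h | ⟨x, ε, y, η, h1, h2, h3⟩
      · exact Or.inl h
      · exact Or.inr (Or.inl (List.mem_cons_of_mem _ h))
      · exact Or.inr (Or.inr ⟨x, ε, y, η, h1, List.mem_cons_of_mem _ h2, h3⟩)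
  | sync h _ ih =>
    rcases List.mem_cons.1 hl with h' | h'
    · cases h'
      exact Or.inr (Or.inr ⟨_, _, _, _, List.mem_cons_self, List.mem_cons_self, h⟩)
    · rcases ih h' with h | h | ⟨x, ε, y, η, h1, h2, h3⟩
      · exact Or.inl (List.mem_cons_of_mem _ h)
      · exact Or.inr (Or.inl (List.mem_cons_of_mem _ h))
      · exact Or.inr (Or.inr ⟨x, ε, y, η, List.mem_cons_of_mem _ h1,
          List.mem_cons_of_mem _ h2, h3⟩)

/-- The set of synchronisations in a merge depends only on the labels of the two sides. -/
theorem mem_iff (h : Merge θ p q l) (hθ : Function.Injective θ) (ι κ : ℕ) : (ι, κ) ∈ l ↔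
    Label.tau ι κ ∈ p ∨ Label.tau ι κ ∈ q ∨ ∃ x ε y η, Label.vis x ε ι ∈ p ∧
      Label.vis y η κ ∈ q ∧ θ (y, η, Slot.loc κ) = (x, ε, Slot.loc ι) := by
  refine ⟨h.cases_of_mem, ?_⟩
  rintro (h1 | h1 | ⟨x, ε, y, η, h1, h2, h3⟩)
  · exact h.mem_of_left h1
  · exact h.mem_of_right h1
  · obtain ⟨y', η', κ', _, h4, h5⟩ := h.exists_of_vis_left h1
    have := hθ (h3.trans h4.symm)
    cases this
    exact h5

theorem mem_locs_iff (h : Merge θ p q l) (μ : ℕ) :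
    μ ∈ (l.map fun t => (Label.tau t.1 t.2 : Label N)).flatMap Label.locs ↔
      μ ∈ p.flatMap Label.locs ∨ μ ∈ q.flatMap Label.locs := by
  induction h with
  | nil => simp
  | left ι κ _ ih =>
    simp only [List.map_cons, List.flatMap_cons, List.mem_append, ih, or_assoc]
  | right ι κ _ ih =>
    simp only [List.map_cons, List.flatMap_cons, List.mem_append, ih]
    tauto
  | sync _ _ ih =>
    simp only [List.map_cons, List.flatMap_cons, List.mem_append, ih, Label.locs, List.mem_cons,
      List.not_mem_nil, or_false]
    tauto

/-- The locations of the left-hand interaction are read off the merge. -/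
theorem map_locs_left (h : Merge θ p q l) (L : ℕ → Prop) [DecidablePred L]
    (hp : ∀ a ∈ p, ∀ ι ∈ a.locs, L ι) (hq : ∀ a ∈ q, ∀ ι ∈ a.locs, ¬ L ι) :
    p.map Label.locs = l.filterMap
      (fun t => if L t.1 then some (if L t.2 then [t.1, t.2] else [t.1]) else none) := by
  induction h with
  | nil => rfl
  | left ι κ _ ih =>
    have h1 := hp _ List.mem_cons_self
    simp only [Label.locs, List.mem_cons, List.not_mem_nil, or_false, forall_eq_or_imp,
      forall_eq] at h1
    simp [h1, Label.locs, ih (fun a ha => hp a (List.mem_cons_of_mem _ ha)) hq]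
  | right ι κ _ ih =>
    have h1 := hq _ List.mem_cons_self
    simp only [Label.locs, List.mem_cons, List.not_mem_nil, or_false, forall_eq_or_imp,
      forall_eq] at h1
    simp [h1, ih hp (fun a ha => hq a (List.mem_cons_of_mem _ ha))]
  | sync _ _ ih =>
    have h1 := hp _ List.mem_cons_self
    have h2 := hq _ List.mem_cons_self
    simp only [Label.locs, List.mem_cons, List.not_mem_nil, or_false, forall_eq] at h1 h2
    simp [h1, h2, Label.locs, ih (fun a ha => hp a (List.mem_cons_of_mem _ ha))
      (fun a ha => hq a (List.mem_cons_of_mem _ ha))]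

theorem map_locs_right (h : Merge θ p q l) (L : ℕ → Prop) [DecidablePred L]
    (hp : ∀ a ∈ p, ∀ ι ∈ a.locs, ¬ L ι) (hq : ∀ a ∈ q, ∀ ι ∈ a.locs, L ι) :
    q.map Label.locs = l.filterMap
      (fun t => if L t.2 then some (if L t.1 then [t.1, t.2] else [t.2]) else none) := by
  induction h with
  | nil => rfl
  | left ι κ _ ih =>
    have h1 := hp _ List.mem_cons_self
    simp only [Label.locs, List.mem_cons, List.not_mem_nil, or_false, forall_eq_or_imp,
      forall_eq] at h1
    simp [h1, ih (fun a ha => hp a (List.mem_cons_of_mem _ ha)) hq]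
  | right ι κ _ ih =>
    have h1 := hq _ List.mem_cons_self
    simp only [Label.locs, List.mem_cons, List.not_mem_nil, or_false, forall_eq_or_imp,
      forall_eq] at h1
    simp [h1, Label.locs, ih hp (fun a ha => hq a (List.mem_cons_of_mem _ ha))]
  | sync _ _ ih =>
    have h1 := hp _ List.mem_cons_self
    have h2 := hq _ List.mem_cons_self
    simp only [Label.locs, List.mem_cons, List.not_mem_nil, or_false, forall_eq] at h1 h2
    simp [h1, h2, Label.locs, ih (fun a ha => hp a (List.mem_cons_of_mem _ ha))
      (fun a ha => hq a (List.mem_cons_of_mem _ ha))]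

end Merge

end Merge

/-! ### Interactions of a parallel composition -/

section Simulation

variable {𝕊 : Type v}

/-- Sequences of internal transitions, given by the pairs of locations that synchronise. -/
inductive ISeq : {V : Type u} → Term 𝕊 Kind.proc V → List (ℕ × ℕ) → Term 𝕊 Kind.proc V → Prop
  | nil {V : Type u} {P : Term 𝕊 Kind.proc V} : ISeq P [] P
  | cons {V : Type u} {P Q R : Term 𝕊 Kind.proc V} {t : ℕ × ℕ} {l : List (ℕ × ℕ)} :
      ITrans P t.1 t.2 Q → ISeq Q l R → ISeq P (t :: l) R

theorem ISeq.new {V : Type u} {P T : Term 𝕊 Kind.proc (Option V)} {l : List (ℕ × ℕ)}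
    (h : ISeq P l T) : ISeq (Term.new P) l (Term.new T) := by
  induction l generalizing P with
  | nil => cases h; exact .nil
  | cons t l ih =>
    cases h with
    | cons h1 h2 => exact .cons (.new h1) (ih h2)

theorem ISeq.of_new {V : Type u} {P : Term 𝕊 Kind.proc (Option V)} {T : Term 𝕊 Kind.proc V}
    {l : List (ℕ × ℕ)} (h : ISeq (Term.new P) l T) : ∃ T', ISeq P l T' ∧ T = Term.new T' := by
  induction l generalizing P with
  | nil => cases h; exact ⟨_, .nil, rfl⟩
  | cons t l ih =>
    cases h with
    | cons h1 h2 =>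
      obtain ⟨P', h3, rfl⟩ := itrans_new.1 h1
      obtain ⟨T', h4, rfl⟩ := ih h2
      exact ⟨T', .cons h3 h4, rfl⟩

variable {N : Type u}

theorem transSeq_tau_iff {P T : Proc 𝕊 N} {l : List (ℕ × ℕ)} :
    TransSeq P (l.map fun t => Label.tau t.1 t.2) T ↔ ISeq P l T := by
  induction l generalizing P with
  | nil =>
    constructor
    · intro h; cases h; exact .nil
    · intro h; cases h; exact .nil
  | cons t l ih =>
    constructor
    · intro h
      cases h with
      | cons h1 h2 =>
        cases h1 with
        | tau h1 => exact .cons h1 (ih.1 h2)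
    · intro h
      cases h with
      | cons h1 h2 => exact .cons (.tau h1) (ih.2 h2)

open Classical in
/-- The names of a parallel composition after a synchronisation of visible actions that reveal the
channel `z`, which becomes the name of the new restriction. -/
noncomputable def bindChannel {W : Type u} (z : Channel N) (f : Channel N → W) (x : Channel N) :
    Option W :=
  if x = z then none else some (f x)

theorem bindChannel_injective {W : Type u} (z : Channel N) {f : Channel N → W}
    (hf : Function.Injective f) : Function.Injective (bindChannel z f) := by
  intro x y hxy
  unfold bindChannel at hxy
  split_ifs at hxy with h1 h2 h2
  · rw [h1, h2]
  · exact hf (Option.some_injective _ hxy)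

/-- The term reached by a synchronisation of visible actions of the two sides is again a parallel
composition of terms over channels, up to renaming. -/
theorem sync_eq {W : Type u} {P Q : Proc 𝕊 N} (hP : Wf P) (hQ : Wf Q) {x y : Channel N}
    {ε η : Pola} {ι κ : ℕ} {P1 Q1 : Term 𝕊 Kind.proc (Option (Channel N))}
    (h1 : VTrans P x ε ι P1) (h2 : VTrans Q y η κ Q1) (f : Channel N → W)
    {β β' : Channel N → Channel N} (hβ : Function.Injective β')
    (hββ' : ∀ z ∈ Q.free, β' z = β z) (hc : β' (y.child η κ) = x.child ε ι) :
    Term.par (P1.rename (Option.map f)) (Q1.rename (Option.map (f ∘ β))) =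
      (Term.par (P1.rename (fun o => o.getD (x.child ε ι)))
        ((Q1.rename (fun o => o.getD (y.child η κ))).rename β')).rename
          (bindChannel (x.child ε ι) f) := by
  have hx := hP.child_notMem x ε h1.mem_locs
  have hy := hQ.child_notMem y η h2.mem_locs
  simp only [Term.rename, rename_rename]
  congr 1
  · refine rename_congr _ ?_
    rintro (_ | z) hz
    · simp [bindChannel]
    · have : z ≠ x.child ε ι := fun h => hx (h ▸ h1.free_subset hz)
      simp [bindChannel, this]
  · refine rename_congr _ ?_
    rintro (_ | z) hz
    · simp [bindChannel, hc]
    · have h3 := h2.free_subset hz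
      have : β' z ≠ x.child ε ι := by
        rw [← hc]
        exact fun h => hy (hβ h ▸ h3)
      rw [hββ' z h3] at this
      simp [bindChannel, hββ' z h3, this]

/-- A merge of interactions of two terms is an interaction of their parallel composition. -/
theorem Merge.iseq [Zero 𝕊] {θ : Event N → Event N} {β : Channel N → Channel N}
    (hθ : IsDuality θ β) {p q : List (Label N)} {l : List (ℕ × ℕ)} (h : Merge θ p q l)
    {P Q P' Q' : Proc 𝕊 N} (hp : TransSeq P p P') (hq : TransSeq Q q Q') (hP : Wf P) (hQ : Wf Q)
    {W : Type u} {f : Channel N → W} (hf : Function.Injective f) :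
    ∃ T, ISeq ((Term.par P (Q.rename β)).rename f) l T ∧
      (T.HasDualInactions ↔ (Term.par P' (Q'.rename β)).HasDualInactions) := by
  induction h generalizing P Q W with
  | nil =>
    cases hp
    cases hq
    exact ⟨_, .nil, hasDualInactions_rename _ _ hf⟩
  | left ι κ _ ih =>
    cases hp with
    | cons h1 h2 =>
      obtain ⟨T, h3, h4⟩ := ih h2 hq (h1.wf hP) hQ hf
      cases h1 with
      | tau h1 => exact ⟨T, .cons (.parLeft (h1.rename f)) h3, h4⟩
  | right ι κ _ ih =>
    cases hq with
    | cons h1 h2 =>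
      obtain ⟨T, h3, h4⟩ := ih hp h2 hP (h1.wf hQ) hf
      cases h1 with
      | tau h1 => exact ⟨T, .cons (.parRight ((h1.rename β).rename f)) h3, h4⟩
  | @sync p q l x y ε η ι κ he _ ih =>
    obtain ⟨rfl, rfl, hc⟩ := hθ.of_loc he
    cases hp with
    | cons h1 h2 =>
      cases hq with
      | cons h3 h4 =>
        obtain ⟨T, h5, h6⟩ := ih h2 h4 (h1.wf hP) (h3.wf hQ)
          (bindChannel_injective ((β y).child η.op ι) hf)
        cases h1 with
        | vis h1 =>
          cases h3 with
          | vis h3 =>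
            rw [← sync_eq hP hQ h1 h3 f hθ.injective_channel (fun _ _ => rfl) hc] at h5
            refine ⟨Term.new T, .cons (.sync (h1.rename f) ?_) h5.new, h6⟩
            have := h3.rename (f ∘ β)
            rw [← rename_rename] at this
            simpa using this

variable [Finite N]

/-- Conversely, any sequence of internal transitions of a parallel composition is a merge. A
permutation `g` of the arena that matches the names on both sides is found along the way: at each
synchronisation, it is corrected on the part of the arena below the names that are revealed, which
no previous action has used. -/
theorem exists_merge_of_iseq {P Q : Proc 𝕊 N} {W : Type u} {f : Channel N → W}
    {g : Equiv.Perm (Event N)} {l : List (ℕ × ℕ)} {T : Term 𝕊 Kind.proc W}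
    (h : ISeq ((Term.par P (Q.rename (dualChannel g))).rename f) l T)
    (hf : Function.Injective f) (hP : Wf P) (hQ : Wf Q) (hg : g ∈ (arena N).group)
    (hK : ∀ y ∈ Q.free, ∀ b ∈ (dualChannel g y).2, b.2 ∉ P.locs) :
    ∃ g', g' ∈ (arena N).group ∧
      (∀ y : Channel N, (∀ b ∈ y.2, b.2 ∉ Q.locs) →
        (∀ b ∈ (dualChannel g y).2, b.2 ∉ P.locs) → dualChannel g' y = dualChannel g y) ∧
      ∃ p q P' Q', Merge (dualEvent g') p q l ∧ TransSeq P p P' ∧ TransSeq Q q Q' := by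
  induction l generalizing P Q W g with
  | nil => exact ⟨g, hg, fun _ _ _ => rfl, [], [], P, Q, .nil, .nil, .nil⟩
  | cons t l ih =>
    obtain ⟨ι, κ⟩ := t
    have hd := isDuality_of_mem hg
    cases h with
    | cons h1 h2 =>
      rcases itrans_par.1 h1 with ⟨b, ε, P1', Q1', h3, h4, rfl⟩ | ⟨P1', h3, rfl⟩ | ⟨Q1', h3, rfl⟩
      · obtain ⟨x, P1, rfl, h5, rfl⟩ := h3.of_rename
        rw [rename_rename] at h4
        obtain ⟨y, Q1, hxy, h6, rfl⟩ := h4.of_rename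
        obtain rfl : x = dualChannel g y := hf hxy
        set x := dualChannel g y with hx
        obtain ⟨n, _, h8⟩ := hd.loc y ε.op κ
        rw [Pola.op_op] at h8
        -- The current permutation sends `y⋅κ` to `x⋅n`, but `κ` synchronises with `ι`.
        set g1 : Equiv.Perm (Event N) := generator x ε (Equiv.swap n ι) * g with hg1'
        have hg1 : g1 ∈ (arena N).group := mul_mem (generator_mem _ _ _) hg
        have hd1 := isDuality_of_mem hg1
        have hc : dualChannel g1 (y.child ε.op κ) = x.child ε ι :=
          dualChannel_generator_mul_child hg h8
        have hagree : ∀ z : Channel N, (∀ b ∈ z.2, b.2 ∉ Q.locs) →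
            (∀ b ∈ (dualChannel g z).2, b.2 ∉ P.locs) → dualChannel g1 z = dualChannel g z := by
          intro z hz hz'
          refine dualChannel_generator_mul x ε n ι hg z (fun s hs => ?_) (fun s hs => ?_)
          · obtain ⟨z', r, rfl, h9⟩ := hd.exists_prefix z (x.child ε n) s
              (by rw [hs]; simp [Channel.child])
            obtain rfl := hd.injective_channel (h9.trans h8.symm)
            exact hz (ε.op, κ) (by simp [Channel.child]) h6.mem_locs
          · exact hz' (ε, ι) (by rw [hs]; simp) h5.mem_locs
        -- No free name of `Q` goes through the locations `ι` and `κ`, which are still to be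
        -- triggered, so the correction does not affect it.
        have hfree : ∀ z ∈ Q.free, dualChannel g1 z = dualChannel g z :=
          fun z hz => hagree z (hQ.fresh z hz) (hK z hz)
        have t1 : Trans P (Label.vis x ε ι) _ := .vis h5
        have t2 : Trans Q (Label.vis y ε.op κ) _ := .vis h6
        obtain ⟨T', h9, rfl⟩ := h2.of_new
        rw [sync_eq hP hQ h5 h6 f hd1.injective_channel hfree hc] at h9
        -- The revealed names go through triggered locations only, so later corrections leave them
        -- alone.
        have hKy : ∀ b ∈ (y.child ε.op κ).2, b.2 ∉ (Q1.rename
            (fun o => o.getD (y.child ε.op κ))).locs := by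
          intro b hb hb'
          simp only [Channel.child, List.mem_append, List.mem_singleton] at hb
          rcases hb with hb | rfl
          · exact hQ.fresh y h6.mem_free b hb (t2.locs_sublist.subset hb')
          · exact t2.not_mem_locs hQ.nodup (by simp [Label.locs]) hb'
        have hKx : ∀ b ∈ (dualChannel g1 (y.child ε.op κ)).2, b.2 ∉ (P1.rename
            (fun o => o.getD (x.child ε ι))).locs := by
          rw [hc]
          intro b hb hb'
          simp only [Channel.child, List.mem_append, List.mem_singleton] at hb
          rcases hb with hb | rfl
          · exact hP.fresh x h5.mem_free b hb (t1.locs_sublist.subset hb')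
          · exact t1.not_mem_locs hP.nodup (by simp [Label.locs]) hb'
        obtain ⟨g', hg', h10, p, q, P', Q', h11, h12, h13⟩ :=
          ih h9 (bindChannel_injective _ hf) (t1.wf hP) (t2.wf hQ) hg1 (by
            intro z hz
            obtain ⟨o, ho, rfl⟩ := (mem_free_rename _).1 hz
            rcases o with _ | z
            · exact hKx
            · have hz' := h6.free_subset ho
              intro b hb hb'
              rw [Option.getD_some, hfree z hz'] at hb
              exact hK z hz' b hb (t1.locs_sublist.subset hb'))
        refine ⟨g', hg', fun z hz hz' => ?_, _, _, P', Q', .sync ?_ h11, .cons t1 h12,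
          .cons t2 h13⟩
        · rw [h10 z (fun b hb hb' => hz b hb (t2.locs_sublist.subset hb')), hagree z hz hz']
          intro b hb hb'
          rw [hagree z hz hz'] at hb
          exact hz' b hb (t1.locs_sublist.subset hb')
        · exact (isDuality_of_mem hg').of_child ((h10 _ hKy hKx).trans hc)
      · obtain ⟨P1, h5, rfl⟩ := h3.of_rename hf.injOn
        have t1 : Trans P (Label.tau ι κ) P1 := .tau h5
        obtain ⟨g', hg', h10, p, q, P', Q', h11, h12, h13⟩ :=
          ih (P := P1) (Q := Q) (f := f) (g := g) h2 hf (t1.wf hP) hQ hg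
            (fun y hy b hb hb' => hK y hy b hb (t1.locs_sublist.subset hb'))
        exact ⟨g', hg', fun z hz hz' => h10 z hz
          (fun b hb hb' => hz' b hb (t1.locs_sublist.subset hb')),
          _, _, P', Q', .left ι κ h11, .cons t1 h12, h13⟩
      · obtain ⟨Q2, h5, rfl⟩ := h3.of_rename hf.injOn
        obtain ⟨Q1, h6, rfl⟩ := h5.of_rename hd.injective_channel.injOn
        have t1 : Trans Q (Label.tau ι κ) Q1 := .tau h6
        obtain ⟨g', hg', h10, p, q, P', Q', h11, h12, h13⟩ :=
          ih (P := P) (Q := Q1) (f := f) (g := g) h2 hf hP (t1.wf hQ) hg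
            (fun y hy => hK y (h6.free_subset hy))
        exact ⟨g', hg', fun z hz hz' => h10 z
          (fun b hb hb' => hz b hb (t1.locs_sublist.subset hb')) hz',
          _, _, P', Q', .right ι κ h11, h12, .cons t1 h13⟩

end Simulation

end PiI

namespace OrderAlgebra.Play

variable {X : Arena.{u}} {A : Finset X.web} {R : X.web → X.web → Prop}

theorem apply_mem_map_support {π : Equiv.Perm X.web} {r : Play X} {x : X.web} :
    π x ∈ (map π r).support ↔ x ∈ r.support := by
  change π x ∈ r.support.map _ ↔ _
  rw [Finset.mem_map_equiv, Equiv.symm_apply_apply]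

theorem generate_rel_of_mem {x y : X.web} (hx : x ∈ A) (hy : y ∈ A) (h : R x y) :
    (generate A R).rel x y :=
  ⟨hx, .single ⟨hx, hy, h⟩⟩

/-- A map that strictly increases along the non-trivial steps of the relation `R` strictly
increases along the preorder that `R` generates. -/
theorem eq_or_lt_of_generate (h : X.web → ℕ) (hR : ∀ x y, R x y → x = y ∨ h x < h y)
    {x y : X.web} (hxy : (generate A R).rel x y) : x = y ∨ h x < h y := by
  obtain ⟨_, hxy⟩ := hxy
  induction hxy with
  | refl => exact Or.inl rfl
  | tail _ h1 ih =>
    rcases ih with rfl | ih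
    · exact hR _ _ h1.2.2
    · rcases hR _ _ h1.2.2 with rfl | h2
      · exact Or.inr ih
      · exact Or.inr (ih.trans h2)

theorem consistent_generate (h : X.web → ℕ) (hR : ∀ x y, R x y → x = y ∨ h x < h y) :
    (generate A R).Consistent := by
  intro x y hxy hyx
  rcases eq_or_lt_of_generate h hR hxy with h1 | h1
  · exact h1
  · rcases eq_or_lt_of_generate h hR hyx with h2 | h2
    · exact h2.symm
    · exact absurd h2 h1.asymm

open Classical in
/-- A consistent play extends to a linear order, hence has an injective and increasing rank. -/
theorem Consistent.exists_rank {r : Play X} (hr : r.Consistent) :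
    ∃ h : X.web → ℕ, (∀ x y, r.rel x y → h x ≤ h y) ∧
      ∀ x ∈ r.support, ∀ y ∈ r.support, h x = h y → x = y := by
  have : IsPartialOrder X.web (fun x y => x = y ∨ r.rel x y) :=
    { refl := fun x => Or.inl rfl
      trans := by
        rintro x y z (rfl | h1) (rfl | h2)
        · exact Or.inl rfl
        · exact Or.inr h2
        · exact Or.inr h1
        · exact Or.inr (r.trans h1 h2)
      antisymm := by
        rintro x y (rfl | h1) (h2 | h2)
        · rfl
        · rfl
        · exact h2.symm
        · exact hr x y h1 h2 }
  obtain ⟨s, hs, hle⟩ := extend_partialOrder (fun x y => x = y ∨ r.rel x y)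
  -- The rank is the number of elements of the support that are below for the linear order `s`.
  have hmono : ∀ {x y}, s x y → r.support.filter (s · x) ⊆ r.support.filter (s · y) :=
    fun hxy => Finset.monotone_filter_right _ (fun _ _ hz => hs.trans _ _ _ hz hxy)
  have key : ∀ x ∈ r.support, ∀ y ∈ r.support, s x y →
      (r.support.filter (s · x)).card = (r.support.filter (s · y)).card → x = y := by
    intro x _ y hy hxy hc
    have h1 := Finset.eq_of_subset_of_card_le (hmono hxy) hc.ge
    have h2 : y ∈ r.support.filter (s · x) := by
      rw [h1]
      exact Finset.mem_filter.2 ⟨hy, hs.refl y⟩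
    exact hs.antisymm _ _ hxy (Finset.mem_filter.1 h2).2
  refine ⟨fun x => (r.support.filter (s · x)).card, fun x y hxy =>
    Finset.card_le_card (hmono (hle _ _ (Or.inr hxy))), fun x hx y hy hc => ?_⟩
  rcases hs.total x y with h | h
  · exact key x hx y hy h hc
  · exact (key y hy x hx h hc.symm).symm

end OrderAlgebra.Play

namespace PiI

open Term OrderAlgebra

/-! ### Synchronisation of induced traces -/

section Traces

variable {𝕊 : Type v} {N : Type u}

theorem TransSeq.mem_free {P T : Proc 𝕊 N} {p : List (Label N)} (h : TransSeq P p T)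
    {x : Channel N} (hx : x ∈ T.free) :
    x ∈ P.free ∨ ∃ y ε n, Label.vis y ε n ∈ p ∧ x = y.child ε n := by
  induction h with
  | nil => exact Or.inl hx
  | cons h _ ih =>
    rcases ih hx with h1 | ⟨y, ε, n, h1, h2⟩
    · cases h with
      | vis h =>
        obtain ⟨o, ho, rfl⟩ := (mem_free_rename _).1 h1
        rcases o with _ | z
        · exact Or.inr ⟨_, _, _, List.mem_cons_self, rfl⟩
        · exact Or.inl (h.free_subset ho)
      | tau h => exact Or.inl (h.free_subset h1)
    · exact Or.inr ⟨y, ε, n, List.mem_cons_of_mem _ h1, h2⟩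

variable {P Q : Proc 𝕊 N} {ρ : Pretrace P} {σ : Pretrace Q} {p q : List (Label N)}
  {l : List (ℕ × ℕ)}

theorem Pretrace.known_of_mem_free (hP : ∀ x ∈ P.free, ∃ u : N, x = Channel.ofName u)
    {x : Channel N} (hx : x ∈ ρ.reduct.free) : ρ.Known x := by
  obtain ⟨p, hp, hT⟩ := ρ.reduct_transSeq
  rcases hT.mem_free hx with h | ⟨y, ε, n, h, rfl⟩
  · exact Or.inl (hP x h)
  · exact Or.inr ⟨y, ε, n, (hp.hasLabel_iff _).2 h, rfl⟩

theorem Pretrace.mem_traceSupport_loc {x : Channel N} {ε : Pola} {n : ℕ} :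
    (x, ε, Slot.loc n) ∈ ρ.traceSupport ↔ ρ.HasLabel (Label.vis x ε n) := by
  constructor
  · rintro (⟨x, ε, n, h, h'⟩ | ⟨x, ε, _, h' | h'⟩) <;> cases h'
    exact h
  · exact fun h => Or.inl ⟨x, ε, n, h, rfl⟩

theorem Pretrace.mem_traceSupport_bot {x : Channel N} {ε : Pola} :
    (x, ε, Slot.bot) ∈ ρ.traceSupport ↔ ρ.Known x := by
  constructor
  · rintro (⟨x, ε, n, h, h'⟩ | ⟨x, ε, h, h' | h'⟩) <;> cases h'
    exact h
  · exact fun h => Or.inr ⟨x, ε, h, Or.inl rfl⟩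

theorem Pretrace.mem_traceSupport_top {x : Channel N} {ε : Pola} :
    (x, ε, Slot.top) ∈ ρ.traceSupport ↔ ρ.Known x := by
  constructor
  · rintro (⟨x, ε, n, h, h'⟩ | ⟨x, ε, h, h' | h'⟩) <;> cases h'
    exact h
  · exact fun h => Or.inr ⟨x, ε, h, Or.inr rfl⟩

/-- Pre-traces that synchronise along `θ` have the same support up to `θ`. -/
theorem Merge.mem_traceSupport {θ : Event N → Event N} {β : Channel N → Channel N}
    (hθ : IsDuality θ β) (h : Merge θ p q l) (hp : ρ.Has p) (hq : σ.Has q) (e : Event N) :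
    θ e ∈ ρ.traceSupport ↔ e ∈ σ.traceSupport := by
  have hK : ∀ y, ρ.Known (β y) ↔ σ.Known y := by
    intro y
    constructor
    · rintro (⟨u, hu⟩ | ⟨x, ε, ι, h1, hy⟩)
      · exact Or.inl ⟨u, hθ.injective_channel (hu.trans (hθ.ofName u).symm)⟩
      · obtain ⟨z, η, κ, h2, h3, _⟩ := h.exists_of_vis_left ((hp.hasLabel_iff _).1 h1)
        exact Or.inr ⟨z, η, κ, (hq.hasLabel_iff _).2 h2,
          hθ.injective_channel (hy.trans (hθ.of_loc h3).2.2.symm)⟩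
    · rintro (⟨u, rfl⟩ | ⟨z, η, κ, h1, rfl⟩)
      · exact Or.inl ⟨u, hθ.ofName u⟩
      · obtain ⟨x, ε, ι, h2, h3, _⟩ := h.exists_of_vis_right ((hq.hasLabel_iff _).1 h1)
        exact Or.inr ⟨x, ε, ι, (hp.hasLabel_iff _).2 h2, (hθ.of_loc h3).2.2⟩
  obtain ⟨y, η, κ | _ | _⟩ := e
  · rw [Pretrace.mem_traceSupport_loc, hq.hasLabel_iff]
    constructor
    · intro h1
      obtain ⟨m, h2, _⟩ := hθ.loc y η κ
      rw [h2, Pretrace.mem_traceSupport_loc, hp.hasLabel_iff] at h1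
      obtain ⟨z, η', κ', h3, h4, _⟩ := h.exists_of_vis_left h1
      have := hθ.injective (h4.trans h2.symm)
      cases this
      exact h3
    · intro h1
      obtain ⟨x, ε, ι, h2, h3, _⟩ := h.exists_of_vis_right h1
      rw [h3, Pretrace.mem_traceSupport_loc, hp.hasLabel_iff]
      exact h2
  · rw [hθ.bot, Pretrace.mem_traceSupport_bot, Pretrace.mem_traceSupport_top, hK]
  · rw [hθ.top, Pretrace.mem_traceSupport_bot, Pretrace.mem_traceSupport_top, hK]

theorem dualEvent_surjective (g : Equiv.Perm (Event N)) : Function.Surjective (dualEvent g) :=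
  g.surjective.comp (invert N).surjective

variable [Finite N]

/-- The image under `g` of the inverted trace of `σ`. -/
noncomputable def dualPlay [Zero 𝕊] (g : Equiv.Perm (Event N)) (σ : Pretrace Q) :
    Play (arena N) :=
  Play.map (X := arena N) g (Play.map (X := arena N) (invert N) σ.trace)

variable [Zero 𝕊] {g : Equiv.Perm (Event N)}

theorem mem_trace_support {e : (arena N).web} :
    e ∈ ρ.trace.support ↔ e ∈ ρ.traceSupport :=
  Set.Finite.mem_toFinset _

theorem mem_dualPlay_support {e : Event N} :
    (dualEvent g e : (arena N).web) ∈ (dualPlay g σ).support ↔ e ∈ σ.traceSupport := by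
  refine Iff.trans ?_ mem_trace_support
  exact (Play.apply_mem_map_support (X := arena N) (π := g)).trans
    (Play.apply_mem_map_support (X := arena N) (π := invert N))

theorem dualPlay_rel {e f : Event N} :
    (dualPlay g σ).rel (dualEvent g e) (dualEvent g f) ↔ σ.trace.rel e f := by
  change σ.trace.rel ((invert N).symm (g.symm (g (invert N e))))
    ((invert N).symm (g.symm (g (invert N f)))) ↔ _
  simp

/-- The support of the play induced by `σ`, transported along `g`, is that of `ρ`. -/
theorem dualPlay_support_eq_iff : (dualPlay g σ).support = ρ.trace.support ↔
    ∀ e, dualEvent g e ∈ ρ.traceSupport ↔ e ∈ σ.traceSupport := by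
  constructor
  · intro h e
    refine mem_trace_support.symm.trans ?_
    rw [← h]
    exact mem_dualPlay_support
  · intro h
    ext a
    obtain ⟨e, rfl⟩ := dualEvent_surjective g a
    exact mem_dualPlay_support.trans ((h e).symm.trans mem_trace_support.symm)

open Classical in
/-- Traces that come from interactions that synchronise, without dual inactions on a known name,
have a consistent synchronisation: the position in these interactions is a rank. -/
theorem Merge.consistent_sync (hg : g ∈ (arena N).group) (hP : Wf P)
    (h : Merge (dualEvent g) p q l) (hp : ρ.Has p) (hq : σ.Has q)
    (hd : ∀ y η, HasInaction η y σ.reduct → ¬ HasInaction η.op (dualChannel g y) ρ.reduct)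
    (hs : (dualPlay g σ).support = ρ.trace.support) :
    (ρ.trace.sync (dualPlay g σ) hs).Consistent := by
  have hθ := isDuality_of_mem hg
  obtain ⟨T, hT⟩ := hp.transSeq
  let idx : Event N → ℕ :=
    fun e => @List.idxOf _ (@instBEqOfDecidableEq _ (Classical.decEq _)) e (events p)
  have hidx : ∀ {e f}, List.Sublist [e, f] (events p) → idx e < idx f :=
    fun h => @idxOf_lt_of_pair_sublist _ (Classical.decEq _) _
      (events_nodup (hT.nodup hP.nodup)) _ _ h
  -- The marks of an inaction `x^ε.0` left by `ρ` are ranked as `⊥ < ⊤`. All other pairs of marks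
  -- are ranked in the opposite way, which is that of the duals of the inactions left by `σ`.
  let r : (arena N).web → ℕ := fun e : Event N => match e with
    | (x, ε, Slot.loc n) => idx (x, ε, Slot.loc n)
    | (x, ε, Slot.bot) => if HasInaction ε x ρ.reduct then 0 else 1
    | (x, ε, Slot.top) => if HasInaction ε x ρ.reduct then 1 else 0
  refine Play.consistent_generate r ?_
  rintro a b (hab | hab)
  · refine Play.eq_or_lt_of_generate r ?_ hab
    rintro _ _ (⟨x, ε, n, y, η, m, rfl, rfl, hc⟩ | ⟨x, ε, rfl, rfl, hi⟩)
    · obtain ⟨_, _, hc | hc⟩ := hc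
      · cases hc
        exact Or.inl rfl
      · exact Or.inr (hidx ((hc ⟨p, hp.1⟩ hp.2).filterMap Label.event))
    · refine Or.inr ?_
      simp [r, hi]
  · obtain ⟨a, rfl⟩ := dualEvent_surjective g a
    obtain ⟨b, rfl⟩ := dualEvent_surjective g b
    rw [dualPlay_rel] at hab
    have hab : a = b ∨ r (dualEvent g a) < r (dualEvent g b) := by
      refine Play.eq_or_lt_of_generate (X := arena N) (fun a => r (dualEvent g a)) ?_ hab
      rintro _ _ (⟨x, ε, n, y, η, m, rfl, rfl, hc⟩ | ⟨x, ε, rfl, rfl, hi⟩)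
      · obtain ⟨_, _, hc | hc⟩ := hc
        · cases hc
          exact Or.inl rfl
        · have h1 := ((hc ⟨q, hq.1⟩ hq.2).filterMap Label.event).map (dualEvent g)
          change List.Sublist _ ((events q).map _) at h1
          rw [← h.events_eq] at h1
          refine Or.inr ?_
          obtain ⟨m', h2, _⟩ := hθ.loc x ε n
          obtain ⟨n', h3, _⟩ := hθ.loc y η m
          have h4 := hidx h1
          rw [h2, h3] at h4
          simp only [h2, h3, r]
          exact h4
      · refine Or.inr ?_
        simp only [hθ.bot, hθ.top, r, hd x ε hi, if_false]
        exact zero_lt_one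
    rcases hab with rfl | hab
    · exact Or.inl rfl
    · exact Or.inr hab

/-- If the synchronisation of two traces is consistent, then the visible actions of both
pre-traces can be played in the same order. -/
theorem exists_merge_of_consistent (hg : g ∈ (arena N).group) (hP : Wf P) (hQ : Wf Q)
    (hfP : ∀ x ∈ P.free, ∃ u : N, x = Channel.ofName u)
    (hs : (dualPlay g σ).support = ρ.trace.support)
    (hc : (ρ.trace.sync (dualPlay g σ) hs).Consistent) :
    (∃ p q l, ρ.Has p ∧ σ.Has q ∧ Merge (dualEvent g) p q l) ∧
    ∀ y η, HasInaction η y σ.reduct → ¬ HasInaction η.op (dualChannel g y) ρ.reduct := by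
  have hθ := isDuality_of_mem hg
  have hs' := dualPlay_support_eq_iff.1 hs
  have hmem : ∀ {e : (arena N).web}, e ∈ ρ.traceSupport → e ∈ ρ.trace.support :=
    fun h => mem_trace_support.2 h
  have hrel1 : ∀ {a b}, ρ.trace.rel a b → (ρ.trace.sync (dualPlay g σ) hs).rel a b :=
    fun h => Play.generate_rel_of_mem (ρ.trace.rel_mem h).1 (ρ.trace.rel_mem h).2 (Or.inl h)
  have hrel2 : ∀ {a b : Event N}, σ.trace.rel a b →
      (ρ.trace.sync (dualPlay g σ) hs).rel (dualEvent g a) (dualEvent g b) :=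
    fun h => Play.generate_rel_of_mem
      (hmem ((hs' _).2 (mem_trace_support.1 (σ.trace.rel_mem h).1)))
      (hmem ((hs' _).2 (mem_trace_support.1 (σ.trace.rel_mem h).2)))
      (Or.inr (dualPlay_rel.2 h))
  refine ⟨?_, ?_⟩
  · obtain ⟨r, hr, hinj⟩ := hc.exists_rank
    obtain ⟨p, hp, hps⟩ := ρ.exists_has_sorted hP r (fun x ε ι y η κ h =>
      hr _ _ (hrel1 (Play.generate_rel_of_mem
        (mem_trace_support.2 (Pretrace.mem_traceSupport_loc.2 h.1))
        (mem_trace_support.2 (Pretrace.mem_traceSupport_loc.2 h.2.1))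
        (Or.inl ⟨_, _, _, _, _, _, rfl, rfl, h⟩))))
    obtain ⟨q, hq, hqs⟩ := σ.exists_has_sorted hQ (fun e => r (dualEvent g e))
      (fun x ε ι y η κ h => hr _ _ (hrel2 (Play.generate_rel_of_mem
        (mem_trace_support.2 (Pretrace.mem_traceSupport_loc.2 h.1))
        (mem_trace_support.2 (Pretrace.mem_traceSupport_loc.2 h.2.1))
        (Or.inl ⟨_, _, _, _, _, _, rfl, rfl, h⟩))))
    have hpe : ∀ e, e ∈ events p ↔ e ∈ ρ.traceSupport ∧ ∃ n, e.2.2 = Slot.loc n := by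
      rintro ⟨x, ε, s⟩
      rw [mem_events]
      constructor
      · rintro ⟨ι, rfl, h⟩
        exact ⟨Pretrace.mem_traceSupport_loc.2 ((hp.hasLabel_iff _).2 h), ι, rfl⟩
      · rintro ⟨h, ι, rfl⟩
        exact ⟨ι, rfl, (hp.hasLabel_iff _).1 (Pretrace.mem_traceSupport_loc.1 h)⟩
    have hqe : ∀ e, e ∈ events q ↔ e ∈ σ.traceSupport ∧ ∃ n, e.2.2 = Slot.loc n := by
      rintro ⟨x, ε, s⟩
      rw [mem_events]
      constructor
      · rintro ⟨ι, rfl, h⟩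
        exact ⟨Pretrace.mem_traceSupport_loc.2 ((hq.hasLabel_iff _).2 h), ι, rfl⟩
      · rintro ⟨h, ι, rfl⟩
        exact ⟨ι, rfl, (hq.hasLabel_iff _).1 (Pretrace.mem_traceSupport_loc.1 h)⟩
    have hloc : ∀ e, (∃ n, (dualEvent g e).2.2 = Slot.loc n) ↔ ∃ n, e.2.2 = Slot.loc n := by
      rintro ⟨y, η, κ | _ | _⟩
      · obtain ⟨m, h, _⟩ := hθ.loc y η κ
        simp [h]
      · simp [hθ.bot]
      · simp [hθ.top]
    obtain ⟨T, hT⟩ := hp.transSeq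
    obtain ⟨S, hS⟩ := hq.transSeq
    -- Both lists of visible actions enumerate the same events by increasing rank.
    have hperm : (events p).Perm ((events q).map (dualEvent g)) := by
      rw [List.perm_ext_iff_of_nodup (events_nodup (hT.nodup hP.nodup))
        ((events_nodup (hS.nodup hQ.nodup)).map hθ.injective)]
      intro a
      obtain ⟨e, rfl⟩ := dualEvent_surjective g a
      rw [List.mem_map_of_injective hθ.injective, hpe, hqe, hs', hloc]
    have heq : events p = (events q).map (dualEvent g) := by
      refine List.Perm.eq_of_pairwise (le := fun e f => r e ≤ r f) ?_ hps ?_ hperm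
      · intro a b ha hb h1 h2
        exact hinj a (hmem ((hpe a).1 ha).1) b (hmem ((hpe b).1 (hperm.mem_iff.2 hb)).1)
          (h1.antisymm h2)
      · exact List.pairwise_map.2 hqs
    obtain ⟨l, hl⟩ := Merge.exists_of_events_eq heq
    exact ⟨p, q, l, hp, hq, hl⟩
  · intro y η hy hx
    -- The marks of the two inactions form a cycle.
    have hk : ρ.Known (dualChannel g y) := ρ.known_of_mem_free hfP hx.mem_free
    have hb : (dualChannel g y, η.op, Slot.bot) ∈ ρ.traceSupport :=
      Pretrace.mem_traceSupport_bot.2 hk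
    have ht : (dualChannel g y, η.op, Slot.top) ∈ ρ.traceSupport :=
      Pretrace.mem_traceSupport_top.2 hk
    have h1 := hrel1 (Play.generate_rel_of_mem (hmem hb) (hmem ht)
      (Or.inr ⟨_, _, rfl, rfl, hx⟩))
    have ht' := ht
    rw [← hθ.bot y η, hs'] at ht
    rw [← hθ.top y η, hs'] at hb
    have h2 : σ.trace.rel (y, η, Slot.bot) (y, η, Slot.top) :=
      Play.generate_rel_of_mem (mem_trace_support.2 ht) (mem_trace_support.2 hb)
        (Or.inr ⟨_, _, rfl, rfl, hy⟩)
    have h3 := hrel2 h2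
    rw [hθ.bot, hθ.top] at h3
    have := hc _ _ h1 h3
    cases this

end Traces

end PiI

namespace PiI

open Term OrderAlgebra

/-! ### Pre-traces of a parallel composition -/

section Synchronisation

variable {𝕊 : Type v} {N : Type u}

theorem Wf.left {P Q : Proc 𝕊 N} (h : Wf (Term.par P Q)) : Wf P :=
  ⟨(List.nodup_append.1 h.nodup).1,
    fun x hx b hb hl => h.fresh x (Or.inl hx) b hb (List.mem_append_left _ hl)⟩

theorem Wf.right {P Q : Proc 𝕊 N} (h : Wf (Term.par P Q)) : Wf Q :=
  ⟨(List.nodup_append.1 h.nodup).2.1,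
    fun x hx b hb hl => h.fresh x (Or.inr hx) b hb (List.mem_append_right _ hl)⟩

theorem Wf.disjoint {P Q : Proc 𝕊 N} (h : Wf (Term.par P Q)) {ι : ℕ} (hP : ι ∈ P.locs)
    (hQ : ι ∈ Q.locs) : False :=
  (List.nodup_append.1 h.nodup).2.2 ι hP ι hQ rfl

theorem Simple.free_proc [CommSemiring 𝕊] (P : Simple N) :
    ∀ x ∈ (P.proc 𝕊).free, ∃ u : N, x = Channel.ofName u := by
  intro x hx
  obtain ⟨u, _, rfl⟩ := (mem_free_rename _).1 hx
  exact ⟨u, rfl⟩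

/-- Interactions whose labels have the same locations, up to permutation, are homotopic. -/
theorem Pretrace.Has.unique_of_locs {P : Proc 𝕊 N} (hP : Wf P) {ρ σ : Pretrace P}
    {p q : List (Label N)} (hp : ρ.Has p) (hq : σ.Has q)
    (hpq : (p.map Label.locs).Perm (q.map Label.locs)) : ρ = σ := by
  obtain ⟨p', h1, h2⟩ := exists_perm_map_eq _ hpq
  obtain ⟨T, hT⟩ := hp.transSeq
  obtain ⟨S, hS⟩ := hq.transSeq
  have hpw : (q.map Label.locs).Pairwise
      (fun s t => ¬ ∃ ι ∈ t, ∃ κ ∈ s, P.Prefixing ι κ) :=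
    List.pairwise_map.2 (hS.pairwise hP.nodup)
  rw [← h2] at hpw
  obtain ⟨T', h3, _⟩ := TransSeq.rearrange (c := []) hT hP h1 (List.pairwise_map.1 hpw)
  obtain ⟨rfl, _⟩ := TransSeq.deterministic (p := p') h3 hS hP.nodup h2
  exact hp.unique hP hq h1

/-- The merge depends on `θ` only at the events of the second interaction. -/
theorem Merge.congr {θ θ' : Event N → Event N} {p q : List (Label N)} {l : List (ℕ × ℕ)}
    (h : Merge θ p q l) (hθ : ∀ y η κ, Label.vis y η κ ∈ q →
      θ (y, η, Slot.loc κ) = θ' (y, η, Slot.loc κ)) : Merge θ' p q l := by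
  induction h with
  | nil => exact .nil
  | left ι κ _ ih => exact .left ι κ (ih hθ)
  | right ι κ _ ih =>
    exact .right ι κ (ih fun y η κ h => hθ y η κ (List.mem_cons_of_mem _ h))
  | sync h _ ih =>
    exact .sync ((hθ _ _ _ List.mem_cons_self).symm.trans h)
      (ih fun y η κ h => hθ y η κ (List.mem_cons_of_mem _ h))

/-- The pre-trace `τ` of `P | Q` consists of the pre-traces `ρ` of `P` and `σ` of `Q`, where the
visible actions are synchronised along the permutation `g` of the arena. -/
def Syncs (g : Equiv.Perm (Event N)) {P Q : Proc 𝕊 N} (ρ : Pretrace P) (σ : Pretrace Q)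
    (τ : Pretrace (Term.par P Q)) : Prop :=
  ∃ p q l, ρ.Has p ∧ σ.Has q ∧ Merge (dualEvent g) p q l ∧
    τ.Has (l.map fun t => Label.tau t.1 t.2)

variable {P Q : Proc 𝕊 N} {ρ : Pretrace P} {σ : Pretrace Q}
  {τ : Pretrace (Term.par P Q)} {g g' : Equiv.Perm (Event N)}

namespace Syncs

theorem internal (h : Syncs g ρ σ τ) : τ.Internal := by
  obtain ⟨p, q, l, _, _, _, hw⟩ := h
  intro a ha
  obtain ⟨t, _, rfl⟩ := List.mem_map.1 ((hw.hasLabel_iff a).1 ha)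
  exact ⟨t.1, t.2, rfl⟩

theorem triggers_iff (h : Syncs g ρ σ τ) (μ : ℕ) :
    τ.Triggers μ ↔ ρ.Triggers μ ∨ σ.Triggers μ := by
  obtain ⟨p, q, l, hp, hq, hm, hw⟩ := h
  rw [hw.triggers_iff, hp.triggers_iff, hq.triggers_iff, hm.mem_locs_iff]

/-- The result of a synchronisation is determined by its two sides and by the permutation on the
support of the trace. -/
theorem unique (hPQ : Wf (Term.par P Q)) {τ' : Pretrace (Term.par P Q)}
    (hgg' : ∀ e ∈ σ.traceSupport, dualEvent g e = dualEvent g' e)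
    (h : Syncs g ρ σ τ) (h' : Syncs g' ρ σ τ') : τ = τ' := by
  obtain ⟨p, q, l, hp, hq, hm, hw⟩ := h
  obtain ⟨p', q', l', hp', hq', hm', hw'⟩ := h'
  have hm : Merge (dualEvent g') p q l := hm.congr fun y η κ hy =>
    hgg' _ (Pretrace.mem_traceSupport_loc.2 ((hq.hasLabel_iff _).2 hy))
  have hinj : Function.Injective (dualEvent g') := g'.injective.comp (invert N).injective
  obtain ⟨T, hT⟩ := hw.transSeq
  obtain ⟨T', hT'⟩ := hw'.transSeq
  refine hw.unique hPQ hw' (List.Perm.map _ ?_)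
  rw [List.perm_ext_iff_of_nodup (hT.nodup hPQ.nodup).of_map (hT'.nodup hPQ.nodup).of_map]
  rintro ⟨ι, κ⟩
  simp only [hm.mem_iff hinj, hm'.mem_iff hinj, (hp.perm hp').mem_iff, (hq.perm hq').mem_iff]

/-- The two sides of a synchronisation are determined by its locations. -/
theorem left_right_unique (hPQ : Wf (Term.par P Q)) {ρ' : Pretrace P} {σ' : Pretrace Q}
    (h : Syncs g ρ σ τ) (h' : Syncs g' ρ' σ' τ) : ρ = ρ' ∧ σ = σ' := by
  classical
  obtain ⟨p, q, l, hp, hq, hm, hw⟩ := h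
  obtain ⟨p', q', l', hp', hq', hm', hw'⟩ := h'
  have hl : l.Perm l' := (List.map_perm_map_iff (fun s t hst => by
    obtain ⟨_, _⟩ := s
    obtain ⟨_, _⟩ := t
    cases hst
    rfl)).1 (hw.perm hw')
  have hlp : ∀ {ρ : Pretrace P} {p}, ρ.Has p → ∀ a ∈ p, ∀ ι ∈ a.locs, ι ∈ P.locs :=
    fun hp a ha ι hι => hp.transSeq.choose_spec.mem_locs ha hι
  have hlq : ∀ {σ : Pretrace Q} {q}, σ.Has q → ∀ a ∈ q, ∀ ι ∈ a.locs, ι ∈ Q.locs :=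
    fun hq a ha ι hι => hq.transSeq.choose_spec.mem_locs ha hι
  constructor
  · refine hp.unique_of_locs hPQ.left hp' ?_
    rw [hm.map_locs_left (· ∈ P.locs) (hlp hp)
        (fun a ha ι hι h => hPQ.disjoint h (hlq hq a ha ι hι)),
      hm'.map_locs_left (· ∈ P.locs) (hlp hp')
        (fun a ha ι hι h => hPQ.disjoint h (hlq hq' a ha ι hι))]
    exact hl.filterMap _
  · refine hq.unique_of_locs hPQ.right hq' ?_
    rw [hm.map_locs_right (· ∈ Q.locs)
        (fun a ha ι hι h => hPQ.disjoint (hlp hp a ha ι hι) h) (hlq hq),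
      hm'.map_locs_right (· ∈ Q.locs)
        (fun a ha ι hι h => hPQ.disjoint (hlp hp' a ha ι hι) h) (hlq hq')]
    exact hl.filterMap _

end Syncs

variable [Finite N]

theorem rename_dualChannel (hQ : ∀ x ∈ Q.free, ∃ u : N, x = Channel.ofName u)
    (hg : g ∈ (arena N).group) : Q.rename (dualChannel g) = Q := by
  conv_rhs => rw [← rename_id Q]
  refine rename_congr _ fun x hx => ?_
  obtain ⟨u, rfl⟩ := hQ x hx
  exact (isDuality_of_mem hg).ofName u

/-- A merge of interactions of `P` and `Q` is an interaction of `P | Q`. -/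
theorem Merge.transSeq [Zero 𝕊] (hg : g ∈ (arena N).group) (hP : Wf P) (hQ : Wf Q)
    (hfQ : ∀ x ∈ Q.free, ∃ u : N, x = Channel.ofName u) {p q : List (Label N)}
    {l : List (ℕ × ℕ)} (h : Merge (dualEvent g) p q l) {P' Q' : Proc 𝕊 N}
    (hp : TransSeq P p P') (hq : TransSeq Q q Q') :
    ∃ T, TransSeq (Term.par P Q) (l.map fun t => Label.tau t.1 t.2) T ∧
      (T.HasDualInactions ↔ (Term.par P' (Q'.rename (dualChannel g))).HasDualInactions) := by
  obtain ⟨T, h1, h2⟩ := h.iseq (isDuality_of_mem hg) hp hq hP hQ Function.injective_id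
  rw [rename_id, rename_dualChannel hfQ hg] at h1
  exact ⟨T, transSeq_tau_iff.2 h1, h2⟩

theorem exists_syncs [Zero 𝕊] (hg : g ∈ (arena N).group) (hP : Wf P) (hQ : Wf Q)
    (hfQ : ∀ x ∈ Q.free, ∃ u : N, x = Channel.ofName u) {p q : List (Label N)}
    {l : List (ℕ × ℕ)} (h : Merge (dualEvent g) p q l) (hp : ρ.Has p) (hq : σ.Has q) :
    ∃ τ, Syncs g ρ σ τ := by
  obtain ⟨_, hp'⟩ := hp.transSeq
  obtain ⟨_, hq'⟩ := hq.transSeq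
  obtain ⟨_, h1, _⟩ := h.transSeq hg hP hQ hfQ hp' hq'
  exact ⟨h1.pretrace, p, q, l, hp, hq, h, Pretrace.has_pretrace h1⟩

/-- Every internal pre-trace of `P | Q` comes from pre-traces of `P` and `Q`. -/
theorem Pretrace.Internal.exists_syncs (hPQ : Wf (Term.par P Q))
    (hfQ : ∀ x ∈ Q.free, ∃ u : N, x = Channel.ofName u) (h : τ.Internal) :
    ∃ g ∈ (arena N).group, ∃ ρ σ, Syncs g ρ σ τ := by
  obtain ⟨w, hw⟩ := τ.exists_has
  have hw' : ∀ a ∈ w, ∃ t : ℕ × ℕ, Label.tau t.1 t.2 = a := by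
    intro a ha
    obtain ⟨ι, κ, rfl⟩ := h a ((hw.hasLabel_iff a).2 ha)
    exact ⟨(ι, κ), rfl⟩
  obtain ⟨l, rfl⟩ : ∃ l : List (ℕ × ℕ), w = l.map fun t => Label.tau t.1 t.2 := by
    clear hw
    induction w with
    | nil => exact ⟨[], rfl⟩
    | cons a w ih =>
      obtain ⟨t, rfl⟩ := hw' _ List.mem_cons_self
      obtain ⟨l, rfl⟩ := ih fun a ha => hw' a (List.mem_cons_of_mem _ ha)
      exact ⟨t :: l, rfl⟩
  obtain ⟨T, hT⟩ := hw.transSeq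
  have hT' := transSeq_tau_iff.1 hT
  -- The identity permutation starts the splitting, as it fixes the free names.
  rw [← rename_id (Term.par P Q)] at hT'
  conv at hT' in Term.par P Q => rw [← rename_dualChannel hfQ (one_mem (arena N).group)]
  obtain ⟨g, hg, _, p, q, P', Q', h1, h2, h3⟩ := exists_merge_of_iseq hT'
    Function.injective_id hPQ.left hPQ.right (one_mem _) (by
      intro y hy b hb
      obtain ⟨u, rfl⟩ := hfQ y hy
      have := (isDuality_of_mem (one_mem (arena N).group)).ofName u
      exact absurd (congrArg Prod.snd this ▸ hb) List.not_mem_nil)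
  exact ⟨g, hg, h2.pretrace, h3.pretrace, p, q, l, Pretrace.has_pretrace h2,
    Pretrace.has_pretrace h3, h1, hw⟩

namespace Syncs

theorem hasDualInactions_iff [Zero 𝕊] (hg : g ∈ (arena N).group) (hPQ : Wf (Term.par P Q))
    (hfQ : ∀ x ∈ Q.free, ∃ u : N, x = Channel.ofName u) (h : Syncs g ρ σ τ) :
    τ.reduct.HasDualInactions ↔ ρ.reduct.HasDualInactions ∨ σ.reduct.HasDualInactions ∨
      ∃ y η, σ.reduct.HasInaction η y ∧ ρ.reduct.HasInaction η.op (dualChannel g y) := by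
  obtain ⟨p, q, l, hp, hq, hm, hw⟩ := h
  obtain ⟨P', hP'⟩ := hp.transSeq
  obtain ⟨Q', hQ'⟩ := hq.transSeq
  obtain ⟨T, hT, hd⟩ := hm.transSeq hg hPQ.left hPQ.right hfQ hP' hQ'
  have hP1 := hp.seq_reduct hPQ.left hP'
  have hQ1 := hq.seq_reduct hPQ.right hQ'
  rw [(hw.seq_reduct hPQ hT).hasDualInactions_iff, hd, hP1.hasDualInactions_iff,
    hQ1.hasDualInactions_iff]
  simp only [HasDualInactions, hasInaction_rename, hasDualInactions_rename _ _
    (isDuality_of_mem hg).injective_channel, hP1.hasInaction_iff, hQ1.hasInaction_iff]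
  refine or_congr_right (or_congr_right ⟨?_, ?_⟩)
  · rintro ⟨_, ε, h1, y, rfl, h2⟩
    exact ⟨y, ε.op, h2, by rwa [Pola.op_op]⟩
  · rintro ⟨y, η, h1, h2⟩
    exact ⟨_, η.op, h2, y, rfl, by rwa [Pola.op_op]⟩

/-- The permutation along which two pre-traces synchronise is determined by the result on the
support of the trace. -/
theorem dualEvent_eq (hg : g ∈ (arena N).group) (hg' : g' ∈ (arena N).group)
    (hPQ : Wf (Term.par P Q)) (h : Syncs g ρ σ τ) (h' : Syncs g' ρ σ τ) :
    ∀ e ∈ σ.traceSupport, dualEvent g e = dualEvent g' e := by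
  have hθ := isDuality_of_mem hg
  have hθ' := isDuality_of_mem hg'
  have hloc : ∀ y η κ, σ.HasLabel (Label.vis y η κ) → ∃ x ε ι,
      dualEvent g (y, η, Slot.loc κ) = (x, ε, Slot.loc ι) ∧
      dualEvent g' (y, η, Slot.loc κ) = (x, ε, Slot.loc ι) := by
    obtain ⟨p, q, l, hp, hq, hm, hw⟩ := h
    obtain ⟨p', q', l', hp', hq', hm', hw'⟩ := h'
    intro y η κ hy
    obtain ⟨x, ε, ι, h1, h2, h3⟩ := hm.exists_of_vis_right ((hq.hasLabel_iff _).1 hy)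
    obtain ⟨x', ε', ι', h1', h2', h3'⟩ := hm'.exists_of_vis_right ((hq'.hasLabel_iff _).1 hy)
    obtain ⟨T, hT⟩ := hw.transSeq
    obtain ⟨P', hP'⟩ := hp.transSeq
    have h4 := (hw.perm hw').mem_iff.2 (List.mem_map_of_mem (f := fun t : ℕ × ℕ =>
      (Label.tau t.1 t.2 : Label N)) h3')
    have h5 := hT.label_unique hPQ.nodup (List.mem_map_of_mem h3) h4 (ι := κ)
      (by simp [Label.locs]) (by simp [Label.locs])
    cases h5
    have h6 := hP'.label_unique hPQ.left.nodup h1 ((hp.perm hp').mem_iff.2 h1') (ι := ι)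
      (by simp [Label.locs]) (by simp [Label.locs])
    cases h6
    exact ⟨x, ε, ι, h2, h2'⟩
  have hK : ∀ y, σ.Known y → dualChannel g y = dualChannel g' y := by
    rintro y (⟨u, rfl⟩ | ⟨y, η, κ, h1, rfl⟩)
    · rw [hθ.ofName, hθ'.ofName]
    · obtain ⟨x, ε, ι, h2, h3⟩ := hloc y η κ h1
      rw [(hθ.of_loc h2).2.2, (hθ'.of_loc h3).2.2]
  rintro ⟨y, η, κ | _ | _⟩ he
  · obtain ⟨x, ε, ι, h2, h3⟩ := hloc y η κ (Pretrace.mem_traceSupport_loc.1 he)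
    rw [h2, h3]
  · rw [hθ.bot, hθ'.bot, hK y (Pretrace.mem_traceSupport_bot.1 he)]
  · rw [hθ.top, hθ'.top, hK y (Pretrace.mem_traceSupport_top.1 he)]

end Syncs

/-- The synchronisation of the trace of `ρ` with the dual trace of `σ`, transported along `g`, is
defined and consistent exactly when `ρ` and `σ` synchronise along `g` in `P | Q` without leaving
dual inactions on both sides. -/
theorem sync_consistent_iff [Zero 𝕊] (hg : g ∈ (arena N).group) (hPQ : Wf (Term.par P Q))
    (hfP : ∀ x ∈ P.free, ∃ u : N, x = Channel.ofName u)
    (hfQ : ∀ x ∈ Q.free, ∃ u : N, x = Channel.ofName u) :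
    (∃ hs : (dualPlay g σ).support = ρ.trace.support,
      (ρ.trace.sync (dualPlay g σ) hs).Consistent) ↔
    (∃ τ, Syncs g ρ σ τ) ∧ ¬ ∃ y η, σ.reduct.HasInaction η y ∧
      ρ.reduct.HasInaction η.op (dualChannel g y) := by
  constructor
  · rintro ⟨hs, hc⟩
    obtain ⟨⟨p, q, l, hp, hq, hm⟩, hd⟩ :=
      exists_merge_of_consistent hg hPQ.left hPQ.right hfP hs hc
    exact ⟨exists_syncs hg hPQ.left hPQ.right hfQ hm hp hq, fun ⟨y, η, h1, h2⟩ => hd y η h1 h2⟩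
  · rintro ⟨⟨τ, p, q, l, hp, hq, hm, _⟩, hd⟩
    refine ⟨dualPlay_support_eq_iff.2 (hm.mem_traceSupport (isDuality_of_mem hg) hp hq), ?_⟩
    exact hm.consistent_sync hg hPQ.left hp hq (fun y η h1 h2 => hd ⟨y, η, h1, h2⟩) _

end Synchronisation

end PiI

namespace OrderAlgebra

/-! ### The outcome of a permuted synchronisation as a number of cosets -/

section Counting

open Play

variable {X : Arena.{u}}

/-- The pointwise stabilizer of the support stabilizes the play. -/
theorem Play.fixingSubgroup_le_stabilizer (s : Play X) :
    fixingSubgroup X.group (s.support : Set X.web) ≤ MulAction.stabilizer X.group s := by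
  intro g hg
  rw [mem_fixingSubgroup_iff] at hg
  have hfix : ∀ x ∈ s.support, (g : Equiv.Perm X.web).symm x = x := fun x hx =>
    (Equiv.symm_apply_eq _).2 (hg x hx).symm
  have hfix' : ∀ x, (g : Equiv.Perm X.web).symm x ∈ s.support →
      (g : Equiv.Perm X.web).symm x = x := fun x hx =>
    ((Equiv.symm_apply_eq _).1 (hfix _ hx)).trans (Equiv.apply_symm_apply _ _)
  rw [MulAction.mem_stabilizer_iff]
  change map (g : Equiv.Perm X.web) s = s
  ext x y
  · change x ∈ s.support.map _ ↔ _
    rw [Finset.mem_map_equiv]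
    exact ⟨fun h => hfix' x h ▸ h, fun h => (hfix x h).symm ▸ h⟩
  · change s.rel ((g : Equiv.Perm X.web).symm x) ((g : Equiv.Perm X.web).symm y) ↔ _
    constructor
    · intro h
      have := s.rel_mem h
      rwa [hfix' x this.1, hfix' y this.2] at h
    · intro h
      have := s.rel_mem h
      rwa [hfix x this.1, hfix y this.2]

theorem Play.mk_eq_mk_iff {s : Play X} {g g' : X.group} :
    (g : X.group ⧸ fixingSubgroup X.group (s.support : Set X.web)) = g' ↔
      ∀ x ∈ s.support, (g : Equiv.Perm X.web) x = (g' : Equiv.Perm X.web) x := by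
  rw [QuotientGroup.eq, mem_fixingSubgroup_iff]
  refine forall₂_congr fun x _ => ?_
  rw [mul_smul, inv_smul_eq_iff]
  exact eq_comm

/-- The multiplicity turns a number of plays in the orbit of `s` into a number of cosets of the
pointwise stabilizer of the support. -/
theorem Play.multiplicity_mul_card (s : Play X) (D : Play X → Prop) :
    s.multiplicity * Nat.card {t : Play X // t ∈ MulAction.orbit X.group s ∧ D t} =
      Nat.card {c : X.group ⧸ fixingSubgroup X.group (s.support : Set X.web) //
        ∃ g : X.group, (g : X.group ⧸ fixingSubgroup X.group (s.support : Set X.web)) = c ∧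
          D (g • s)} := by
  have hle := s.fixingSubgroup_le_stabilizer
  set H := fixingSubgroup X.group (s.support : Set X.web)
  set K := MulAction.stabilizer X.group s with hK
  let D' : X.group ⧸ K → Prop := fun c =>
    D ((MulAction.orbitEquivQuotientStabilizer X.group s).symm c)
  have hD' : ∀ g : X.group, D' (g : X.group ⧸ K) ↔ D (g • s) := fun g => by
    simp only [D']
    rw [MulAction.orbitEquivQuotientStabilizer_symm_apply]
  have e1 : {t : Play X // t ∈ MulAction.orbit X.group s ∧ D t} ≃ {c : X.group ⧸ K // D' c} :=
    (Equiv.subtypeSubtypeEquivSubtypeInter _ _).symm.trans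
      ((MulAction.orbitEquivQuotientStabilizer X.group s).subtypeEquiv fun t => by
        simp only [D', Equiv.symm_apply_apply])
  have e2 : {c : X.group ⧸ H // ∃ g : X.group, (g : X.group ⧸ H) = c ∧ D (g • s)} ≃
      {c : (X.group ⧸ K) × (K ⧸ H.subgroupOf K) // D' c.1} :=
    (Subgroup.quotientEquivProdOfLE hle).subtypeEquiv fun c => by
      induction c using QuotientGroup.induction_on with
      | H g =>
        change _ ↔ D' (g : X.group ⧸ K)
        rw [hD']
        constructor
        · rintro ⟨g', h, hg'⟩
          have := MulAction.mem_stabilizer_iff.1 (hle (QuotientGroup.eq.1 h))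
          rw [mul_smul, inv_smul_eq_iff] at this
          rwa [this]
        · exact fun h => ⟨g, rfl, h⟩
  rw [Nat.card_congr e1, Nat.card_congr e2,
    Nat.card_congr (Equiv.prodSubtypeFstEquivSubtypeProd (p := D')), Nat.card_prod, mul_comm]
  rfl

variable (𝕊 : Type v) [CommSemiring 𝕊]

/-- The play `t` can be synchronised with `r` and the result is consistent. -/
def Play.Compatible (r t : Play X) : Prop :=
  ∃ h : t.support = r.support, (r.sync t h).Consistent

open Classical in
/-- The outcome of a permuted synchronisation counts the cosets of permutations after which the
synchronisation is defined and consistent. -/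
theorem outcome_psyncPlay (r s : Play X) : outcome 𝕊 X (psyncPlay 𝕊 r s) =
    (Nat.card {c : X.group ⧸ fixingSubgroup X.group (s.support : Set X.web) //
      ∃ g : X.group, (g : X.group ⧸ fixingSubgroup X.group (s.support : Set X.web)) = c ∧
        r.Compatible (g • s)} : 𝕊) := by
  rw [← s.multiplicity_mul_card r.Compatible, psyncPlay, map_nsmul, nsmul_eq_mul, Nat.cast_mul]
  congr 1
  have : Fintype (s.OrbitOn r.support) := Fintype.ofFinite _
  rw [finsum_eq_sum_of_fintype, map_sum]
  simp only [outcome, Finsupp.linearCombination_single, one_smul]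
  rw [Finset.sum_boole, ← Fintype.card_subtype, ← Nat.card_eq_fintype_card]
  congr 1
  exact Nat.card_congr ⟨fun t => ⟨t.1.1, t.1.2.1, t.1.2.2, t.2⟩,
    fun t => ⟨⟨t.1, t.2.1, t.2.2.choose⟩, t.2.2.choose_spec⟩, fun _ => rfl, fun _ => rfl⟩

end Counting

end OrderAlgebra

namespace PiI

open Term OrderAlgebra

/-! ### The outcome of a parallel composition -/

section Outcomes

variable {𝕊 : Type v} [CommSemiring 𝕊] {N : Type u} [Finite N]

/-- The translation is the sum of the traces of the exhaustive pre-traces. -/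
theorem translate_eq_sum (P : Simple N) [Fintype {ρ : Pretrace (P.proc 𝕊) // P.Exhaustive ρ}] :
    translate 𝕊 P = ∑ ρ : {ρ : Pretrace (P.proc 𝕊) // P.Exhaustive ρ},
      Finsupp.single ρ.1.trace (1 : 𝕊) := by
  classical
  ext t
  rw [Finsupp.finsetSum_apply]
  simp only [Finsupp.single_apply]
  rw [Finset.sum_boole, ← Fintype.card_subtype, ← Nat.card_eq_fintype_card]
  change ((Nat.card _ : ℕ) : 𝕊) = _
  congr 1
  exact Nat.card_congr (Equiv.subtypeSubtypeEquivSubtypeInter _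
    (fun ρ : Pretrace (P.proc 𝕊) => ρ.trace = t)).symm

/-- The cosets of permutations of the arena under the pointwise stabilizer of the dual trace
of `σ`. -/
abbrev TraceCoset {Q : Proc 𝕊 N} (σ : Pretrace Q) : Type u :=
  (arena N).group ⧸ fixingSubgroup (arena N).group
    ((Play.map (X := arena N) (invert N) σ.trace).support : Set (arena N).web)

/-- The coset `c` contains a permutation along which the traces of `ρ` and `σ` synchronise. -/
def CompatibleCoset {P Q : Proc 𝕊 N} (ρ : Pretrace P) (σ : Pretrace Q) (c : TraceCoset σ) : Prop :=
  ∃ g : (arena N).group, (g : TraceCoset σ) = c ∧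
    ρ.trace.Compatible (g • Play.map (X := arena N) (invert N) σ.trace)

theorem outcome_psync_translate (P Q : Simple N)
    [Fintype {ρ : Pretrace (P.proc 𝕊) // P.Exhaustive ρ}]
    [Fintype {σ : Pretrace (Q.proc 𝕊) // Q.Exhaustive σ}] :
    OrderAlgebra.outcome 𝕊 (arena N) (psync 𝕊 (arena N) (translate 𝕊 P)
      (bar N 𝕊 (translate 𝕊 Q))) =
    ∑ ρ : {ρ : Pretrace (P.proc 𝕊) // P.Exhaustive ρ},
      ∑ σ : {σ : Pretrace (Q.proc 𝕊) // Q.Exhaustive σ},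
        (Nat.card {c : TraceCoset σ.1 // CompatibleCoset ρ.1 σ.1 c} : 𝕊) := by
  rw [translate_eq_sum P, translate_eq_sum Q, map_sum, map_sum, LinearMap.sum_apply, map_sum]
  refine Finset.sum_congr rfl fun ρ _ => ?_
  rw [map_sum, map_sum]
  refine Finset.sum_congr rfl fun σ _ => ?_
  rw [bar, Finsupp.lmapDomain_apply, Finsupp.mapDomain_single, psync,
    Finsupp.linearCombination_single, one_smul, Finsupp.linearCombination_single, one_smul]
  exact outcome_psyncPlay 𝕊 _ _

theorem traceCoset_eq_iff {Q : Proc 𝕊 N} {σ : Pretrace Q} {g g' : (arena N).group} :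
    (g : TraceCoset σ) = g' ↔ ∀ e ∈ σ.traceSupport, dualEvent g.1 e = dualEvent g'.1 e := by
  refine Play.mk_eq_mk_iff.trans ⟨fun h e he => h _ ?_, fun h a ha => ?_⟩
  · exact (Play.apply_mem_map_support (X := arena N) (π := invert N)).2 (mem_trace_support.2 he)
  · obtain ⟨e, rfl⟩ := (invert N).surjective a
    exact h e (mem_trace_support.1 ((Play.apply_mem_map_support (X := arena N)
      (π := invert N)).1 ha))

namespace Simple

variable {P Q : Simple N}

/-- A pre-trace of `P | Q` is exhaustive if and only if its two sides are, and leave no dual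
inactions. -/
theorem exhaustive_par_iff {g : Equiv.Perm (Event N)} (hg : g ∈ (arena N).group)
    (hPQ : Wf (Term.par (P.proc 𝕊) (Q.proc 𝕊))) {ρ : Pretrace (P.proc 𝕊)}
    {σ : Pretrace (Q.proc 𝕊)} {τ : Pretrace ((Simple.par P Q).proc 𝕊)} (h : Syncs g ρ σ τ) :
    (Simple.par P Q).Exhaustive τ ↔ P.Exhaustive ρ ∧ Q.Exhaustive σ ∧
      ¬ ∃ y η, σ.reduct.HasInaction η y ∧ ρ.reduct.HasInaction η.op (dualChannel g y) := by
  have hd := h.hasDualInactions_iff hg hPQ Q.free_proc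
  have hl : ∀ μ ∈ (P.proc 𝕊).locs, (τ.Triggers μ ↔ ρ.Triggers μ) := by
    intro μ hμ
    refine (h.triggers_iff μ).trans (or_iff_left ?_)
    rintro ⟨a, ⟨q, _, ha⟩, hμ'⟩
    exact hPQ.disjoint hμ (q.2.choose_spec.mem_locs ha hμ')
  have hr : ∀ μ ∈ (Q.proc 𝕊).locs, (τ.Triggers μ ↔ σ.Triggers μ) := by
    intro μ hμ
    refine (h.triggers_iff μ).trans (or_iff_right ?_)
    rintro ⟨a, ⟨p, _, ha⟩, hμ'⟩
    exact hPQ.disjoint (p.2.choose_spec.mem_locs ha hμ') hμ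
  have h1 : ∀ μ ∈ P.linearLocs, (τ.Triggers μ ↔ ρ.Triggers μ) :=
    fun μ hμ => hl μ (linearLocs_subset P hμ)
  have h2 : ∀ μ ∈ P.inactionLocs, (τ.Triggers μ ↔ ρ.Triggers μ) :=
    fun μ hμ => hl μ (inactionLocs_subset P hμ)
  have h3 : ∀ μ ∈ Q.linearLocs, (τ.Triggers μ ↔ σ.Triggers μ) :=
    fun μ hμ => hr μ (linearLocs_subset Q hμ)
  have h4 : ∀ μ ∈ Q.inactionLocs, (τ.Triggers μ ↔ σ.Triggers μ) :=
    fun μ hμ => hr μ (inactionLocs_subset Q hμ)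
  simp only [Exhaustive, linearLocs, inactionLocs, List.mem_append, or_imp, forall_and]
  rw [forall₂_congr h1, forall₂_congr h3, forall₂_congr (fun μ hμ => not_congr (h2 μ hμ)),
    forall₂_congr (fun μ hμ => not_congr (h4 μ hμ)),
    show (¬ τ.reduct.HasDualInactions) ↔ _ from not_congr hd, not_or, not_or]
  constructor
  · rintro ⟨⟨a1, a2⟩, ⟨b1, b2⟩, c1, c2, c3⟩
    exact ⟨⟨a1, b1, c1⟩, ⟨a2, b2, c2⟩, c3⟩
  · rintro ⟨⟨a1, b1, c1⟩, ⟨a2, b2, c2⟩, c3⟩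
    exact ⟨⟨a1, a2⟩, ⟨b1, b2⟩, c1, c2, c3⟩

end Simple

/-- Pairs of exhaustive pre-traces of `P` and `Q` with a coset along which they synchronise. -/
abbrev SyncTriple (𝕊 : Type v) [CommSemiring 𝕊] (P Q : Simple N) : Type u :=
  Σ ρ : {ρ : Pretrace (P.proc 𝕊) // P.Exhaustive ρ},
    Σ σ : {σ : Pretrace (Q.proc 𝕊) // Q.Exhaustive σ},
      {c : TraceCoset σ.1 // CompatibleCoset ρ.1 σ.1 c}

/-- Triples of exhaustive pre-traces of `P` and `Q` with a coset correspond to the exhaustive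
internal pre-traces of `P | Q`. -/
theorem nonempty_syncTriple_equiv (P Q : Simple N)
    (hPQ : Wf (Term.par (P.proc 𝕊) (Q.proc 𝕊))) :
    Nonempty (SyncTriple 𝕊 P Q ≃ {τ : Pretrace ((Simple.par P Q).proc 𝕊) //
      (Simple.par P Q).Exhaustive τ ∧ τ.Internal}) := by
  have key : ∀ b : SyncTriple 𝕊 P Q, ∃ τ : {τ : Pretrace ((Simple.par P Q).proc 𝕊) //
      (Simple.par P Q).Exhaustive τ ∧ τ.Internal}, ∃ g : (arena N).group,
        (g : TraceCoset b.2.1.1) = b.2.2.1 ∧ Syncs g.1 b.1.1 b.2.1.1 τ.1 := by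
    rintro ⟨⟨ρ, hρ⟩, ⟨σ, hσ⟩, ⟨c, g, rfl, hc⟩⟩
    obtain ⟨⟨τ, hτ⟩, hd⟩ := (sync_consistent_iff g.2 hPQ P.free_proc Q.free_proc).1 hc
    exact ⟨⟨τ, (Simple.exhaustive_par_iff g.2 hPQ hτ).2 ⟨hρ, hσ, hd⟩, hτ.internal⟩, g, rfl, hτ⟩
  choose F g hg hF using key
  refine ⟨Equiv.ofBijective F ⟨?_, ?_⟩⟩
  · intro b b' hbb'
    have h1 := hF b
    have h2 := hF b'
    have h3 := hg b
    have h4 := hg b'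
    rw [← hbb'] at h2
    generalize g b = k at *
    generalize g b' = k' at *
    obtain ⟨⟨ρ, hρ⟩, ⟨σ, hσ⟩, ⟨c, hc⟩⟩ := b
    obtain ⟨⟨ρ', hρ'⟩, ⟨σ', hσ'⟩, ⟨c', hc'⟩⟩ := b'
    obtain ⟨h5, h6⟩ := h1.left_right_unique hPQ h2
    simp only at h5 h6 h3 h4
    subst h5 h6
    have h7 : c = c' :=
      h3.symm.trans ((traceCoset_eq_iff.2 (h1.dualEvent_eq k.2 k'.2 hPQ h2)).trans h4)
    subst h7
    rfl
  · rintro ⟨τ, hτ, hi⟩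
    obtain ⟨k, hk, ρ, σ, hs⟩ := hi.exists_syncs hPQ Q.free_proc
    obtain ⟨hρ, hσ, hd⟩ := (Simple.exhaustive_par_iff hk hPQ hs).1 hτ
    let b : SyncTriple 𝕊 P Q := ⟨⟨ρ, hρ⟩, ⟨σ, hσ⟩, ⟨((⟨k, hk⟩ : (arena N).group) : TraceCoset σ),
      ⟨k, hk⟩, rfl, (sync_consistent_iff hk hPQ P.free_proc Q.free_proc).2 ⟨⟨τ, hs⟩, hd⟩⟩⟩
    refine ⟨b, Subtype.ext ?_⟩
    exact (hF b).unique hPQ (traceCoset_eq_iff.1 (hg b)) hs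

end Outcomes

end PiI

/-- For simple terms `P` and `Q` such that all locations in `P | Q` are distinct, the outcome of
`P | Q` is the outcome of the permuted synchronisation of `[P]` and the inverted `[Q]`. -/
theorem mainTheorem6 {𝕊 : Type v} [CommSemiring 𝕊] {N : Type u} [Finite N]
    (P Q : PiI.Simple N)
    (hloc : (PiI.Term.par (P.proc 𝕊) (Q.proc 𝕊)).locs.Nodup) :
    PiI.outcome (PiI.Term.par (P.proc 𝕊) (Q.proc 𝕊)) =
      OrderAlgebra.outcome 𝕊 (PiI.arena N)
        (OrderAlgebra.psync 𝕊 (PiI.arena N) (PiI.translate 𝕊 P)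
          (PiI.bar N 𝕊 (PiI.translate 𝕊 Q))) := by
  classical
  have hPQ : PiI.Wf (PiI.Term.par (P.proc 𝕊) (Q.proc 𝕊)) :=
    PiI.Simple.wf_proc (𝕊 := 𝕊) (P := PiI.Simple.par P Q) hloc
  obtain ⟨E⟩ := PiI.nonempty_syncTriple_equiv P Q hPQ
  have hfin : Finite (PiI.SyncTriple 𝕊 P Q) := Finite.of_equiv _ E.symm
  have := Fintype.ofFinite {ρ : PiI.Pretrace (P.proc 𝕊) // P.Exhaustive ρ}
  have := Fintype.ofFinite {σ : PiI.Pretrace (Q.proc 𝕊) // Q.Exhaustive σ}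
  rw [PiI.outcome_psync_translate]
  have hn : ((PiI.Simple.par P Q).proc 𝕊).locs.Nodup := hloc
  refine (PiI.Simple.outcome_eq_card hn).trans ?_
  rw [← Nat.card_congr E]
  have hfin1 : ∀ ρ : {ρ : PiI.Pretrace (P.proc 𝕊) // P.Exhaustive ρ},
      Finite (Σ σ : {σ : PiI.Pretrace (Q.proc 𝕊) // Q.Exhaustive σ},
        {c : PiI.TraceCoset σ.1 // PiI.CompatibleCoset ρ.1 σ.1 c}) :=
    fun ρ => Finite.of_injective (fun b => (⟨ρ, b⟩ : PiI.SyncTriple 𝕊 P Q))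
      fun _ _ h => by cases h; rfl
  have hfin2 : ∀ (ρ : {ρ : PiI.Pretrace (P.proc 𝕊) // P.Exhaustive ρ})
      (σ : {σ : PiI.Pretrace (Q.proc 𝕊) // Q.Exhaustive σ}),
      Finite {c : PiI.TraceCoset σ.1 // PiI.CompatibleCoset ρ.1 σ.1 c} := fun ρ σ =>
    have := hfin1 ρ
    Finite.of_injective (fun c => (⟨σ, c⟩ : Σ σ : {σ : PiI.Pretrace (Q.proc 𝕊) //
      Q.Exhaustive σ}, {c : PiI.TraceCoset σ.1 // PiI.CompatibleCoset ρ.1 σ.1 c}))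
      fun _ _ h => by cases h; rfl
  rw [Nat.card_sigma, Nat.cast_sum]
  refine Finset.sum_congr rfl fun ρ _ => ?_
  rw [Nat.card_sigma, Nat.cast_sum]
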